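/- Let $\mathbf C$ be an infinitary pretopos, i.e. an exact (regular, with effective equivalence relations) and infinitary extensive category. Let $\Phi$ be an irreducible simply laced root system of rank $\ge 4$ not of type $\mathsf D_4$ (so of type $\mathsf A_\ell$ with $\ell\ge 4$, $\mathsf D_\ell$ with $\ell\ge 5$, or $\mathsf E_6,\mathsf E_7,\mathsf E_8$). Let $R$ be a weakly unital $\Phi$-ring in $\mathbf C$, i.e. a not necessarily unital associative ring object, which is assumed to be commutative unless $\Phi$ is of type $\mathsf A_\ell$, having a weak unit. Here a weak unit is a subobject $\mathcal E\subseteq R$ such that, in the internal (geometric) logic of $\mathbf C$, 1. $\mathcal E\mathcal E\subseteq\mathcal E$ and $\mathcal E$ is central in $R$; 2. for all $\varepsilon,\eta\in\mathcal E$ there exist $\zeta,\varepsilon',\eta'\in\mathcal E$ with $\varepsilon=\varepsilon'\zeta$ and $\eta=\eta'\zeta$; 3. the multiplication morphisms $\mathcal E\times\mathcal E\to\mathcal E$ and $R\times\mathcal E\to R$ are epimorphisms; 4. if $p\varepsilon=0$ with $p\in R$ and $\varepsilon\in\mathcal E$, then there exist $\varepsilon',\varepsilon''\in\mathcal E$ with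 $\varepsilon=\varepsilon'\varepsilon''$ and $p\varepsilon'=0$. Let $\mathrm{St}(\Phi,R)$ be the Steinberg group, i.e. the group object of $\mathbf C$ presented by generators and relations as follows. For $\Phi=\mathsf A_\ell$ the generators are $x_{ij}(p)$ with $p\in R$ and distinct $i,j\in\{1,\dots,\ell+1\}$, and the relations are $$x_{ij}(p)\,x_{ij}(q)=x_{ij}(p+q),\qquad [x_{ij}(p),x_{jk}(q)]=x_{ik}(pq)\ \text{ for } i\ne k,\qquad [x_{ij}(p),x_{kl}(q)]=1\ \text{ for } j\ne k,\ i\ne l.$$ For $R$ commutative (in particular for $\Phi$ of type $\mathsf D_\ell$ or $\mathsf E_\ell$) the generators are $x_\alpha(p)$ with $\alpha\in\Phi$ and $p\in R$, and the relations are $$x_\alpha(p)\,x_\alpha(q)=x_\alpha(p+q),\qquad [x_\alpha(p),x_\beta(q)]=x_{\alpha+\beta}(N_{\alpha\beta}\,pq)\ \text{ for }\alpha+\beta\in\Phi,\qquad [x_\alpha(p),x_\beta(q)]=1\ \text{ for }\alpha+\beta\notin\Phi\cup\{0\},$$ where $N_{\alpha\beta}\in\{\pm1\}$ are the structure constants of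 any Chevalley basis of the complex simple Lie algebra of type $\Phi$. Then the group object $\mathrm{St}(\Phi,R)$ exists and is centrally closed: for every group object $X$ of $\mathbf C$, every epimorphic homomorphism $X\to\mathrm{St}(\Phi,R)$ with central kernel has a section that is a homomorphism. -/

import Mathlib

open CategoryTheory Limits MonoidalCategory CartesianMonoidalCategory

open scoped MonObj AddMonObj commutatorElement

universe w₁ w₂ w₃ v u

/-- An infinitary pretopos: a category that is exact (regular, and every internal equivalence
relation is the kernel pair of its coequalizer) and infinitary extensive (all small coproducts
exist, and they are disjoint and stable under pullback, that is, van Kampen). -/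
class InfinitaryPretopos (C : Type u) [Category.{v} C] : Prop extends Regular C where
  isEffectiveEquivalenceRelation {S X : C} (p₁ p₂ : S ⟶ X) [IsEquivalenceRelation p₁ p₂] :
    IsEffectiveEquivalenceRelation p₁ p₂
  hasCoproducts : HasCoproducts.{v} C
  isVanKampenColimit {J : Type v} {F : Discrete J ⥤ C} (c : Cocone F) (hc : IsColimit c) :
    IsVanKampenColimit c

section Rings

variable {C : Type u} [Category.{v} C] [CartesianMonoidalCategory C]

/-- A not necessarily unital associative ring object. The axioms are written as identities between
generalized elements `T ⟶ R`. -/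
class NonUnitalRingObj (R : C) extends AddGrpObj R where
  /-- The multiplication morphism. -/
  mulHom : R ⊗ R ⟶ R
  add_comm_hom {T : C} (p q : T ⟶ R) : p + q = q + p
  mul_assoc_hom {T : C} (p q r : T ⟶ R) :
    lift (lift p q ≫ mulHom) r ≫ mulHom = lift p (lift q r ≫ mulHom) ≫ mulHom
  mul_add_hom {T : C} (p q r : T ⟶ R) :
    lift p (q + r) ≫ mulHom = lift p q ≫ mulHom + lift p r ≫ mulHom
  add_mul_hom {T : C} (p q r : T ⟶ R) :
    lift (p + q) r ≫ mulHom = lift p r ≫ mulHom + lift q r ≫ mulHom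

/-- The generalized elements of a ring object at every stage form a ring. -/
instance NonUnitalRingObj.homRing {R : C} [NonUnitalRingObj R] {T : C} :
    NonUnitalRing (T ⟶ R) where
  __ := (Hom.addGroup : AddGroup (T ⟶ R))
  add_comm := NonUnitalRingObj.add_comm_hom
  mul p q := lift p q ≫ NonUnitalRingObj.mulHom
  left_distrib := NonUnitalRingObj.mul_add_hom
  right_distrib := NonUnitalRingObj.add_mul_hom
  mul_assoc := NonUnitalRingObj.mul_assoc_hom
  zero_mul p := by
    have h := NonUnitalRingObj.add_mul_hom (0 : T ⟶ R) 0 p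
    rw [add_zero] at h
    exact left_eq_add.mp h
  mul_zero p := by
    have h := NonUnitalRingObj.mul_add_hom p (0 : T ⟶ R) 0
    rw [add_zero] at h
    exact left_eq_add.mp h

/-- The subobject `E` of the ring object `R` is a weak unit. `E.Factors a` says that the
generalized element `a` of `R` lies in `E`. An existential quantifier of the internal (geometric)
logic means existence after passing to a cover, that is, along an epimorphism `T' ⟶ T`. -/
structure IsWeakUnit {R : C} [NonUnitalRingObj R] (E : Subobject R) : Prop where
  mul_mem {T : C} (a b : T ⟶ R) (ha : E.Factors a) (hb : E.Factors b) : E.Factors (a * b)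
  central {T : C} (a p : T ⟶ R) (ha : E.Factors a) : a * p = p * a
  exists_common_divisor {T : C} (a b : T ⟶ R) (ha : E.Factors a) (hb : E.Factors b) :
    ∃ (T' : C) (f : T' ⟶ T) (_ : Epi f) (z a' b' : T' ⟶ R),
      E.Factors z ∧ E.Factors a' ∧ E.Factors b' ∧ f ≫ a = a' * z ∧ f ≫ b = b' * z
  /-- The multiplication morphism `E × E ⟶ E` is an epimorphism. -/
  epi_mul_self (m : (E : C) ⊗ (E : C) ⟶ (E : C))
    (hm : m ≫ E.arrow = (fst (E : C) (E : C) ≫ E.arrow) * (snd (E : C) (E : C) ≫ E.arrow)) :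
    Epi m
  /-- The multiplication morphism `R × E ⟶ R` is an epimorphism. -/
  epi_mul : Epi (fst R (E : C) * (snd R (E : C) ≫ E.arrow))
  exists_factor_of_mul_eq_zero {T : C} (p a : T ⟶ R) (ha : E.Factors a) (h : p * a = 0) :
    ∃ (T' : C) (f : T' ⟶ T) (_ : Epi f) (a' a'' : T' ⟶ R),
      E.Factors a' ∧ E.Factors a'' ∧ f ≫ a = a' * a'' ∧ (f ≫ p) * a' = 0

/-- A ring object is weakly unital if it has a weak unit. -/
def WeaklyUnital (R : C) [NonUnitalRingObj R] : Prop :=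
  ∃ E : Subobject R, IsWeakUnit E

end Rings

section CentralExtensions

variable {C : Type u} [Category.{v} C] [CartesianMonoidalCategory C]

/-- A central extension of group objects: an epimorphic homomorphism with central kernel. -/
structure IsCentralExtension {X G : C} [GrpObj X] [GrpObj G] (f : X ⟶ G) : Prop where
  isMonHom : IsMonHom f
  epi : Epi f
  central {T : C} (k g : T ⟶ X) (hk : k ≫ f = 1) : k * g = g * k

/-- A group object is centrally closed if all its central extensions split. -/
def CentrallyClosed (G : C) [GrpObj G] : Prop :=
  ∀ (X : C) [GrpObj X] (f : X ⟶ G), IsCentralExtension f →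
    ∃ s : G ⟶ X, IsMonHom s ∧ s ≫ f = 𝟙 G

end CentralExtensions

section LinearSteinberg

variable {C : Type u} [Category.{v} C] [CartesianMonoidalCategory C]

/-- The Steinberg relations of type `A` of rank `n - 1` (indices from `1` to `n`) between morphisms
`x i j : R ⟶ G`. The commutator is `⁅g, h⁆ = g * h * g⁻¹ * h⁻¹`. -/
structure LinearSteinbergRelations {n : ℕ} {R G : C} [NonUnitalRingObj R] [GrpObj G]
    (x : ∀ i j : Fin n, i ≠ j → (R ⟶ G)) : Prop where
  add (i j : Fin n) (hij : i ≠ j) {T : C} (p q : T ⟶ R) :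
    (p ≫ x i j hij) * (q ≫ x i j hij) = (p + q) ≫ x i j hij
  commutator (i j k : Fin n) (hij : i ≠ j) (hjk : j ≠ k) (hik : i ≠ k) {T : C} (p q : T ⟶ R) :
    ⁅p ≫ x i j hij, q ≫ x j k hjk⁆ = (p * q) ≫ x i k hik
  commute (i j k l : Fin n) (hij : i ≠ j) (hkl : k ≠ l) (hjk : j ≠ k) (hil : i ≠ l)
    {T : C} (p q : T ⟶ R) : ⁅p ≫ x i j hij, q ≫ x k l hkl⁆ = 1

/-- The group object `G` with the root morphisms `x i j` is the Steinberg group of type `A` of rank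
`n - 1` over `R`: it is presented by the generators `x i j` and the Steinberg relations. -/
structure IsLinearSteinbergGroup {n : ℕ} {R G : C} [NonUnitalRingObj R] [GrpObj G]
    (x : ∀ i j : Fin n, i ≠ j → (R ⟶ G)) : Prop where
  relations : LinearSteinbergRelations x
  universal (H : C) [GrpObj H] (y : ∀ i j : Fin n, i ≠ j → (R ⟶ H))
    (hy : LinearSteinbergRelations y) :
    ∃! f : G ⟶ H, IsMonHom f ∧ ∀ (i j : Fin n) (hij : i ≠ j), x i j hij ≫ f = y i j hij

end LinearSteinberg

section RootSystems

variable {I : Type w₁} {M : Type w₂} {N : Type w₃} [AddCommGroup M] [Module ℝ M]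
  [AddCommGroup N] [Module ℝ N]

/-- A root system is simply laced if non-proportional roots `α`, `β` have
`2 (α, β) / (β, β)` equal to `0`, `1` or `-1`. -/
def RootIsSimplyLaced (P : RootPairing I ℝ M N) : Prop :=
  ∀ i j : I, P.root i ≠ P.root j → P.root i ≠ -P.root j →
    P.pairing i j = 0 ∨ P.pairing i j = 1 ∨ P.pairing i j = -1

/-- The root system has type `D₄`: with respect to some base its Cartan matrix is that of `D₄`. -/
def RootIsTypeD4 [Finite I] (P : RootPairing I ℝ M N) [P.IsCrystallographic] : Prop :=
  ∃ (b : P.Base) (e : b.support ≃ Fin 4), b.cartanMatrix = (CartanMatrix.D 4).submatrix e e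

/-- The elements `e i` (root vectors) and `h i` (coroots) form a Chevalley basis of the complex Lie
algebra `L` with the simply laced root system `P`, and `c` is its family of structure constants
(the values `c i j` matter only if the sum of the `i`-th and the `j`-th root is a root). -/
structure IsChevalleySystem (P : RootPairing I ℝ M N) [P.IsCrystallographic]
    {L : Type} [LieRing L] [LieAlgebra ℂ L] (e h : I → L) (c : I → I → ℤˣ) : Prop where
  linearIndependent : LinearIndependent ℂ e
  span_eq_top : Submodule.span ℂ (Set.range e ∪ Set.range h) = ⊤
  lie_h_h (i j : I) : ⁅h i, h j⁆ = 0
  lie_h_e (i j : I) : ⁅h i, e j⁆ = P.pairingIn ℤ j i • e j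
  lie_e_neg (i j : I) (hij : P.root j = -P.root i) : ⁅e i, e j⁆ = h i
  lie_e_e (i j k : I) (hk : P.root k = P.root i + P.root j) : ⁅e i, e j⁆ = (c i j : ℤ) • e k
  lie_e_e_eq_zero (i j : I) (h₀ : P.root i + P.root j ≠ 0)
    (hij : P.root i + P.root j ∉ Set.range P.root) : ⁅e i, e j⁆ = 0

/-- `c` is a family of structure constants of the simply laced root system `P`, i.e. that of some
Chevalley basis. -/
def IsStructureConstants (P : RootPairing I ℝ M N) [P.IsCrystallographic]
    (c : I → I → ℤˣ) : Prop :=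
  ∃ (L : Type) (_ : LieRing L) (_ : LieAlgebra ℂ L) (e h : I → L), IsChevalleySystem P e h c

variable {C : Type u} [Category.{v} C] [CartesianMonoidalCategory C]

/-- The Steinberg relations of the simply laced root system `P` with the structure constants `c`
between morphisms `x i : R ⟶ G`. The commutator is `⁅g, h⁆ = g * h * g⁻¹ * h⁻¹`. -/
structure SteinbergRelations (P : RootPairing I ℝ M N) (c : I → I → ℤˣ) {R G : C}
    [NonUnitalRingObj R] [GrpObj G] (x : I → (R ⟶ G)) : Prop where
  add (i : I) {T : C} (p q : T ⟶ R) : (p ≫ x i) * (q ≫ x i) = (p + q) ≫ x i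
  commutator (i j k : I) (hk : P.root k = P.root i + P.root j) {T : C} (p q : T ⟶ R) :
    ⁅p ≫ x i, q ≫ x j⁆ = ((c i j : ℤ) • (p * q)) ≫ x k
  commute (i j : I) (h₀ : P.root i + P.root j ≠ 0)
    (hij : P.root i + P.root j ∉ Set.range P.root) {T : C} (p q : T ⟶ R) :
    ⁅p ≫ x i, q ≫ x j⁆ = 1

/-- The group object `G` with the root morphisms `x i` is the Steinberg group of the simply laced
root system `P` over `R`: it is presented by the generators `x i` and the Steinberg relations. -/
structure IsSteinbergGroup (P : RootPairing I ℝ M N) (c : I → I → ℤˣ) {R G : C}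
    [NonUnitalRingObj R] [GrpObj G] (x : I → (R ⟶ G)) : Prop where
  relations : SteinbergRelations P c x
  universal (H : C) [GrpObj H] (y : I → (R ⟶ H)) (hy : SteinbergRelations P c y) :
    ∃! f : G ⟶ H, IsMonHom f ∧ ∀ i : I, x i ≫ f = y i

end RootSystems

-- Generalized elements carry the internal logic: `Locally` reads "there exists" as "after passing
-- to a cover of the canonical topology". Representables are sheaves for this topology, so an
-- element that exists locally and is unique exists globally (`Locally.exists_glue`). The covers
-- needed are coproduct injections and epimorphisms; every epimorphism of a pretopos is regular.
--
-- Existence of the group: words form the coproduct of the powers of `R`. The congruence generated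
-- by the relations is the union, over formal derivations, of the images of spans, so effectiveness
-- yields the quotient monoid. Its generators are invertible, hence it is a group.
--
-- Central closedness: let `f : X ⟶ G` be a central extension. The commutator of lifts does not
-- depend on the lifts, so every decomposition `t = i + j` of a root gives a canonical element
-- `rootBracket` over `x t` at `p * q`. A section exists once this element depends only on `p * q`,
-- neither on the two factors nor on the decomposition, and lifts commute whenever the relations
-- demand it (`IsRootGroup.exists_section`).
--
-- The main tool is a form of the Hall–Witt identity (`rootBracket_mul_eq_iff`). If `t = a + b + c`
-- and the root elements of `a` and `c` commute, then the two bracketings of a triple product agree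
-- if and only if the corresponding lifts over `a + b` and `b + c` commute. Lifts commute, in turn,
-- when one root splits into summands whose root elements commute with those of the other. Comparing
-- bracketings shows that the brackets are balanced, and the weak unit makes `R` behave like `R ⊗_R
-- R`, so a balanced additive map factors through the product (`IsWeakUnit.exists_factor_mul`).
--
-- In type `A` with at least five indices, a spare index provides all decompositions. In the other
-- types the obstacle is a pair of orthogonal roots with the same neighbors modulo 2, since
-- splitting into summands orthogonal to the other root then fails. Outside `D₄` a decomposition
-- avoiding such pairs always exists, because three mutually orthogonal roots with the same
-- neighbors, all pairing to `-1` with one root, force `D₄`. This settles the brackets, and the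
-- Hall–Witt criterion read backwards gives the remaining commutations.

universe w

/-! ### Local existence and gluing in the canonical topology -/

section Locality

variable {C : Type u} [Category.{v} C]

/-- A property of the morphisms into `T` holds locally if it holds on a sieve that covers `T` in
the canonical topology. -/
def Locally (T : C) (P : ∀ ⦃T' : C⦄, (T' ⟶ T) → Prop) : Prop :=
  ∃ S ∈ Sheaf.canonicalTopology C T, ∀ ⦃T' : C⦄ (f : T' ⟶ T), S f → P f

namespace Locally

variable {T : C} {P Q : ∀ ⦃T' : C⦄, (T' ⟶ T) → Prop}

theorem of_forall (h : ∀ ⦃T' : C⦄ (f : T' ⟶ T), P f) : Locally T P :=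
  ⟨⊤, (Sheaf.canonicalTopology C).top_mem T, fun _ f _ => h f⟩

theorem mono (hP : Locally T P) (h : ∀ ⦃T' : C⦄ (f : T' ⟶ T), P f → Q f) : Locally T Q := by
  obtain ⟨S, hS, hSP⟩ := hP
  exact ⟨S, hS, fun T' f hf => h f (hSP f hf)⟩

theorem and (hP : Locally T P) (hQ : Locally T Q) : Locally T (fun _ f => P f ∧ Q f) := by
  obtain ⟨S, hS, hSP⟩ := hP
  obtain ⟨S', hS', hSQ⟩ := hQ
  exact ⟨S ⊓ S', (Sheaf.canonicalTopology C).intersection_covering hS hS',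
    fun T' f hf => ⟨hSP f hf.1, hSQ f hf.2⟩⟩

theorem pullback (hP : Locally T P) {T₁ : C} (g : T₁ ⟶ T) : Locally T₁ (fun _ f => P (f ≫ g)) := by
  obtain ⟨S, hS, hSP⟩ := hP
  exact ⟨S.pullback g, (Sheaf.canonicalTopology C).pullback_stable g hS,
    fun T' f hf => hSP (f ≫ g) hf⟩

theorem bind (hP : Locally T P)
    (h : ∀ ⦃T' : C⦄ (f : T' ⟶ T), P f → Locally T' (fun _ g => Q (g ≫ f))) : Locally T Q := by
  obtain ⟨S, hS, hSP⟩ := hP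
  choose V hV hVQ using fun (T' : C) (f : T' ⟶ T) (hf : S f) => h f (hSP f hf)
  refine ⟨Sieve.bind S.arrows fun T' f hf => V T' f hf,
    (Sheaf.canonicalTopology C).bind_covering hS fun T' f hf => hV T' f hf, ?_⟩
  rintro T' _ ⟨Y, g, f, hf, hg, rfl⟩
  exact hVQ _ f hf g hg

theorem eq {X : C} {a b : T ⟶ X} (h : Locally T (fun _ f => f ≫ a = f ≫ b)) : a = b := by
  obtain ⟨S, hS, hSP⟩ := h
  exact ((Sheaf.isSheaf_yoneda_obj X) S hS).isSeparatedFor.ext fun T' f hf => hSP f hf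

/-- A generalized element that exists locally and is unique exists globally. -/
theorem exists_glue {X : C} {P : ∀ ⦃T' : C⦄, (T' ⟶ T) → (T' ⟶ X) → Prop}
    (hP : ∀ ⦃T' T'' : C⦄ (f : T' ⟶ T) (g : T'' ⟶ T') (x : T' ⟶ X), P f x → P (g ≫ f) (g ≫ x))
    (huniq : ∀ ⦃T' : C⦄ (f : T' ⟶ T) (x x' : T' ⟶ X), P f x → P f x' → x = x')
    (hex : Locally T (fun _ f => ∃ x, P f x)) :
    ∃ x : T ⟶ X, Locally T (fun _ f => P f (f ≫ x)) := by
  obtain ⟨S, hS, hSP⟩ := hex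
  choose x hx using hSP
  have hc : Presieve.FamilyOfElements.Compatible (P := yoneda.obj X) (R := S.arrows) x := by
    intro Y₁ Y₂ Z g₁ g₂ f₁ f₂ h₁ h₂ e
    have h1 := hP _ g₁ _ (hx f₁ h₁)
    have h2 := hP _ g₂ _ (hx f₂ h₂)
    rw [← e] at h2
    exact huniq _ _ _ h1 h2
  obtain ⟨y, hy, -⟩ := (Sheaf.isSheaf_yoneda_obj X) S hS x hc
  refine ⟨y, S, hS, fun T' f hf => ?_⟩
  have : f ≫ y = x f hf := hy f hf
  change P f (f ≫ y)
  rw [this]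
  exact hx f hf

theorem lift_mono {I X : C} (m : I ⟶ X) [Mono m] {a : T ⟶ X}
    (h : Locally T (fun _ f => ∃ b, b ≫ m = f ≫ a)) : ∃ b, b ≫ m = a := by
  obtain ⟨b, hb⟩ := exists_glue (P := fun T' f b => b ≫ m = f ≫ a)
    (fun T' T'' f g x hx => by rw [Category.assoc, hx, Category.assoc])
    (fun T' f x x' hx hx' => by rw [← cancel_mono m, hx, hx']) h
  exact ⟨b, eq (by simpa only [Category.assoc] using hb)⟩

end Locally

theorem isSheafFor_yoneda_of_isColimit {J : Type v} {X : J → C} {c : Cofan X} (hc : IsColimit c)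
    (Z : C) : (Presieve.ofArrows X c.inj).IsSheafFor (yoneda.obj Z) := by
  intro x _
  refine ⟨Cofan.IsColimit.desc hc fun j => x (c.inj j) (.mk j), ?_, ?_⟩
  · rintro Y f ⟨j⟩
    exact Cofan.IsColimit.fac hc _ j
  · intro y hy
    refine Cofan.IsColimit.hom_ext hc _ _ fun j => ?_
    rw [Cofan.IsColimit.fac hc]
    exact hy _ (.mk j)

end Locality

/-! ### Regular epimorphisms and coproduct injections as covers -/

section Covers

variable {C : Type u} [Category.{v} C] [InfinitaryPretopos C]

instance InfinitaryPretopos.hasCoproduct {J : Type v} (X : J → C) : HasCoproduct X :=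
  InfinitaryPretopos.hasCoproducts J |>.has_colimit _

/-- Pullbacks of a regular epimorphism are again regular, hence effective, so the sieve it generates
satisfies the sheaf condition for representables after every base change. -/
theorem Locally.of_isRegularEpi {T T₀ : C} (p : T₀ ⟶ T) [IsRegularEpi p] :
    Locally T (fun _ f => ∃ g, g ≫ p = f) := by
  refine ⟨Sieve.generate (Presieve.singleton p), ?_, ?_⟩
  · refine Sheaf.mem_finestTopology_of_forall_isSheafFor ?_
    rintro _ ⟨X, rfl⟩ Y f
    have : (Presieve.singleton p).HasPullbacks f := ⟨fun _ => inferInstance⟩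
    rw [← Sieve.pullbackArrows_comm, Presieve.pullback_singleton, ← Presieve.isSheafFor_iff_generate]
    have : EffectiveEpi (Limits.pullback.snd p f) := (isRegularEpi_iff_effectiveEpi _).mp inferInstance
    exact Presieve.IsSheafFor.singleton_of_isRepresentable_of_effectiveEpi _ _
  · rintro T' f ⟨Y, g, h, ⟨⟩, rfl⟩
    exact ⟨g, rfl⟩

/-- Van Kampen coproducts are universal: the pullbacks of the injections along any morphism exhibit
its domain as a coproduct, so the injections generate a covering sieve. -/
theorem Locally.of_sigma {J : Type v} (X : J → C) {T : C} (a : T ⟶ ∐ X) :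
    Locally T (fun _ f => ∃ (j : J) (b : _ ⟶ X j), b ≫ Sigma.ι X j = f ≫ a) := by
  refine Locally.pullback (P := fun _ f => ∃ (j : J) (b : _ ⟶ X j), b ≫ Sigma.ι X j = f) ?_ a
  refine ⟨Sieve.generate (Presieve.ofArrows X (Sigma.ι X)), ?_, ?_⟩
  · refine Sheaf.mem_finestTopology_of_forall_isSheafFor ?_
    rintro _ ⟨Z, rfl⟩ Y f
    have : (Presieve.ofArrows X (Sigma.ι X)).HasPullbacks f := ⟨fun _ => inferInstance⟩
    rw [← Sieve.pullbackArrows_comm, ← Presieve.ofArrows_pullback,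
      ← Presieve.isSheafFor_iff_generate]
    have hu := (InfinitaryPretopos.isVanKampenColimit _ (coproductIsCoproduct X)).isUniversal
    let d : Cofan (fun j => Limits.pullback (Sigma.ι X j) f) :=
      Cofan.mk Y fun j => Limits.pullback.snd (Sigma.ι X j) f
    obtain ⟨hd⟩ := hu.nonempty_isColimit_of_isPullback_right (fun j => Sigma.ι X j) (𝟙 _) f
      (fun j => Limits.pullback.fst (Sigma.ι X j) f) (fun j => Limits.pullback.snd (Sigma.ι X j) f)
      (fun j => IsPullback.of_hasPullback _ _) (IsPullback.id_horiz f).flip d (Iso.refl _)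
      (fun j => by simp)
      (fun j => by simp [d, Cofan.inj, pullback.condition]) (fun j => by simp [d])
    exact isSheafFor_yoneda_of_isColimit hd Z
  · rintro T' f ⟨Y, g, h, ⟨j⟩, rfl⟩
    exact ⟨j, g, rfl⟩

instance InfinitaryPretopos.hasInitial : HasInitial C := by
  have := InfinitaryPretopos.hasCoproducts (C := C) PEmpty
  exact hasColimitsOfShape_of_equivalence
    (Discrete.equivalence (Equiv.equivOfIsEmpty PEmpty.{v + 1} PEmpty.{1}))

/-- If a generalized element lies in two different summands of a coproduct, then its stage is
empty. -/
theorem Locally.of_sigma_ne {J : Type v} (X : J → C) {T : C} {i j : J} (hij : i ≠ j)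
    (a : T ⟶ X i) (b : T ⟶ X j) (h : a ≫ Sigma.ι X i = b ≫ Sigma.ι X j)
    (P : ∀ ⦃T' : C⦄, (T' ⟶ T) → Prop) : Locally T P := by
  have hp := isPullback_initial_to_of_cofan_isVanKampen
    (InfinitaryPretopos.isVanKampenColimit _ (coproductIsCoproduct X)) ⟨i⟩ ⟨j⟩ (by simpa using hij)
  -- The stage maps to the initial object, which is covered by the empty family, so any property
  -- holds locally.
  exact (Locally.of_sigma (PEmpty.elim : PEmpty.{v + 1} → C)
    (hp.lift a b h ≫ initial.to _)).mono fun T' f ⟨j, _⟩ => j.elim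

theorem Sigma.mono_ι_of_infinitaryPretopos {J : Type v} (X : J → C) (j : J) :
    Mono (Sigma.ι X j) :=
  mono_of_cofan_isVanKampen
    (InfinitaryPretopos.isVanKampenColimit _ (coproductIsCoproduct X)) ⟨j⟩

end Covers

/-! ### Quotients by internally generated equivalence relations -/

section Quotients

variable {C : Type u} [Category.{v} C]

/-- Two generalized elements are related by a span if locally they are the images of a generalized
element of the span. -/
def SpanRel {S D : C} (p₁ p₂ : S ⟶ D) {T : C} (a b : T ⟶ D) : Prop :=
  Locally T fun _ f => ∃ s, s ≫ p₁ = f ≫ a ∧ s ≫ p₂ = f ≫ b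

variable [CartesianMonoidalCategory C] [InfinitaryPretopos C]

theorem exists_factor_image_iff {S D : C} (p₁ p₂ : S ⟶ D) {T : C} (a b : T ⟶ D) :
    (∃ t, t ≫ (Regular.strongEpiMonoFactorisation (lift p₁ p₂)).m ≫ fst D D = a ∧
      t ≫ (Regular.strongEpiMonoFactorisation (lift p₁ p₂)).m ≫ snd D D = b) ↔
    SpanRel p₁ p₂ a b := by
  set F := Regular.strongEpiMonoFactorisation (lift p₁ p₂) with hF
  have hfac : F.e ≫ F.m = lift p₁ p₂ := F.fac
  constructor
  · rintro ⟨t, rfl, rfl⟩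
    refine ((Locally.of_isRegularEpi F.e).pullback t).mono ?_
    rintro T' f ⟨g, hg⟩
    refine ⟨g, ?_, ?_⟩
    · rw [← Category.assoc f, ← hg, Category.assoc, reassoc_of% hfac, lift_fst]
    · rw [← Category.assoc f, ← hg, Category.assoc, reassoc_of% hfac, lift_snd]
  · intro h
    obtain ⟨t, ht⟩ := Locally.lift_mono (T := T) F.m (a := lift a b) (h.mono (by
      rintro T' f ⟨s, h₁, h₂⟩
      exact ⟨s ≫ F.e, by rw [Category.assoc, hfac, comp_lift, comp_lift, h₁, h₂]⟩))
    exact ⟨t, by rw [reassoc_of% ht, lift_fst], by rw [reassoc_of% ht, lift_snd]⟩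

/-- The quotient by the equivalence relation generated, in the internal logic, by a span. -/
theorem exists_quotient_of_span {S D : C} (p₁ p₂ : S ⟶ D)
    (hrefl : ∀ {T : C} (a : T ⟶ D), SpanRel p₁ p₂ a a)
    (hsymm : ∀ {T : C} (a b : T ⟶ D), SpanRel p₁ p₂ a b → SpanRel p₁ p₂ b a)
    (htrans : ∀ {T : C} (a b c : T ⟶ D), SpanRel p₁ p₂ a b → SpanRel p₁ p₂ b c →
      SpanRel p₁ p₂ a c) :
    ∃ (Q : C) (q : D ⟶ Q), IsRegularEpi q ∧
      ∀ {T : C} (a b : T ⟶ D), a ≫ q = b ≫ q ↔ SpanRel p₁ p₂ a b := by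
  set F := Regular.strongEpiMonoFactorisation (lift p₁ p₂) with hF
  have key := fun {T : C} (a b : T ⟶ D) => exists_factor_image_iff p₁ p₂ a b
  rw [← hF] at key
  set d₁ := F.m ≫ fst D D with hd₁
  set d₂ := F.m ≫ snd D D with hd₂
  have hself : ∀ {T : C} (t : T ⟶ F.I), SpanRel p₁ p₂ (t ≫ d₁) (t ≫ d₂) :=
    fun t => (key _ _).mp ⟨t, rfl, rfl⟩
  obtain ⟨r, hr₁, hr₂⟩ := (key _ _).mpr (hrefl (𝟙 D))
  obtain ⟨s, hs₁, hs₂⟩ := (key _ _).mpr (hsymm _ _ (hself (𝟙 F.I)))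
  have hself' := hself (pullback.snd d₂ d₁)
  rw [← pullback.condition] at hself'
  obtain ⟨t, ht₁, ht₂⟩ := (key _ _).mpr (htrans _ _ _ (hself (pullback.fst d₂ d₁)) hself')
  -- The image of the span in `D ⊗ D` is a jointly monic pair. Its structure morphisms come from the
  -- properties of `SpanRel` applied to generic elements.
  have hE : EquivalenceRelation d₁ d₂ :=
    { right_cancellation := fun Y f g h₁ h₂ => by
        rw [← cancel_mono F.m]
        exact CartesianMonoidalCategory.hom_ext _ _ (by simpa [hd₁] using h₁)
          (by simpa [hd₂] using h₂)
      r := r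
      reflexivity₁ := hr₁
      reflexivity₂ := hr₂
      s := s
      symmetry₁ := by simpa using hs₁
      symmetry₂ := by simpa using hs₂
      c := PullbackCone.mk _ _ pullback.condition
      isLimit := pullbackIsPullback d₂ d₁
      t := t
      transitivity₁ := ht₁
      transitivity₂ := ht₂ }
  have : IsEquivalenceRelation d₁ d₂ := ⟨⟨hE⟩⟩
  obtain ⟨⟨e⟩⟩ := InfinitaryPretopos.isEffectiveEquivalenceRelation d₁ d₂
  refine ⟨e.B, e.π, inferInstance, fun a b => ?_⟩
  rw [← key]
  constructor
  · intro h
    exact ⟨e.isKernelPair.lift a b h, e.isKernelPair.lift_fst a b h, e.isKernelPair.lift_snd a b h⟩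
  · rintro ⟨t, rfl, rfl⟩
    simpa only [Category.assoc] using congr(t ≫ $(e.isKernelPair.w))

end Quotients

/-! ### Epimorphisms in a pretopos are regular -/

section Balanced

variable {C : Type u} [Category.{v} C] [InfinitaryPretopos C]

instance InfinitaryPretopos.hasBinaryCoproducts : HasBinaryCoproducts C :=
  have := InfinitaryPretopos.hasCoproducts (C := C) (ULift.{v} WalkingPair)
  hasColimitsOfShape_of_equivalence (Discrete.equivalence Equiv.ulift)

theorem Locally.coprod {A B T : C} (a : T ⟶ A ⨿ B) :
    Locally T fun _ f => (∃ x, x ≫ coprod.inl = f ≫ a) ∨ ∃ x, x ≫ coprod.inr = f ≫ a := by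
  let X : ULift.{v} Bool → C := fun b => if b.down then A else B
  let φ : A ⨿ B ⟶ ∐ X := coprod.desc (Sigma.ι X ⟨true⟩) (Sigma.ι X ⟨false⟩)
  let ψ : ∐ X ⟶ A ⨿ B := Sigma.desc fun b => match b with
    | ⟨true⟩ => (coprod.inl : A ⟶ A ⨿ B)
    | ⟨false⟩ => (coprod.inr : B ⟶ A ⨿ B)
  have hφψ : φ ≫ ψ = 𝟙 _ := by ext <;> simp [φ, ψ]
  refine (Locally.of_sigma X (a ≫ φ)).mono ?_
  rintro T' f ⟨⟨⟨⟩⟩, x, hx⟩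
  · refine .inr ⟨x, ?_⟩
    have := congr($hx ≫ ψ)
    simpa [ψ, hφψ] using this
  · refine .inl ⟨x, ?_⟩
    have := congr($hx ≫ ψ)
    simpa [ψ, hφψ] using this

theorem Locally.of_coprod_inl_eq_inr {A B T : C} (a : T ⟶ A) (b : T ⟶ B)
    (h : a ≫ (coprod.inl : A ⟶ A ⨿ B) = b ≫ coprod.inr)
    (P : ∀ ⦃T' : C⦄, (T' ⟶ T) → Prop) : Locally T P := by
  let X : ULift.{v} Bool → C := fun b => if b.down then A else B
  let φ : A ⨿ B ⟶ ∐ X := coprod.desc (Sigma.ι X ⟨true⟩) (Sigma.ι X ⟨false⟩)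
  refine Locally.of_sigma_ne X (i := ⟨true⟩) (j := ⟨false⟩) (by simp) a b ?_ P
  have := congr($h ≫ φ)
  rw [Category.assoc, Category.assoc, coprod.inl_desc, coprod.inr_desc] at this
  exact this

variable [CartesianMonoidalCategory C]

/-- In an infinitary pretopos, a monomorphism that is an epimorphism is an isomorphism. -/
theorem InfinitaryPretopos.isIso_of_mono_of_epi {A B : C} (m : A ⟶ B) [Mono m] [Epi m] :
    IsIso m := by
  have l₁ := fun {X Y W Z : C} (f : X ⟶ W) (g : Y ⟶ W) (h : Z ⟶ X) =>
    congr(h ≫ $(coprod.inl_desc f g))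
  have l₂ := fun {X Y W Z : C} (f : X ⟶ W) (g : Y ⟶ W) (h : Z ⟶ Y) =>
    congr(h ≫ $(coprod.inr_desc f g))
  let s₂ : B ⨿ B ⟶ B ⨿ B := coprod.desc coprod.inr coprod.inl
  let s₁ : A ⨿ A ⟶ A ⨿ A := coprod.desc coprod.inr coprod.inl
  have hs₂ : s₂ ≫ s₂ = 𝟙 _ := by ext <;> simp [coprod.inl_desc, coprod.inr_desc, s₂]
  let k : A ⨿ A ⟶ B ⨿ B := coprod.map m m
  have hk : s₁ ≫ k = k ≫ s₂ := by ext <;> simp [coprod.inl_desc, coprod.inr_desc, s₁, k, s₂]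
  -- The quotient by this span is the amalgamated sum of two copies of `B` along `A`: the summand `A
  -- ⨿ A` identifies the two copies of each element of `A`, in both directions.
  let p₁ : (B ⨿ B) ⨿ (A ⨿ A) ⟶ B ⨿ B := coprod.desc (𝟙 _) k
  let p₂ : (B ⨿ B) ⨿ (A ⨿ A) ⟶ B ⨿ B := coprod.desc (𝟙 _) (k ≫ s₂)
  have key : ∀ {T : C} (a b : T ⟶ B ⨿ B), SpanRel p₁ p₂ a b ↔
      Locally T fun _ f => f ≫ a = f ≫ b ∨ ∃ x, x ≫ k = f ≫ a ∧ f ≫ b = f ≫ a ≫ s₂ := by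
    intro T a b
    constructor
    · intro h
      refine h.bind ?_
      rintro T' f ⟨s, h₁, h₂⟩
      refine (Locally.coprod s).mono ?_
      rintro T'' g (⟨x, hx⟩ | ⟨x, hx⟩)
      · left
        rw [Category.assoc, Category.assoc, ← h₁, ← h₂, ← reassoc_of% hx, ← reassoc_of% hx]
        simp [l₁, p₁, p₂]
      · right
        refine ⟨x, ?_, ?_⟩
        · rw [Category.assoc, ← h₁, ← reassoc_of% hx]
          simp [l₂, p₁]
        · rw [Category.assoc, Category.assoc, ← h₂, ← reassoc_of% h₁, ← reassoc_of% hx,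
            ← reassoc_of% hx]
          simp [l₂, p₁, p₂]
    · intro h
      refine h.mono ?_
      rintro T' f (h | ⟨x, hx, h⟩)
      · exact ⟨f ≫ a ≫ coprod.inl, by simp [l₁, p₁], by simp [l₁, p₂, h]⟩
      · exact ⟨x ≫ coprod.inr, by simp [l₂, p₁, hx], by simp [l₂, p₂, h, reassoc_of% hx]⟩
  obtain ⟨Q, q, -, hq⟩ := exists_quotient_of_span p₁ p₂
    (fun a => (key _ _).mpr (Locally.of_forall fun _ _ => .inl rfl))
    (fun a b h => by
      rw [key] at h ⊢
      refine h.mono ?_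
      rintro T' f (h | ⟨x, hx, h⟩)
      · exact .inl h.symm
      · exact .inr ⟨x ≫ s₁, by rw [Category.assoc, hk, reassoc_of% hx, h],
          by rw [reassoc_of% h, hs₂, Category.comp_id]⟩)
    (fun a b c h h' => by
      rw [key] at h h' ⊢
      refine (h.and h').mono ?_
      rintro T' f ⟨h | ⟨x, hx, h⟩, h' | ⟨x', hx', h'⟩⟩
      · exact .inl (h.trans h')
      · exact .inr ⟨x', by rw [hx', h], by rw [h', reassoc_of% h]⟩
      · exact .inr ⟨x, hx, by rw [← h', h]⟩
      · exact .inl (by rw [h', reassoc_of% h, hs₂, Category.comp_id]))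
  have h₁ : m ≫ coprod.inl ≫ q = m ≫ coprod.inr ≫ q := by
    rw [← Category.assoc, ← Category.assoc, hq, key]
    exact Locally.of_forall fun _ f => .inr ⟨f ≫ coprod.inl, by simp [k], by simp [l₁, s₂]⟩
  -- Since `m` is an epimorphism, the two injections of `B` agree in the amalgamated sum. By
  -- disjointness, each stage is then either empty or maps into `A`, so `m` splits.
  rw [cancel_epi, hq, key] at h₁
  obtain ⟨s, hs⟩ := Locally.lift_mono m (a := 𝟙 B) (h₁.bind (by
    rintro T' f (h | ⟨x, hx, -⟩)
    · exact Locally.of_coprod_inl_eq_inr f f h _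
    · refine Locally.of_forall fun T'' g => ⟨g ≫ x ≫ coprod.desc (𝟙 A) (𝟙 A), ?_⟩
      have := congr(g ≫ $hx ≫ coprod.desc (𝟙 B) (𝟙 B))
      simpa [k, l₁, coprod.desc_comp] using this))
  have := IsSplitEpi.mk' ⟨s, hs⟩
  exact isIso_of_mono_of_isSplitEpi m

/-- In an infinitary pretopos, every epimorphism is regular. -/
theorem InfinitaryPretopos.isRegularEpi_of_epi {X Y : C} (f : X ⟶ Y) [Epi f] :
    IsRegularEpi f := by
  have : ExtremalEpi f :=
    { isIso := fun p i fac _ => by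
        have : Epi (p ≫ i) := fac ▸ ‹Epi f›
        have := epi_of_epi p i
        exact InfinitaryPretopos.isIso_of_mono_of_epi i }
  infer_instance

theorem Locally.of_epi {T T₀ : C} (p : T₀ ⟶ T) [Epi p] :
    Locally T (fun _ f => ∃ g, g ≫ p = f) :=
  have := InfinitaryPretopos.isRegularEpi_of_epi p
  Locally.of_isRegularEpi p

end Balanced

/-! ### The object of words and its quotient by relations -/

section Words

variable {C : Type u} [Category.{v} C] {I : Type v} {R P : C}

/-- Words whose letters are pairs of an index and a generalized element of `R`. -/
abbrev StageWord (I : Type v) (R T : C) : Type v := FreeMonoid (I × (T ⟶ R))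

/-- The restriction of words along a morphism of stages. -/
def StageWord.restrict {T T' : C} (g : T' ⟶ T) : StageWord I R T →* StageWord I R T' :=
  FreeMonoid.map fun a => (a.1, g ≫ a.2)

theorem StageWord.restrict_of {T T' : C} (g : T' ⟶ T) (a : I × (T ⟶ R)) :
    restrict g (FreeMonoid.of a) = FreeMonoid.of (a.1, g ≫ a.2) :=
  FreeMonoid.map_of _ _

theorem StageWord.restrict_comp {T T' T'' : C} (g : T' ⟶ T) (h : T'' ⟶ T')
    (l : StageWord I R T) : restrict h (restrict g l) = restrict (h ≫ g) l := by
  induction l using FreeMonoid.inductionOn' with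
  | one => simp
  | of_mul a l ih => simp [restrict_of, ih]

theorem StageWord.restrict_id {T : C} (l : StageWord I R T) : restrict (𝟙 T) l = l := by
  induction l using FreeMonoid.inductionOn' with
  | one => simp
  | of_mul a l ih => simp [restrict_of, ih]

/-- The congruence on words generated by a set of relations with parameters from `P`. -/
def stageCon (rels : Set (StageWord I R P × StageWord I R P)) (T : C) : Con (StageWord I R T) :=
  conGen fun a b => ∃ l ∈ rels, ∃ t : T ⟶ P, a = .restrict t l.1 ∧ b = .restrict t l.2

theorem stageCon_restrict {rels : Set (StageWord I R P × StageWord I R P)} {T T' : C}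
    (g : T' ⟶ T) {a b : StageWord I R T} (h : stageCon rels T a b) :
    stageCon rels T' (.restrict g a) (.restrict g b) := by
  refine (Con.conGen_le (c := Con.comap (StageWord.restrict g) (map_mul _)
    (stageCon rels T'))).mpr ?_ h
  rintro _ _ ⟨l, hl, t, rfl, rfl⟩
  refine ConGen.Rel.of _ _ ⟨l, hl, g ≫ t, ?_, ?_⟩ <;> rw [StageWord.restrict_comp]

variable [CartesianMonoidalCategory C]

/-- The product of copies of `R`. -/
def powObj (R : C) : List I → C
  | [] => 𝟙_ C
  | _ :: w => R ⊗ powObj R w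

/-- The generalized element of a power of `R` given by a word. -/
def wordCode {T : C} : List (I × (T ⟶ R)) → Σ w : List I, (T ⟶ powObj R w)
  | [] => ⟨[], toUnit T⟩
  | a :: l => ⟨a.1 :: (wordCode l).1, lift a.2 (wordCode l).2⟩

/-- The word given by a generalized element of a power of `R`. -/
def wordDecode {T : C} : (w : List I) → (T ⟶ powObj R w) → List (I × (T ⟶ R))
  | [], _ => []
  | i :: w, a => (i, a ≫ fst R (powObj R w)) :: wordDecode w (a ≫ snd R (powObj R w))

theorem wordDecode_wordCode {T : C} (l : List (I × (T ⟶ R))) :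
    wordDecode (wordCode l).1 (wordCode l).2 = l := by
  induction l with
  | nil => rfl
  | cons a l ih =>
    change (a.1, lift a.2 (wordCode l).2 ≫ fst R (powObj R _)) ::
      wordDecode _ (lift a.2 (wordCode l).2 ≫ snd R (powObj R _)) = _
    rw [lift_fst, lift_snd, ih]

theorem wordCode_wordDecode {T : C} (w : List I) (a : T ⟶ powObj R w) :
    wordCode (wordDecode w a) = ⟨w, a⟩ := by
  induction w with
  | nil => exact Sigma.ext rfl (heq_of_eq (toUnit_unique _ _))
  | cons i w ih =>
    change (⟨i :: (wordCode (wordDecode w (a ≫ snd R (powObj R w)))).1,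
      lift (a ≫ fst R (powObj R w)) (wordCode (wordDecode w (a ≫ snd R (powObj R w)))).2⟩ :
        Σ w : List I, (T ⟶ powObj R w)) = _
    rw [ih]
    exact Sigma.ext rfl (heq_of_eq (CartesianMonoidalCategory.hom_ext _ _ (lift_fst _ _)
      (lift_snd _ _)))

theorem wordCode_restrict {T T' : C} (g : T' ⟶ T) (l : StageWord I R T) :
    wordCode (StageWord.restrict g l).toList =
      ⟨(wordCode l.toList).1, g ≫ (wordCode l.toList).2⟩ := by
  induction l using FreeMonoid.inductionOn' with
  | one => exact Sigma.ext rfl (heq_of_eq (toUnit_unique _ _))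
  | of_mul a l ih =>
    rw [map_mul, StageWord.restrict_of, FreeMonoid.toList_of_mul, FreeMonoid.toList_of_mul]
    change (⟨_ :: (wordCode (StageWord.restrict g l).toList).1,
      lift _ (wordCode (StageWord.restrict g l).toList).2⟩ : Σ w : List I, (T' ⟶ powObj R w)) = _
    rw [ih]
    exact Sigma.ext rfl (heq_of_eq (comp_lift _ _ _).symm)

variable [InfinitaryPretopos C]

/-- The object of words. -/
noncomputable abbrev wordObj (I : Type v) (R : C) : C := ∐ (powObj R : List I → C)

/-- The generalized element of the object of words given by a word. -/
noncomputable def wordHom {T : C} (l : StageWord I R T) : T ⟶ wordObj I R :=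
  (wordCode l.toList).2 ≫ Sigma.ι (powObj R : List I → C) (wordCode l.toList).1

theorem comp_wordHom {T T' : C} (g : T' ⟶ T) (l : StageWord I R T) :
    g ≫ wordHom l = wordHom (.restrict g l) := by
  rw [wordHom, wordHom, wordCode_restrict]
  exact (Category.assoc _ _ _).symm

theorem Locally.exists_wordHom {T : C} (a : T ⟶ wordObj I R) :
    Locally T fun _ f => ∃ l : StageWord I R _, wordHom l = f ≫ a := by
  refine (Locally.of_sigma _ a).mono ?_
  rintro T' f ⟨w, b, hb⟩
  refine ⟨.ofList (wordDecode w b), ?_⟩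
  rw [wordHom, FreeMonoid.toList_ofList, wordCode_wordDecode]
  exact hb

/-- Equality of the words themselves can fail at an empty stage, where words of different shapes
define the same morphism; hence the restriction to a cover. -/
theorem Locally.of_wordHom_eq {T : C} {l l' : StageWord I R T} (h : wordHom l = wordHom l') :
    Locally T fun _ f => StageWord.restrict f l = StageWord.restrict f l' := by
  have hl := wordDecode_wordCode l.toList
  have hl' := wordDecode_wordCode l'.toList
  unfold wordHom at h
  generalize wordCode l.toList = s at h hl
  generalize wordCode l'.toList = s' at h hl'
  obtain ⟨w, a⟩ := s
  obtain ⟨w', a'⟩ := s'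
  by_cases hw : w = w'
  · subst hw
    have := Sigma.mono_ι_of_infinitaryPretopos (powObj R : List I → C) w
    have haa : a = a' := (cancel_mono (Sigma.ι (powObj R) w)).mp h
    have : l = l' := FreeMonoid.toList.injective (by rw [← hl, ← hl', haa])
    exact Locally.of_forall fun _ _ => by rw [this]
  · exact Locally.of_sigma_ne _ hw a a' h _

/-- The congruence on the generalized elements of the object of words. -/
def WordRel (rels : Set (StageWord I R P × StageWord I R P)) {T : C}
    (a b : T ⟶ wordObj I R) : Prop :=
  Locally T fun T' f => ∃ l l' : StageWord I R T', wordHom l = f ≫ a ∧ wordHom l' = f ≫ b ∧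
    stageCon rels T' l l'

variable {rels : Set (StageWord I R P × StageWord I R P)} {T : C}

theorem WordRel.refl (a : T ⟶ wordObj I R) : WordRel rels a a :=
  (Locally.exists_wordHom a).mono fun _ _ ⟨l, hl⟩ => ⟨l, l, hl, hl, Con.refl _ _⟩

theorem WordRel.symm {a b : T ⟶ wordObj I R} (h : WordRel rels a b) : WordRel rels b a :=
  Locally.mono h fun _ _ ⟨l, l', hl, hl', h⟩ => ⟨l', l, hl', hl, Con.symm _ h⟩

theorem WordRel.trans {a b c : T ⟶ wordObj I R} (h : WordRel rels a b) (h' : WordRel rels b c) :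
    WordRel rels a c := by
  refine (Locally.and h h').bind ?_
  rintro T' f ⟨⟨l₁, l₂, h₁, h₂, h₁₂⟩, ⟨l₃, l₄, h₃, h₄, h₃₄⟩⟩
  refine (Locally.of_wordHom_eq (h₂.trans h₃.symm)).mono ?_
  intro T'' g e
  refine ⟨.restrict g l₁, .restrict g l₄, ?_, ?_, ?_⟩
  · rw [← comp_wordHom, h₁, Category.assoc]
  · rw [← comp_wordHom, h₄, Category.assoc]
  · refine Con.trans _ (stageCon_restrict g h₁₂) ?_
    rw [e]
    exact stageCon_restrict g h₃₄

theorem WordRel.of_stageCon {l l' : StageWord I R T} (h : stageCon rels T l l') :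
    WordRel rels (wordHom l) (wordHom l') :=
  Locally.of_forall fun _ f => ⟨.restrict f l, .restrict f l', (comp_wordHom _ _).symm,
    (comp_wordHom _ _).symm, stageCon_restrict f h⟩

theorem wordRel_wordHom_iff {l l' : StageWord I R T} :
    WordRel rels (wordHom l) (wordHom l') ↔
      Locally T fun T' f => stageCon rels T' (.restrict f l) (.restrict f l') := by
  constructor
  · intro h
    refine Locally.bind h ?_
    rintro T' f ⟨m, m', hm, hm', h⟩
    rw [comp_wordHom] at hm hm'
    refine ((Locally.of_wordHom_eq hm).and (Locally.of_wordHom_eq hm')).mono ?_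
    rintro T'' g ⟨e, e'⟩
    rw [← StageWord.restrict_comp, ← StageWord.restrict_comp, ← e, ← e']
    exact stageCon_restrict g h
  · exact fun h => h.mono fun T' f h => ⟨_, _, (comp_wordHom _ _).symm, (comp_wordHom _ _).symm, h⟩

/-- The concatenation of words as a morphism. -/
theorem exists_wordMul (I : Type v) (R : C) : ∃ m : wordObj I R ⊗ wordObj I R ⟶ wordObj I R,
    ∀ {T : C} (l l' : StageWord I R T), lift (wordHom l) (wordHom l') ≫ m = wordHom (l * l') := by
  obtain ⟨m, hm⟩ := Locally.exists_glue (T := wordObj I R ⊗ wordObj I R) (X := wordObj I R)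
    (P := fun T f x => ∀ {T' : C} (g : T' ⟶ T) (l l' : StageWord I R T'),
      wordHom l = g ≫ f ≫ fst _ _ → wordHom l' = g ≫ f ≫ snd _ _ → g ≫ x = wordHom (l * l'))
    (fun T' T'' f g x h T₃ g' l l' hl hl' => by
      have := h (g' ≫ g) l l' (by simpa using hl) (by simpa using hl')
      simpa using this)
    (fun T' f x x' h h' => by
      refine Locally.eq (((Locally.exists_wordHom (f ≫ fst _ _)).and
        (Locally.exists_wordHom (f ≫ snd _ _))).mono ?_)
      rintro T'' g ⟨⟨l, hl⟩, ⟨l', hl'⟩⟩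
      rw [h g l l' hl hl', h' g l l' hl hl'])
    (by
      refine ((Locally.exists_wordHom (fst _ _)).and (Locally.exists_wordHom (snd _ _))).mono ?_
      rintro T f ⟨⟨l, hl⟩, ⟨l', hl'⟩⟩
      refine ⟨wordHom (l * l'), fun g k k' hk hk' => ?_⟩
      rw [← hl, comp_wordHom] at hk
      rw [← hl', comp_wordHom] at hk'
      rw [comp_wordHom, map_mul]
      refine Locally.eq (((Locally.of_wordHom_eq hk).and (Locally.of_wordHom_eq hk')).mono ?_)
      rintro T'' g' ⟨e, e'⟩
      rw [comp_wordHom, comp_wordHom, map_mul, map_mul, e, e'])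
  refine ⟨m, fun {T} l l' => Locally.eq ((hm.pullback (lift (wordHom l) (wordHom l'))).mono ?_)⟩
  intro T' f h
  have := h (𝟙 _) (.restrict f l) (.restrict f l') (by simp [comp_wordHom, StageWord.restrict_id])
    (by simp [comp_wordHom, StageWord.restrict_id])
  rw [comp_wordHom, map_mul, ← this, Category.id_comp, Category.assoc]

variable (rels) in
/-- The formal derivations of consequences of a set of relations. -/
inductive WordDerivation : Type v
  | of (l : rels)
  | refl
  | symm (d : WordDerivation)
  | trans (d d' : WordDerivation)
  | mul (d d' : WordDerivation)

/-- The instances of a derivation, with the two words whose equality it derives. -/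
noncomputable def WordDerivation.span (m : wordObj I R ⊗ wordObj I R ⟶ wordObj I R) :
    WordDerivation rels → Σ S : C, (S ⟶ wordObj I R) × (S ⟶ wordObj I R)
  | of l => ⟨P, wordHom l.1.1, wordHom l.1.2⟩
  | refl => ⟨wordObj I R, 𝟙 _, 𝟙 _⟩
  | symm d => ⟨(d.span m).1, (d.span m).2.2, (d.span m).2.1⟩
  | trans d d' => ⟨Limits.pullback (d.span m).2.2 (d'.span m).2.1,
      pullback.fst _ _ ≫ (d.span m).2.1, pullback.snd _ _ ≫ (d'.span m).2.2⟩
  | mul d d' => ⟨(d.span m).1 ⊗ (d'.span m).1, ((d.span m).2.1 ⊗ₘ (d'.span m).2.1) ≫ m,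
      ((d.span m).2.2 ⊗ₘ (d'.span m).2.2) ≫ m⟩

theorem WordRel.comp {T' : C} (g : T' ⟶ T) {a b : T ⟶ wordObj I R} (h : WordRel rels a b) :
    WordRel rels (g ≫ a) (g ≫ b) :=
  (Locally.pullback h g).mono fun _ _ ⟨l, l', hl, hl', h⟩ =>
    ⟨l, l', by simpa using hl, by simpa using hl', h⟩

theorem WordDerivation.wordRel {m : wordObj I R ⊗ wordObj I R ⟶ wordObj I R}
    (hm : ∀ {T : C} (l l' : StageWord I R T),
      lift (wordHom l) (wordHom l') ≫ m = wordHom (l * l')) (d : WordDerivation rels) :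
    WordRel rels (d.span m).2.1 (d.span m).2.2 := by
  induction d with
  | of l =>
    exact WordRel.of_stageCon (ConGen.Rel.of _ _ ⟨l.1, l.2, 𝟙 _,
      (StageWord.restrict_id (T := P) l.1.1).symm, (StageWord.restrict_id (T := P) l.1.2).symm⟩)
  | refl => exact WordRel.refl _
  | symm d ih => exact ih.symm
  | trans d d' ih ih' =>
    refine (ih.comp (pullback.fst _ _)).trans ?_
    rw [pullback.condition]
    exact ih'.comp _
  | mul d d' ih ih' =>
    refine (Locally.and (ih.comp (fst _ _)) (ih'.comp (snd _ _))).mono ?_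
    rintro T f ⟨⟨l₁, l₂, h₁, h₂, h₁₂⟩, ⟨l₃, l₄, h₃, h₄, h₃₄⟩⟩
    refine ⟨l₁ * l₃, l₂ * l₄, ?_, ?_, Con.mul _ h₁₂ h₃₄⟩
    · rw [← hm, h₁, h₃]
      change _ = f ≫ (_ ⊗ₘ _) ≫ m
      rw [← lift_fst_comp_snd_comp, comp_lift_assoc]
    · rw [← hm, h₂, h₄]
      change _ = f ≫ (_ ⊗ₘ _) ≫ m
      rw [← lift_fst_comp_snd_comp, comp_lift_assoc]

/-- Each inference step of the generated congruence is a constructor of `WordDerivation`, and the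
parameters of an instance form an element of its span. Derivations form a small type, so all spans
can be collected in one coproduct. -/
theorem WordDerivation.exists_of_stageCon {m : wordObj I R ⊗ wordObj I R ⟶ wordObj I R}
    (hm : ∀ {T : C} (l l' : StageWord I R T),
      lift (wordHom l) (wordHom l') ≫ m = wordHom (l * l')) {l l' : StageWord I R T}
    (h : stageCon rels T l l') : ∃ (d : WordDerivation rels) (t : T ⟶ (d.span m).1),
      t ≫ (d.span m).2.1 = wordHom l ∧ t ≫ (d.span m).2.2 = wordHom l' := by
  change ConGen.Rel _ l l' at h
  induction h with
  | of a b h =>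
    obtain ⟨l, hl, t, rfl, rfl⟩ := h
    exact ⟨.of ⟨l, hl⟩, t, comp_wordHom _ _, comp_wordHom _ _⟩
  | refl a => exact ⟨.refl, wordHom a, Category.comp_id _, Category.comp_id _⟩
  | symm _ ih =>
    obtain ⟨d, t, h, h'⟩ := ih
    exact ⟨.symm d, t, h', h⟩
  | trans _ _ ih ih' =>
    obtain ⟨d, t, h₁, h₂⟩ := ih
    obtain ⟨d', t', h₁', h₂'⟩ := ih'
    refine ⟨.trans d d', pullback.lift t t' (h₂.trans h₁'.symm), ?_, ?_⟩
    · exact (pullback.lift_fst_assoc _ _ _ _).trans h₁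
    · exact (pullback.lift_snd_assoc _ _ _ _).trans h₂'
  | mul _ _ ih ih' =>
    obtain ⟨d, t, h₁, h₂⟩ := ih
    obtain ⟨d', t', h₁', h₂'⟩ := ih'
    refine ⟨.mul d d', lift t t', ?_, ?_⟩
    · change lift t t' ≫ (_ ⊗ₘ _) ≫ m = _
      rw [lift_map_assoc, h₁, h₁', hm]
    · change lift t t' ≫ (_ ⊗ₘ _) ≫ m = _
      rw [lift_map_assoc, h₂, h₂', hm]

variable (rels) in
/-- The monoid presented by generators and relations, as a quotient of the object of words. -/
theorem exists_presented_quotient :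
    ∃ (Q : C) (θ : ∀ {T : C}, StageWord I R T → (T ⟶ Q)),
      (∀ {T T' : C} (g : T' ⟶ T) (l : StageWord I R T), g ≫ θ l = θ (.restrict g l)) ∧
      (∀ {T : C} (l l' : StageWord I R T), θ l = θ l' ↔
        Locally T fun T' f => stageCon rels T' (.restrict f l) (.restrict f l')) ∧
      ∀ {T : C} (a : T ⟶ Q), Locally T fun T' f => ∃ l : StageWord I R T', θ l = f ≫ a := by
  obtain ⟨m, hm⟩ := exists_wordMul I R
  let S : WordDerivation rels → C := fun d => (d.span m).1
  let p₁ : ∐ S ⟶ wordObj I R := Sigma.desc fun d => (d.span m).2.1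
  let p₂ : ∐ S ⟶ wordObj I R := Sigma.desc fun d => (d.span m).2.2
  have key : ∀ {T : C} (a b : T ⟶ wordObj I R), SpanRel p₁ p₂ a b ↔ WordRel rels a b := by
    intro T a b
    constructor
    · intro h
      refine Locally.bind h ?_
      rintro T' f ⟨s, hs, hs'⟩
      refine (Locally.of_sigma S s).bind ?_
      rintro T'' g ⟨d, t, ht⟩
      refine Locally.mono ((WordDerivation.wordRel hm d).comp t) ?_
      rintro T₃ k ⟨l, l', hl, hl', h⟩
      have e₁ := congr(k ≫ $ht ≫ p₁)
      have e₂ := congr(k ≫ $ht ≫ p₂)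
      simp only [p₁, Category.assoc, Sigma.ι_desc] at e₁
      simp only [p₂, Category.assoc, Sigma.ι_desc] at e₂
      refine ⟨l, l', ?_, ?_, h⟩
      · rw [hl, e₁, Category.assoc, Category.assoc, ← hs]
      · rw [hl', e₂, Category.assoc, Category.assoc, ← hs']
    · intro h
      refine Locally.mono h ?_
      rintro T' f ⟨l, l', hl, hl', h⟩
      obtain ⟨d, t, h₁, h₂⟩ := WordDerivation.exists_of_stageCon hm h
      refine ⟨t ≫ Sigma.ι S d, ?_, ?_⟩
      · rw [Category.assoc, Sigma.ι_desc, h₁, hl]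
      · rw [Category.assoc, Sigma.ι_desc, h₂, hl']
  obtain ⟨Q, q, hq, hQ⟩ := exists_quotient_of_span p₁ p₂ (fun a => (key _ _).mpr (.refl a))
    (fun a b h => (key _ _).mpr ((key _ _).mp h).symm)
    (fun a b c h h' => (key _ _).mpr (((key _ _).mp h).trans ((key _ _).mp h')))
  refine ⟨Q, fun l => wordHom l ≫ q, fun g l => ?_, fun l l' => ?_, fun a => ?_⟩
  · rw [← Category.assoc, comp_wordHom]
  · rw [hQ, key, wordRel_wordHom_iff]
  · refine ((Locally.of_isRegularEpi q).pullback a).bind ?_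
    rintro T' f ⟨g, hg⟩
    refine (Locally.exists_wordHom g).mono ?_
    rintro T'' k ⟨l, hl⟩
    refine ⟨l, ?_⟩
    change wordHom l ≫ q = _
    rw [hl, Category.assoc, Category.assoc, hg]

end Words

/-! ### Group objects given by generators and relations -/

section PresentedGroups

variable {C : Type u} [Category.{v} C] [CartesianMonoidalCategory C] {I : Type v} {R P : C}

theorem isMonHom_of_comp {G H : C} [MonObj G] [MonObj H] (f : G ⟶ H)
    (h₁ : ∀ T : C, (1 : T ⟶ G) ≫ f = 1)
    (h₂ : ∀ {T : C} (a b : T ⟶ G), (a * b) ≫ f = (a ≫ f) * (b ≫ f)) : IsMonHom f where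
  one_hom := by
    have := h₁ (𝟙_ C)
    rwa [← MonObj.one_eq_one, ← MonObj.one_eq_one] at this
  mul_hom := by
    have := h₂ (fst G G) (snd G G)
    rw [← MonObj.mul_eq_mul] at this
    rw [this, Hom.mul_def, ← lift_fst_comp_snd_comp]

/-- The value of a word on a family of morphisms to a monoid object. -/
def StageWord.eval {H : C} [MonObj H] (y : I → (R ⟶ H)) (T : C) : StageWord I R T →* (T ⟶ H) :=
  FreeMonoid.lift fun a => a.2 ≫ y a.1

theorem StageWord.eval_of {H : C} [MonObj H] (y : I → (R ⟶ H)) {T : C} (a : I × (T ⟶ R)) :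
    eval y T (FreeMonoid.of a) = a.2 ≫ y a.1 :=
  FreeMonoid.lift_eval_of _ _

theorem StageWord.eval_restrict {H : C} [MonObj H] (y : I → (R ⟶ H)) {T T' : C} (g : T' ⟶ T)
    (l : StageWord I R T) : eval y T' (restrict g l) = g ≫ eval y T l := by
  induction l using FreeMonoid.inductionOn' with
  | one => rw [map_one, map_one, map_one, MonObj.comp_one]
  | of_mul a l ih =>
    rw [map_mul, map_mul, map_mul, restrict_of, eval_of, eval_of, ih, MonObj.comp_mul,
      Category.assoc]

theorem StageWord.eval_comp {G H : C} [MonObj G] [MonObj H] (x : I → (R ⟶ G)) (f : G ⟶ H)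
    [IsMonHom f] {T : C} (l : StageWord I R T) :
    eval x T l ≫ f = eval (fun i => x i ≫ f) T l := by
  induction l using FreeMonoid.inductionOn' with
  | one => rw [map_one, map_one, MonObj.one_comp]
  | of_mul a l ih => rw [map_mul, map_mul, eval_of, eval_of, MonObj.mul_comp, ih, Category.assoc]

theorem StageWord.eval_eq_of_stageCon {H : C} [MonObj H] (y : I → (R ⟶ H))
    {rels : Set (StageWord I R P × StageWord I R P)}
    (hy : ∀ l ∈ rels, eval y P l.1 = eval y P l.2) {T : C} {a b : StageWord I R T}
    (h : stageCon rels T a b) : eval y T a = eval y T b := by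
  refine (Con.conGen_le (c := Con.ker (eval y T))).mpr ?_ h
  rintro _ _ ⟨l, hl, t, rfl, rfl⟩
  rw [Con.ker_rel, eval_restrict, eval_restrict, hy l hl]

variable [InfinitaryPretopos C]

/-- In an infinitary pretopos, a group object presented by generators and relations exists as soon
as the relations imply that the generators are invertible. -/
theorem exists_presented_group (rels : Set (StageWord I R P × StageWord I R P))
    (hinv : ∀ (T : C) (a : I × (T ⟶ R)), ∃ b : StageWord I R T,
      stageCon rels T (.of a * b) 1 ∧ stageCon rels T (b * .of a) 1) :
    ∃ (G : C) (_ : GrpObj G) (x : I → (R ⟶ G)),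
      (∀ l ∈ rels, StageWord.eval x P l.1 = StageWord.eval x P l.2) ∧
      ∀ (H : C) [GrpObj H] (y : I → (R ⟶ H)),
        (∀ l ∈ rels, StageWord.eval y P l.1 = StageWord.eval y P l.2) →
        ∃! f : G ⟶ H, IsMonHom f ∧ ∀ i, x i ≫ f = y i := by
  obtain ⟨Q, θ, hθ, hrel, hex⟩ := exists_presented_quotient rels
  have hcon : ∀ {T : C} {a b : StageWord I R T}, stageCon rels T a b → θ a = θ b :=
    fun h => (hrel _ _).mpr (Locally.of_forall fun _ f => stageCon_restrict f h)
  obtain ⟨m, hm⟩ := Locally.exists_glue (T := Q ⊗ Q) (X := Q)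
    (P := fun T f x => ∀ {T' : C} (g : T' ⟶ T) (l l' : StageWord I R T'),
      θ l = g ≫ f ≫ fst _ _ → θ l' = g ≫ f ≫ snd _ _ → g ≫ x = θ (l * l'))
    (fun T' T'' f g x h T₃ g' l l' hl hl' => by
      have := h (g' ≫ g) l l' (by simpa using hl) (by simpa using hl')
      simpa using this)
    (fun T' f x x' h h' => by
      refine Locally.eq (((hex (f ≫ fst _ _)).and (hex (f ≫ snd _ _))).mono ?_)
      rintro T'' g ⟨⟨l, hl⟩, ⟨l', hl'⟩⟩
      rw [h g l l' hl hl', h' g l l' hl hl'])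
    (by
      refine ((hex (fst Q Q)).and (hex (snd Q Q))).mono ?_
      rintro T f ⟨⟨l, hl⟩, ⟨l', hl'⟩⟩
      refine ⟨θ (l * l'), fun g k k' hk hk' => ?_⟩
      rw [← hl, hθ, hrel] at hk
      rw [← hl', hθ, hrel] at hk'
      rw [hθ, map_mul, hrel]
      refine (hk.and hk').mono ?_
      rintro T'' g' ⟨e, e'⟩
      rw [map_mul (StageWord.restrict g'), map_mul (StageWord.restrict g')]
      exact Con.symm _ (Con.mul _ e e'))
  have hmul : ∀ {T : C} (l l' : StageWord I R T), lift (θ l) (θ l') ≫ m = θ (l * l') := by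
    refine fun {T} l l' => Locally.eq ((hm.pullback (lift (θ l) (θ l'))).mono ?_)
    intro T' f h
    have := h (𝟙 _) (.restrict f l) (.restrict f l') (by simp [hθ, StageWord.restrict_id])
      (by simp [hθ, StageWord.restrict_id])
    rw [hθ, map_mul, ← this, Category.id_comp, Category.assoc]
  have hone : ∀ {T T' : C} (f : T ⟶ T'), f ≫ θ 1 = θ 1 := fun f => by rw [hθ, map_one]
  let monQ : MonObj Q :=
    { one := θ 1
      mul := m
      one_mul := by
        refine Locally.eq ((hex (snd (𝟙_ C) Q)).mono ?_)
        rintro T f ⟨l, hl⟩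
        have hf : f = lift (toUnit T) (θ l) :=
          CartesianMonoidalCategory.hom_ext _ _ (toUnit_unique _ _) (by simp [hl])
        rw [hf, lift_whiskerRight_assoc, hone, hmul, one_mul, lift_leftUnitor_hom]
      mul_one := by
        refine Locally.eq ((hex (fst Q (𝟙_ C))).mono ?_)
        rintro T f ⟨l, hl⟩
        have hf : f = lift (θ l) (toUnit T) :=
          CartesianMonoidalCategory.hom_ext _ _ (by simp [hl]) (toUnit_unique _ _)
        rw [hf, lift_whiskerLeft_assoc, hone, hmul, mul_one, lift_rightUnitor_hom]
      mul_assoc := by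
        refine Locally.eq ((((hex (fst (Q ⊗ Q) Q ≫ fst Q Q)).and
          (hex (fst (Q ⊗ Q) Q ≫ snd Q Q))).and (hex (snd (Q ⊗ Q) Q))).mono ?_)
        rintro T f ⟨⟨⟨l₁, h₁⟩, ⟨l₂, h₂⟩⟩, ⟨l₃, h₃⟩⟩
        have hf : f = lift (lift (θ l₁) (θ l₂)) (θ l₃) :=
          CartesianMonoidalCategory.hom_ext _ _
            (CartesianMonoidalCategory.hom_ext _ _ (by simp [h₁]) (by simp [h₂])) (by simp [h₃])
        rw [hf, lift_whiskerRight_assoc, hmul, hmul, lift_lift_associator_hom_assoc,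
          lift_whiskerLeft_assoc, hmul, hmul, mul_assoc] }
  have θmul : ∀ {T : C} (l l' : StageWord I R T), θ (l * l') = θ l * θ l' :=
    fun l l' => (hmul l l').symm
  have θone : ∀ {T : C}, θ (1 : StageWord I R T) = 1 := fun {T} => (hone (toUnit T)).symm
  have hinv' : ∀ {T : C} (l : StageWord I R T), ∃ b : T ⟶ Q, θ l * b = 1 ∧ b * θ l = 1 := by
    intro T l
    induction l using FreeMonoid.inductionOn' with
    | one => exact ⟨1, by rw [θone, one_mul], by rw [θone, one_mul]⟩
    | of_mul a l ih =>
      obtain ⟨b, hb, hb'⟩ := ih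
      obtain ⟨c, hc, hc'⟩ := hinv T a
      refine ⟨b * θ c, ?_, ?_⟩
      · rw [θmul, mul_assoc, ← mul_assoc _ b, hb, one_mul, ← θmul, hcon hc, θone]
      · rw [θmul, mul_assoc, ← mul_assoc (θ c), ← θmul, hcon hc', θone, one_mul, hb']
  obtain ⟨inv, hinv''⟩ := Locally.exists_glue (T := Q) (X := Q)
    (P := fun T f x => f * x = 1 ∧ x * f = 1)
    (fun T' T'' f g x h => by
      rw [← MonObj.comp_mul, ← MonObj.comp_mul, h.1, h.2, MonObj.comp_one]
      exact ⟨rfl, rfl⟩)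
    (fun T' f x x' h h' => left_inv_eq_right_inv h.2 h'.1)
    ((hex (𝟙 Q)).mono fun T f ⟨l, hl⟩ => by
      obtain ⟨b, hb⟩ := hinv' l
      rw [hl, Category.comp_id] at hb
      exact ⟨b, hb⟩)
  let grpQ : GrpObj Q :=
    { monQ with
      inv := inv
      left_inv := Locally.eq (hinv''.mono fun T f h => by
        rw [comp_lift_assoc, Category.comp_id]
        exact h.2.trans (MonObj.comp_one f).symm)
      right_inv := Locally.eq (hinv''.mono fun T f h => by
        rw [comp_lift_assoc, Category.comp_id]
        exact h.1.trans (MonObj.comp_one f).symm) }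
  have heval : ∀ {T : C} (l : StageWord I R T),
      StageWord.eval (fun i => θ (.of (i, 𝟙 R))) T l = θ l := by
    intro T l
    induction l using FreeMonoid.inductionOn' with
    | one => rw [map_one, θone]
    | of_mul a l ih =>
      rw [map_mul, ih, θmul, StageWord.eval_of, hθ, StageWord.restrict_of, Category.comp_id]
  refine ⟨Q, grpQ, fun i => θ (.of (i, 𝟙 R)), fun l hl => ?_, fun H _ y hy => ?_⟩
  · rw [heval, heval]
    exact hcon (ConGen.Rel.of _ _ ⟨l, hl, 𝟙 _, (StageWord.restrict_id _).symm,
      (StageWord.restrict_id _).symm⟩)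
  · have heq : ∀ {T : C} {l l' : StageWord I R T}, θ l = θ l' →
        StageWord.eval y T l = StageWord.eval y T l' := by
      intro T l l' h
      refine Locally.eq (((hrel _ _).mp h).mono ?_)
      intro T' f h
      rw [← StageWord.eval_restrict, ← StageWord.eval_restrict,
        StageWord.eval_eq_of_stageCon y hy h]
    obtain ⟨F, hF⟩ := Locally.exists_glue (T := Q) (X := H)
      (P := fun T f x => ∀ {T' : C} (g : T' ⟶ T) (l : StageWord I R T'),
        θ l = g ≫ f → g ≫ x = StageWord.eval y T' l)
      (fun T' T'' f g x h T₃ g' l hl => by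
        have := h (g' ≫ g) l (by simpa using hl)
        simpa using this)
      (fun T' f x x' h h' => by
        refine Locally.eq ((hex f).mono ?_)
        rintro T'' g ⟨l, hl⟩
        rw [h g l hl, h' g l hl])
      (by
        refine (hex (𝟙 Q)).mono ?_
        rintro T f ⟨l, hl⟩
        refine ⟨StageWord.eval y T l, fun g k hk => ?_⟩
        rw [Category.comp_id] at hl
        rw [← hl, hθ] at hk
        rw [← StageWord.eval_restrict]
        exact (heq hk).symm)
    have hF' : ∀ {T : C} (l : StageWord I R T), θ l ≫ F = StageWord.eval y T l := by
      refine fun {T} l => Locally.eq ((hF.pullback (θ l)).mono ?_)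
      intro T' f h
      have := h (𝟙 _) (.restrict f l) (by simp [hθ, StageWord.restrict_id])
      rw [← StageWord.eval_restrict, ← this, Category.id_comp, Category.assoc]
    refine ⟨F, ⟨isMonHom_of_comp F (fun T => ?_) (fun {T} a b => ?_), fun i => ?_⟩, ?_⟩
    · rw [← θone, hF', map_one]
    · refine Locally.eq (((hex a).and (hex b)).mono ?_)
      rintro T' f ⟨⟨l, hl⟩, ⟨l', hl'⟩⟩
      rw [MonObj.comp_mul, ← Category.assoc, ← Category.assoc, ← Category.assoc,
        MonObj.comp_mul, ← hl, ← hl', ← θmul, hF', hF', hF', map_mul]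
    · rw [hF', StageWord.eval_of, Category.id_comp]
    · rintro F' ⟨hF₁, hF₂⟩
      refine Locally.eq ((hex (𝟙 Q)).mono ?_)
      rintro T f ⟨l, hl⟩
      rw [Category.comp_id] at hl
      rw [← hl, hF', ← heval, StageWord.eval_comp]
      simp only [hF₂]

end PresentedGroups

/-! ### Relations of Steinberg type, common to all root systems -/

section RootRelations

variable {C : Type u} [Category.{v} C] [CartesianMonoidalCategory C]

section HomRing

variable {R : C} [NonUnitalRingObj R] {T T' : C}

theorem NonUnitalRingObj.comp_add (g : T' ⟶ T) (p q : T ⟶ R) : g ≫ (p + q) = g ≫ p + g ≫ q :=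
  AddMonObj.comp_add g p q

theorem NonUnitalRingObj.comp_zero (g : T' ⟶ T) : g ≫ (0 : T ⟶ R) = 0 :=
  AddMonObj.comp_zero g

theorem NonUnitalRingObj.comp_mul (g : T' ⟶ T) (p q : T ⟶ R) : g ≫ (p * q) = (g ≫ p) * (g ≫ q) :=
  comp_lift_assoc _ _ _ _

theorem NonUnitalRingObj.comp_zsmul (g : T' ⟶ T) (n : ℤ) (p : T ⟶ R) :
    g ≫ (n • p) = n • (g ≫ p) :=
  map_zsmul ({ toFun := fun p => g ≫ p, map_zero' := comp_zero g, map_add' := comp_add g } :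
    (T ⟶ R) →+ (T' ⟶ R)) n p

end HomRing

/-- Relations of Steinberg type between morphisms `x i : R ⟶ G`: each `x i` is additive, the
commutator of `x i` and `x j` is given by `x k` with the sign `s` if `mulRel i j k s` holds, and it
is trivial if `comRel i j` holds. -/
structure RootRelations {I : Type w} (mulRel : I → I → I → ℤˣ → Prop) (comRel : I → I → Prop)
    {R G : C} [NonUnitalRingObj R] [GrpObj G] (x : I → (R ⟶ G)) : Prop where
  add (i : I) {T : C} (p q : T ⟶ R) : (p ≫ x i) * (q ≫ x i) = (p + q) ≫ x i
  commutator (i j k : I) (s : ℤˣ) (h : mulRel i j k s) {T : C} (p q : T ⟶ R) :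
    ⁅p ≫ x i, q ≫ x j⁆ = ((s : ℤ) • (p * q)) ≫ x k
  commute (i j : I) (h : comRel i j) {T : C} (p q : T ⟶ R) : ⁅p ≫ x i, q ≫ x j⁆ = 1

/-- The group object `G` is presented by generators `x i` and relations of Steinberg type. -/
structure IsRootGroup {I : Type w} (mulRel : I → I → I → ℤˣ → Prop) (comRel : I → I → Prop)
    {R G : C} [NonUnitalRingObj R] [GrpObj G] (x : I → (R ⟶ G)) : Prop where
  relations : RootRelations mulRel comRel x
  universal (H : C) [GrpObj H] (y : I → (R ⟶ H)) (hy : RootRelations mulRel comRel y) :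
    ∃! f : G ⟶ H, IsMonHom f ∧ ∀ i : I, x i ≫ f = y i

section

variable {I : Type w} {mulRel : I → I → I → ℤˣ → Prop} {comRel : I → I → Prop}
    {R G : C} [NonUnitalRingObj R] [GrpObj G] {x : I → (R ⟶ G)}

theorem zero_comp_of_add {y : R ⟶ G} {T : C}
    (h : (0 ≫ y : T ⟶ G) * (0 ≫ y) = ((0 : T ⟶ R) + 0) ≫ y) : (0 : T ⟶ R) ≫ y = 1 := by
  rw [add_zero] at h
  exact mul_eq_left.mp h

theorem RootRelations.zero_comp (h : RootRelations mulRel comRel x) (i : I) {T : C} :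
    (0 : T ⟶ R) ≫ x i = 1 :=
  zero_comp_of_add (h.add i 0 0)

theorem RootRelations.zsmul_comp (hx : RootRelations mulRel comRel x) (i : I) {T : C}
    (p : T ⟶ R) (s : ℤˣ) :
    ((s : ℤ) • p) ≫ x i = (p ≫ x i) ^ (s : ℤ) := by
  obtain rfl | rfl := Int.units_eq_one_or s
  · simp
  · rw [Units.val_neg, Units.val_one, neg_one_zsmul, zpow_neg_one, eq_inv_iff_mul_eq_one, hx.add,
      neg_add_cancel, hx.zero_comp]

theorem RootRelations.comp_equiv {I' : Type w₁} (e : I' ≃ I) :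
    RootRelations (fun i j k s => mulRel (e i) (e j) (e k) s) (fun i j => comRel (e i) (e j))
      (fun i => x (e i)) ↔ RootRelations mulRel comRel x where
  mp h :=
    { add := fun i T p q => by simpa using h.add (e.symm i) p q
      commutator := fun i j k s hs T p q => by
        simpa using h.commutator (e.symm i) (e.symm j) (e.symm k) s (by simpa using hs) p q
      commute := fun i j hs T p q => by
        simpa using h.commute (e.symm i) (e.symm j) (by simpa using hs) p q }
  mpr h :=
    { add := fun i => h.add (e i)
      commutator := fun i j k s hs => h.commutator _ _ _ s hs
      commute := fun i j hs => h.commute _ _ hs }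

end

variable [InfinitaryPretopos C]

theorem exists_isRootGroup_of_small {I : Type v} (mulRel : I → I → I → ℤˣ → Prop)
    (comRel : I → I → Prop) (R : C) [NonUnitalRingObj R] :
    ∃ (G : C) (_ : GrpObj G) (x : I → (R ⟶ G)), IsRootGroup mulRel comRel x := by
  let g (i : I) (p : R ⊗ R ⟶ R) : StageWord I R (R ⊗ R) := .of (i, p)
  let p : R ⊗ R ⟶ R := fst R R
  let q : R ⊗ R ⟶ R := snd R R
  -- The relations are imposed on the two generic elements of `R ⊗ R`. The relation `(g i 0, 1)`
  -- follows from additivity in a group but not in a monoid; it makes the generators invertible.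
  let rels : Set (StageWord I R (R ⊗ R) × StageWord I R (R ⊗ R)) :=
    {l | (∃ i, l = (g i 0, 1)) ∨ (∃ i, l = (g i p * g i q, g i (p + q))) ∨
      (∃ i j k s, mulRel i j k s ∧
        l = (g i p * g j q, g k ((s : ℤ) • (p * q)) * g j q * g i p)) ∨
      ∃ i j, comRel i j ∧ l = (g i p * g j q, g j q * g i p)}
  have key : ∀ (H : C) [GrpObj H] (y : I → (R ⟶ H)),
      (∀ l ∈ rels, StageWord.eval y (R ⊗ R) l.1 = StageWord.eval y (R ⊗ R) l.2) ↔
        RootRelations mulRel comRel y := by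
    intro H _ y
    constructor
    · intro h
      have hT : ∀ {T : C} (t : T ⟶ R ⊗ R), ∀ l ∈ rels,
          t ≫ StageWord.eval y (R ⊗ R) l.1 = t ≫ StageWord.eval y (R ⊗ R) l.2 :=
        fun t l hl => by rw [h l hl]
      refine ⟨fun i T a b => ?_, fun i j k s hs T a b => ?_, fun i j hs T a b => ?_⟩
      · have := hT (lift a b) _ (.inr (.inl ⟨i, rfl⟩))
        simp only [g, p, q, map_mul, StageWord.eval_of, MonObj.comp_mul] at this
        simpa only [← Category.assoc, NonUnitalRingObj.comp_add, lift_fst, lift_snd] using this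
      · have := hT (lift a b) _ (.inr (.inr (.inl ⟨i, j, k, s, hs, rfl⟩)))
        simp only [g, p, q, map_mul, StageWord.eval_of, MonObj.comp_mul] at this
        simp only [← Category.assoc, NonUnitalRingObj.comp_zsmul, NonUnitalRingObj.comp_mul,
          lift_fst, lift_snd] at this
        rw [commutatorElement_def, this]
        group
      · have := hT (lift a b) _ (.inr (.inr (.inr ⟨i, j, hs, rfl⟩)))
        simp only [g, p, q, map_mul, StageWord.eval_of, MonObj.comp_mul] at this
        simp only [← Category.assoc, lift_fst, lift_snd] at this
        rwa [commutatorElement_eq_one_iff_mul_comm]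
    · rintro h _ (⟨i, rfl⟩ | ⟨i, rfl⟩ | ⟨i, j, k, s, hs, rfl⟩ | ⟨i, j, hs, rfl⟩)
      · simp only [g, StageWord.eval_of, map_one]
        exact h.zero_comp i
      · simp only [g, StageWord.eval_of, map_mul]
        exact h.add i p q
      · simp only [g, StageWord.eval_of, map_mul]
        rw [← h.commutator i j k s hs, commutatorElement_def]
        group
      · simp only [g, StageWord.eval_of, map_mul]
        exact commutatorElement_eq_one_iff_mul_comm.mp (h.commute i j hs p q)
  have hadd : ∀ (T : C) (i : I) (a b : T ⟶ R), a + b = 0 →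
      stageCon rels T (.of (i, a) * .of (i, b)) 1 := by
    intro T i a b hab
    refine Con.trans _ (y := .of (i, a + b)) ?_ ?_
    · refine ConGen.Rel.of _ _ ⟨_, .inr (.inl ⟨i, rfl⟩), lift a b, ?_, ?_⟩
      · simp only [g, p, q, map_mul, StageWord.restrict_of, lift_fst, lift_snd]
      · simp only [g, p, q, StageWord.restrict_of, NonUnitalRingObj.comp_add, lift_fst, lift_snd]
    · refine ConGen.Rel.of _ _ ⟨_, .inl ⟨i, rfl⟩, lift a b, ?_, ?_⟩
      · simp only [g, StageWord.restrict_of, NonUnitalRingObj.comp_zero, hab]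
      · simp only [map_one]
  obtain ⟨G, hG, x, hx, hu⟩ := exists_presented_group rels fun T a =>
    ⟨.of (a.1, -a.2), hadd T a.1 _ _ (add_neg_cancel _), hadd T a.1 _ _ (neg_add_cancel _)⟩
  exact ⟨G, hG, x, (key G x).mp hx, fun H _ y hy => hu H y ((key H y).mpr hy)⟩

/-- Finiteness moves the index type into the universe of the morphisms, in which coproducts exist.
-/
theorem exists_isRootGroup {I : Type w} [Finite I] (mulRel : I → I → I → ℤˣ → Prop)
    (comRel : I → I → Prop) (R : C) [NonUnitalRingObj R] :
    ∃ (G : C) (_ : GrpObj G) (x : I → (R ⟶ G)), IsRootGroup mulRel comRel x := by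
  obtain ⟨n, ⟨e⟩⟩ := Finite.exists_equiv_fin I
  let e' : ULift.{v} (Fin n) ≃ I := Equiv.ulift.trans e.symm
  obtain ⟨G, hG, x, hx⟩ := exists_isRootGroup_of_small
    (fun i j k s => mulRel (e' i) (e' j) (e' k) s) (fun i j => comRel (e' i) (e' j)) R
  refine ⟨G, hG, fun i => x (e'.symm i), ?_, fun H _ y hy => ?_⟩
  · rw [← RootRelations.comp_equiv e']
    simpa using hx.relations
  · obtain ⟨f, ⟨hf, hf'⟩, hu⟩ := hx.universal H (fun i => y (e' i))
      ((RootRelations.comp_equiv e').mpr hy)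
    refine ⟨f, ⟨hf, fun i => by simpa using hf' (e'.symm i)⟩, fun f' ⟨h, h'⟩ => ?_⟩
    exact hu f' ⟨h, fun i => by simpa using h' (e' i)⟩

end RootRelations

/-! ### Commutator identities modulo central elements -/

section GroupLemmas

variable {G : Type*} [Group G]

/-- Conjugation by `b` multiplies `u` and `v` by central elements, which do not affect their
commutator. -/
theorem commutatorElement_commutatorElement_eq_one {u v b : G} (hu : ∀ g, Commute ⁅b, u⁆ g)
    (hv : ∀ g, Commute ⁅b, v⁆ g) : ⁅b, ⁅u, v⁆⁆ = 1 := by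
  have h₁ : b * u * b⁻¹ = ⁅b, u⁆ * u := by rw [commutatorElement_def]; group
  have h₂ : b * v * b⁻¹ = ⁅b, v⁆ * v := by rw [commutatorElement_def]; group
  have h₃ : b * ⁅u, v⁆ * b⁻¹ = ⁅u, v⁆ := by
    have : b * ⁅u, v⁆ * b⁻¹ = ⁅b * u * b⁻¹, b * v * b⁻¹⁆ := by
      simp only [commutatorElement_def]; group
    rw [this, h₁, h₂, commutatorElement_def (_ * u), commutatorElement_def u v]
    generalize ⁅b, u⁆ = y at *
    generalize ⁅b, v⁆ = z at *
    calc y * u * (z * v) * (y * u)⁻¹ * (z * v)⁻¹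
        = y * (u * z) * v * u⁻¹ * y⁻¹ * v⁻¹ * z⁻¹ := by group
      _ = y * z * (u * v * u⁻¹) * y⁻¹ * v⁻¹ * z⁻¹ := by rw [← (hv u).eq]; group
      _ = z * (y * (u * v * u⁻¹)) * y⁻¹ * v⁻¹ * z⁻¹ := by rw [(hu z).eq]; group
      _ = z * (u * v * u⁻¹ * v⁻¹) * z⁻¹ := by rw [(hu (u * v * u⁻¹)).eq]; group
      _ = u * v * u⁻¹ * v⁻¹ := by rw [(hv (u * v * u⁻¹ * v⁻¹)).eq]; group
  rw [commutatorElement_def, h₃, mul_inv_cancel]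

/-- A form of the Hall–Witt identity. -/
theorem commutatorElement_assoc_iff {a b c : G} (hac : ∀ g, Commute ⁅a, c⁆ g)
    (he : Commute ⁅b, c⁆ ⁅a, ⁅b, c⁆⁆) :
    ⁅a, ⁅b, c⁆⁆ = ⁅⁅a, b⁆, c⁆ ↔ Commute ⁅a, b⁆ ⁅b, c⁆ := by
  -- The two sides expand `⁅a * c, b⁆` and `⁅c * a, b⁆`, which are equal because `⁅a, c⁆` is
  -- central.
  have key : a * ⁅b, c⁆⁻¹ * a⁻¹ * ⁅a, b⁆ = c * ⁅a, b⁆ * c⁻¹ * ⁅b, c⁆⁻¹ := by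
    have h := (hac (c * a * b * (c * a)⁻¹)).eq
    have h' : ⁅a, c⁆ * (c * a * b * (c * a)⁻¹) * ⁅a, c⁆⁻¹ = c * a * b * (c * a)⁻¹ := by
      rw [h]; group
    have h₁ : ⁅a, c⁆ * (c * a * b * (c * a)⁻¹) * ⁅a, c⁆⁻¹ = a * c * b * (a * c)⁻¹ := by
      simp only [commutatorElement_def]; group
    rw [h₁] at h'
    have e₁ : a * ⁅b, c⁆⁻¹ * a⁻¹ * ⁅a, b⁆ = a * c * b * (a * c)⁻¹ * b⁻¹ := by
      simp only [commutatorElement_def]; group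
    have e₂ : c * ⁅a, b⁆ * c⁻¹ * ⁅b, c⁆⁻¹ = c * a * b * (c * a)⁻¹ * b⁻¹ := by
      simp only [commutatorElement_def]; group
    rw [e₁, e₂, h']
  have h₁ : ⁅b, c⁆ * (a * ⁅b, c⁆⁻¹ * a⁻¹) = ⁅a, ⁅b, c⁆⁆⁻¹ := by
    simp only [commutatorElement_def]; group
  have h₂ : ⁅⁅a, b⁆, c⁆⁻¹ = c * ⁅a, b⁆ * c⁻¹ * ⁅a, b⁆⁻¹ := by
    simp only [commutatorElement_def]; group
  have h₃ : ⁅a, ⁅b, c⁆⁆⁻¹ = a * ⁅b, c⁆⁻¹ * a⁻¹ * ⁅b, c⁆ := by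
    rw [← h₁]
    have := he.inv_right.eq
    rw [← h₁] at this
    exact mul_left_cancel (this.trans (mul_assoc _ _ _))
  rw [← inv_inj, h₂, h₃]
  generalize a * ⁅b, c⁆⁻¹ * a⁻¹ = u at *
  generalize c * ⁅a, b⁆ * c⁻¹ = w at *
  generalize ⁅a, b⁆ = d at *
  generalize ⁅b, c⁆ = e at *
  have hu : u = w * e⁻¹ * d⁻¹ := by rw [← key]; group
  rw [hu]
  constructor
  · intro h
    have : w * (e⁻¹ * d⁻¹ * e) = w * d⁻¹ := by rw [← h]; group
    have h' : d⁻¹ * e = e * d⁻¹ := by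
      calc d⁻¹ * e = e * (e⁻¹ * d⁻¹ * e) := by group
        _ = e * d⁻¹ := by rw [mul_left_cancel this]
    have : Commute d⁻¹ e := h'
    exact (Commute.inv_left_iff).mp this
  · intro h
    have h' : d⁻¹ * e = e * d⁻¹ := h.inv_left.eq
    rw [mul_assoc, h']; group

end GroupLemmas

/-! ### Commutators of lifts in a central extension -/

section CentralExtensions

variable {C : Type u} [Category.{v} C] [CartesianMonoidalCategory C]

theorem MonObj.commutatorElement_comp {G H : C} [GrpObj G] [GrpObj H] (f : G ⟶ H) [IsMonHom f]
    {T : C} (a b : T ⟶ G) : ⁅a, b⁆ ≫ f = ⁅a ≫ f, b ≫ f⁆ := by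
  simp only [commutatorElement_def, MonObj.mul_comp, GrpObj.inv_comp]

theorem MonObj.comp_commutatorElement {G : C} [GrpObj G] {T T' : C} (g : T' ⟶ T) (a b : T ⟶ G) :
    g ≫ ⁅a, b⁆ = ⁅g ≫ a, g ≫ b⁆ := by
  simp only [commutatorElement_def, MonObj.comp_mul, GrpObj.comp_inv]

section

variable {X G : C} [GrpObj X] {f : X ⟶ G}

/-- All lifts of the values of two morphisms to `G` along `f` commute. -/
def LiftsCommute {R : C} (f : X ⟶ G) (x y : R ⟶ G) : Prop :=
  ∀ ⦃T : C⦄ (a b : T ⟶ X) (p q : T ⟶ R), a ≫ f = p ≫ x → b ≫ f = q ≫ y → Commute a b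

theorem LiftsCommute.symm {R : C} {x y : R ⟶ G} (h : LiftsCommute f x y) : LiftsCommute f y x :=
  fun _ a b p q ha hb => (h b a q p hb ha).symm

end

variable {X G : C} [GrpObj X] [GrpObj G] {f : X ⟶ G}

namespace IsCentralExtension

variable (hf : IsCentralExtension f)

include hf

theorem commute_of_comp_eq_one {T : C} {k : T ⟶ X} (hk : k ≫ f = 1) (g : T ⟶ X) : Commute k g :=
  hf.central k g hk

/-- Two lifts of the same element differ by a central factor, which cancels in a commutator. -/
theorem commutatorElement_congr {T : C} {a a' b b' : T ⟶ X} (ha : a ≫ f = a' ≫ f)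
    (hb : b ≫ f = b' ≫ f) : ⁅a, b⁆ = ⁅a', b'⁆ := by
  have := hf.isMonHom
  obtain ⟨y, rfl⟩ : ∃ y, y * a' = a := ⟨a * a'⁻¹, by group⟩
  obtain ⟨z, rfl⟩ : ∃ z, z * b' = b := ⟨b * b'⁻¹, by group⟩
  have hy := hf.commute_of_comp_eq_one (k := y) (by simpa [MonObj.mul_comp] using ha)
  have hz := hf.commute_of_comp_eq_one (k := z) (by simpa [MonObj.mul_comp] using hb)
  simp only [commutatorElement_def, mul_inv_rev]
  calc y * a' * (z * b') * (a'⁻¹ * y⁻¹) * (b'⁻¹ * z⁻¹)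
      = y * (a' * z) * b' * a'⁻¹ * y⁻¹ * b'⁻¹ * z⁻¹ := by group
    _ = z * (y * (a' * b' * a'⁻¹)) * y⁻¹ * b'⁻¹ * z⁻¹ := by
      rw [← (hz a').eq, ← mul_assoc y, (hy z).eq]; group
    _ = z * (a' * b' * a'⁻¹ * b'⁻¹) * z⁻¹ := by rw [(hy _).eq]; group
    _ = a' * b' * a'⁻¹ * b'⁻¹ := by rw [(hz _).eq]; group

variable [InfinitaryPretopos C]

theorem exists_lift {T : C} (a : T ⟶ G) : Locally T fun _ g => ∃ b, b ≫ f = g ≫ a :=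
  have := hf.epi
  (Locally.of_epi f).pullback a

theorem exists_bracket : ∃ κ : G ⊗ G ⟶ X, ∀ {T : C} (a b : T ⟶ X),
    lift (a ≫ f) (b ≫ f) ≫ κ = ⁅a, b⁆ := by
  obtain ⟨κ, hκ⟩ := Locally.exists_glue (T := G ⊗ G) (X := X)
    (P := fun T g x => ∀ {T' : C} (h : T' ⟶ T) (a b : T' ⟶ X),
      a ≫ f = h ≫ g ≫ fst _ _ → b ≫ f = h ≫ g ≫ snd _ _ → h ≫ x = ⁅a, b⁆)
    (fun T' T'' g g' x h T₃ k a b ha hb => by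
      have := h (k ≫ g') a b (by simpa using ha) (by simpa using hb)
      simpa using this)
    (fun T' g x x' h h' => by
      refine Locally.eq (((hf.exists_lift (g ≫ fst _ _)).and
        (hf.exists_lift (g ≫ snd _ _))).mono ?_)
      rintro T'' k ⟨⟨a, ha⟩, ⟨b, hb⟩⟩
      rw [h k a b ha hb, h' k a b ha hb])
    (by
      refine ((hf.exists_lift (fst G G)).and (hf.exists_lift (snd G G))).mono ?_
      rintro T g ⟨⟨a, ha⟩, ⟨b, hb⟩⟩
      refine ⟨⁅a, b⁆, fun h a' b' ha' hb' => ?_⟩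
      rw [MonObj.comp_commutatorElement]
      exact hf.commutatorElement_congr (by rw [Category.assoc, ha, ha'])
        (by rw [Category.assoc, hb, hb']))
  refine ⟨κ, fun {T} a b => Locally.eq ((hκ.pullback (lift (a ≫ f) (b ≫ f))).mono ?_)⟩
  intro T' g h
  have := h (𝟙 _) (g ≫ a) (g ≫ b) (by simp) (by simp)
  rw [MonObj.comp_commutatorElement, ← this, Category.id_comp, Category.assoc]

/-- The commutator of lifts to the central extension. -/
noncomputable def bracket {T : C} (a b : T ⟶ G) : T ⟶ X :=
  lift a b ≫ hf.exists_bracket.choose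

theorem bracket_comp_comp {T : C} (a b : T ⟶ X) : hf.bracket (a ≫ f) (b ≫ f) = ⁅a, b⁆ :=
  hf.exists_bracket.choose_spec a b

theorem comp_bracket {T T' : C} (g : T' ⟶ T) (a b : T ⟶ G) :
    g ≫ hf.bracket a b = hf.bracket (g ≫ a) (g ≫ b) :=
  comp_lift_assoc _ _ _ _

theorem bracket_comp {T : C} (a b : T ⟶ G) : hf.bracket a b ≫ f = ⁅a, b⁆ := by
  have := hf.isMonHom
  refine Locally.eq (((hf.exists_lift a).and (hf.exists_lift b)).mono ?_)
  rintro T' g ⟨⟨a', ha⟩, ⟨b', hb⟩⟩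
  rw [← Category.assoc, hf.comp_bracket, MonObj.comp_commutatorElement, ← ha, ← hb,
    hf.bracket_comp_comp, MonObj.commutatorElement_comp]

end IsCentralExtension

end CentralExtensions

theorem zpow_units_zpow_units {H : Type*} [Group H] (g : H) (s t : ℤˣ) :
    (g ^ (s : ℤ)) ^ (t : ℤ) = g ^ ((s * t : ℤˣ) : ℤ) := by
  rw [← zpow_mul, Units.val_mul]

theorem units_smul_units_smul {A : Type*} [AddGroup A] (a : A) (s : ℤˣ) :
    (s : ℤ) • (s : ℤ) • a = a := by
  obtain rfl | rfl := Int.units_eq_one_or s <;> simp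

theorem zpow_units_of_add {A H : Type*} [AddGroup A] [Group H] (F : A → H)
    (hF : ∀ a b, F (a + b) = F a * F b) (s : ℤˣ) (a : A) : F ((s : ℤ) • a) = F a ^ (s : ℤ) := by
  have h₀ : F 0 = 1 := by
    have := hF 0 0
    rw [add_zero] at this
    exact left_eq_mul.mp this
  obtain rfl | rfl := Int.units_eq_one_or s
  · simp
  · rw [Units.val_neg, Units.val_one, neg_one_zsmul, zpow_neg_one, eq_inv_iff_mul_eq_one, ← hF,
      neg_add_cancel, h₀]

/-! ### Factorizations and balanced maps from a weak unit -/

section WeakUnits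

variable {C : Type u} [Category.{v} C] [CartesianMonoidalCategory C] [InfinitaryPretopos C]
  {R : C} [NonUnitalRingObj R]

namespace IsWeakUnit

variable {E : Subobject R} (hE : IsWeakUnit E)

include hE

theorem exists_mul_eq {T : C} (p : T ⟶ R) :
    Locally T fun T' f => ∃ s e : T' ⟶ R, E.Factors e ∧ s * e = f ≫ p := by
  have := hE.epi_mul
  refine ((Locally.of_epi (fst R (E : C) * (snd R (E : C) ≫ E.arrow))).pullback p).mono ?_
  rintro T' f ⟨g, hg⟩
  refine ⟨g ≫ fst _ _, g ≫ snd _ _ ≫ E.arrow, ?_, ?_⟩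
  · rw [← Category.assoc]
    exact Subobject.factors_of_factors_right _ (Subobject.factors_self E)
  · rw [← hg, NonUnitalRingObj.comp_mul]

/-- Each element has its own right factor in `E`; a common divisor of these two factors serves both,
the cofactors being absorbed on the left. -/
theorem exists_mul_eq_mul_eq {T : C} (p q : T ⟶ R) :
    Locally T fun T' f => ∃ s t e : T' ⟶ R, E.Factors e ∧ s * e = f ≫ p ∧ t * e = f ≫ q := by
  refine ((hE.exists_mul_eq p).and (hE.exists_mul_eq q)).bind ?_
  rintro T' f ⟨⟨s, a, ha, hs⟩, ⟨t, b, hb, ht⟩⟩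
  obtain ⟨T'', g, hg, z, a', b', hz, -, -, hza, hzb⟩ := hE.exists_common_divisor a b ha hb
  refine (Locally.of_epi g).mono ?_
  rintro T₃ k ⟨l, rfl⟩
  refine ⟨l ≫ (g ≫ s * a'), l ≫ (g ≫ t * b'), l ≫ z, ?_, ?_, ?_⟩
  · exact Subobject.factors_of_factors_right _ hz
  · rw [← NonUnitalRingObj.comp_mul, mul_assoc, ← hza, ← NonUnitalRingObj.comp_mul, hs]
    simp only [Category.assoc]
  · rw [← NonUnitalRingObj.comp_mul, mul_assoc, ← hzb, ← NonUnitalRingObj.comp_mul, ht]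
    simp only [Category.assoc]

/-- Any two elements locally have the form `p * q`, `q * r`. -/
theorem exists_mul_eq_eq_mul {T : C} (a b : T ⟶ R) :
    Locally T fun T' f => ∃ p q r : T' ⟶ R, p * q = f ≫ a ∧ q * r = f ≫ b :=
  (hE.exists_mul_eq_mul_eq a b).mono fun _ _ ⟨s, t, e, he, hs, ht⟩ =>
    ⟨s, e, t, hs, by rw [hE.central e t he, ht]⟩

/-- A balanced map to a group object that is additive in the first variable factors through the
multiplication of the ring object. -/
theorem exists_factor_mul {X : C} [GrpObj X] (F : ∀ {T : C}, (T ⟶ R) → (T ⟶ R) → (T ⟶ X))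
    (hcomp : ∀ {T T' : C} (g : T' ⟶ T) (p q : T ⟶ R), g ≫ F p q = F (g ≫ p) (g ≫ q))
    (hadd : ∀ {T : C} (p p' q : T ⟶ R), F (p + p') q = F p q * F p' q)
    (hbal : ∀ {T : C} (p q r : T ⟶ R), F (p * q) r = F p (q * r)) :
    ∃ y : R ⟶ X, ∀ {T : C} (p q : T ⟶ R), F p q = (p * q) ≫ y := by
  have hzero : ∀ {T : C} (q : T ⟶ R), F 0 q = 1 := fun q => by
    have := hadd 0 0 q
    rw [add_zero] at this
    exact left_eq_mul.mp this
  have key : ∀ {T : C} (p q p' q' : T ⟶ R), p * q = p' * q' → F p q = F p' q' := by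
    intro T p q p' q' h
    refine Locally.eq ((hE.exists_mul_eq_mul_eq q q').mono ?_)
    rintro T' f ⟨s, s', e, he, hs, hs'⟩
    rw [hcomp, hcomp, ← hs, ← hs', ← hbal, ← hbal]
    -- Both values now have second argument `e`, so by additivity it suffices that `F u e = 1` for
    -- the difference `u`, where `u * e = 0`. The last axiom of a weak unit gives `e = a' * a''`
    -- with `u * a' = 0`, and balancing moves `a'` to the left.
    have h₀ : (f ≫ p * s - f ≫ p' * s') * e = 0 := by
      rw [sub_mul, mul_assoc, hs, mul_assoc, hs', ← NonUnitalRingObj.comp_mul,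
        ← NonUnitalRingObj.comp_mul, h, sub_self]
    obtain ⟨T'', g, hg, a', a'', -, -, ha, hp⟩ := hE.exists_factor_of_mul_eq_zero _ e he h₀
    have h₁ : F (g ≫ (f ≫ p * s - f ≫ p' * s')) (g ≫ e) = 1 := by
      rw [ha, ← hbal, hp, hzero]
    have h₂ : F (f ≫ p * s - f ≫ p' * s') e = 1 := by
      rw [← cancel_epi g, hcomp, h₁, MonObj.comp_one]
    have h₃ := hadd (f ≫ p * s - f ≫ p' * s') (f ≫ p' * s') e
    rwa [sub_add_cancel, h₂, one_mul] at h₃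
  obtain ⟨y, hy⟩ := Locally.exists_glue (T := R) (X := X)
    (P := fun T f x => ∀ {T' : C} (g : T' ⟶ T) (p q : T' ⟶ R), p * q = g ≫ f → g ≫ x = F p q)
    (fun T' T'' f g x h T₃ g' p q hpq => by
      have := h (g' ≫ g) p q (by simpa using hpq)
      simpa using this)
    (fun T' f x x' h h' => by
      refine Locally.eq ((hE.exists_mul_eq f).mono ?_)
      rintro T'' g ⟨p, q, -, hpq⟩
      rw [h g p q hpq, h' g p q hpq])
    (by
      refine (hE.exists_mul_eq (𝟙 R)).mono ?_
      rintro T f ⟨p, q, -, hpq⟩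
      refine ⟨F p q, fun g p' q' h => ?_⟩
      rw [hcomp]
      refine key _ _ _ _ ?_
      rw [← NonUnitalRingObj.comp_mul, hpq, Category.comp_id, h])
  refine ⟨y, fun {T} p q => Locally.eq ((hy.pullback (p * q)).mono ?_)⟩
  intro T' f h
  have := h (𝟙 _) (f ≫ p) (f ≫ q) (by rw [Category.id_comp, ← NonUnitalRingObj.comp_mul])
  rw [hcomp, ← this, Category.id_comp, Category.assoc]

end IsWeakUnit

end WeakUnits

/-! ### Signed brackets of root elements -/

section RootBracket

variable {C : Type u} [Category.{v} C] [CartesianMonoidalCategory C] [InfinitaryPretopos C]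
  {R X G : C} [GrpObj X] [GrpObj G] {I : Type w} {f : X ⟶ G} (hf : IsCentralExtension f)
  (x : I → (R ⟶ G))

/-- The commutator of lifts of the values of two root morphisms, with a sign. -/
noncomputable def rootBracket (i j : I) (s : ℤˣ)
    {T : C} (p q : T ⟶ R) : T ⟶ X :=
  hf.bracket (p ≫ x i) (q ≫ x j) ^ (s : ℤ)

theorem comp_rootBracket {T T' : C} (g : T' ⟶ T) (i j : I) (s : ℤˣ) (p q : T ⟶ R) :
    g ≫ rootBracket hf x i j s p q = rootBracket hf x i j s (g ≫ p) (g ≫ q) := by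
  rw [rootBracket, rootBracket, GrpObj.comp_zpow, hf.comp_bracket, Category.assoc, Category.assoc]

theorem rootBracket_swap (i j : I) (s : ℤˣ) {T : C} (p q : T ⟶ R) :
    rootBracket hf x j i (-s) q p = rootBracket hf x i j s p q := by
  have : hf.bracket (q ≫ x j) (p ≫ x i) = (hf.bracket (p ≫ x i) (q ≫ x j))⁻¹ := by
    refine Locally.eq (((hf.exists_lift (p ≫ x i)).and (hf.exists_lift (q ≫ x j))).mono ?_)
    rintro T' g ⟨⟨a, ha⟩, ⟨b, hb⟩⟩
    rw [GrpObj.comp_inv, hf.comp_bracket, hf.comp_bracket, ← ha, ← hb, hf.bracket_comp_comp,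
      hf.bracket_comp_comp, commutatorElement_inv]
  rw [rootBracket, rootBracket, this, Units.val_neg, zpow_neg, inv_zpow, inv_inv]

end RootBracket

/-! ### Commuting lifts, additivity and triple products of brackets -/

section RootExtensions

variable {C : Type u} [Category.{v} C] [CartesianMonoidalCategory C] [InfinitaryPretopos C]
  {R : C} [NonUnitalRingObj R] {E : Subobject R} (hE : IsWeakUnit E)
  {I : Type w} {mulRel : I → I → I → ℤˣ → Prop} {comRel : I → I → Prop}
  {X G : C} [GrpObj X] [GrpObj G] {x : I → (R ⟶ G)} (hx : RootRelations mulRel comRel x)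
  {f : X ⟶ G} (hf : IsCentralExtension f)

-- Writing `p` locally as a product makes any lift of `p ≫ x i` a commutator of lifts from the
-- summands `k` and `l`, up to a central factor. A lift over `x j` commutes with these modulo the
-- kernel, hence with their commutator.
include hE hx hf in
theorem liftsCommute_of_mulRel {i j k l : I} {s : ℤˣ} (h : mulRel k l i s) (hk : comRel k j)
    (hl : comRel l j) : LiftsCommute f (x i) (x j) := by
  have := hf.isMonHom
  intro T a b p q ha hb
  refine Locally.eq ((hE.exists_mul_eq p).bind ?_)
  rintro T' g ⟨p', e, -, hp⟩
  refine ((hf.exists_lift (((s : ℤ) • p') ≫ x k)).and (hf.exists_lift (e ≫ x l))).mono ?_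
  rintro T'' g' ⟨⟨u, hu⟩, ⟨v, hv⟩⟩
  have hbb : ((g' ≫ g) ≫ b) ≫ f = (g' ≫ g ≫ q) ≫ x j := by simp only [Category.assoc, hb]
  have hcu : ⁅(g' ≫ g) ≫ b, u⁆ ≫ f = 1 := by
    rw [MonObj.commutatorElement_comp, hbb, hu, ← inv_inj, commutatorElement_inv, inv_one]
    simp only [← Category.assoc]
    exact hx.commute k j hk _ _
  have hcv : ⁅(g' ≫ g) ≫ b, v⁆ ≫ f = 1 := by
    rw [MonObj.commutatorElement_comp, hbb, hv, ← inv_inj, commutatorElement_inv, inv_one]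
    simp only [← Category.assoc]
    exact hx.commute l j hl _ _
  have hcom : Commute ((g' ≫ g) ≫ b) ⁅u, v⁆ :=
    commutatorElement_eq_one_iff_commute.mp (commutatorElement_commutatorElement_eq_one
      (hf.commute_of_comp_eq_one hcu) (hf.commute_of_comp_eq_one hcv))
  have hz : ((g' ≫ g) ≫ a * ⁅u, v⁆⁻¹) ≫ f = 1 := by
    rw [MonObj.mul_comp, GrpObj.inv_comp, mul_inv_eq_one, MonObj.commutatorElement_comp, hu, hv,
      ← Category.assoc, ← Category.assoc, hx.commutator k l i s h, NonUnitalRingObj.comp_zsmul,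
      smul_mul_assoc, units_smul_units_smul, ← NonUnitalRingObj.comp_mul, hp]
    simp only [Category.assoc, ha]
  have hcz := hf.commute_of_comp_eq_one hz ((g' ≫ g) ≫ b)
  have := hcz.mul_left hcom.symm
  rw [inv_mul_cancel_right] at this
  rw [MonObj.comp_mul, MonObj.comp_mul]
  exact this.eq

include hx in
theorem rootBracket_comp {i j t : I} {s : ℤˣ} (h : mulRel i j t s) {T : C} (p q : T ⟶ R) :
    rootBracket hf x i j s p q ≫ f = (p * q) ≫ x t := by
  have := hf.isMonHom
  rw [rootBracket, GrpObj.zpow_comp, hf.bracket_comp, hx.commutator i j t s h, ← hx.zsmul_comp,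
    units_smul_units_smul]

-- In `⁅a * a', b⁆ = a * ⁅a', b⁆ * a⁻¹ * ⁅a, b⁆` the conjugation disappears, because `⁅a', b⁆` lies
-- over `x t` and so commutes with the lift `a` of a value of `x i`.
include hx in
theorem rootBracket_add_left {i j t : I} {s : ℤˣ} (h : mulRel i j t s)
    (hi : LiftsCommute f (x t) (x i)) (ht : LiftsCommute f (x t) (x t)) {T : C}
    (p p' q : T ⟶ R) : rootBracket hf x i j s (p + p') q =
      rootBracket hf x i j s p q * rootBracket hf x i j s p' q := by
  have := hf.isMonHom
  have hb := fun p q : T ⟶ R => hf.bracket_comp (p ≫ x i) (q ≫ x j)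
  simp only [hx.commutator i j t s h] at hb
  have hcom : Commute (hf.bracket (p ≫ x i) (q ≫ x j)) (hf.bracket (p' ≫ x i) (q ≫ x j)) :=
    ht _ _ _ _ (hb p q) (hb p' q)
  rw [rootBracket, rootBracket, rootBracket, ← hcom.mul_zpow]
  congr 1
  refine Locally.eq (((hf.exists_lift (p ≫ x i)).and (hf.exists_lift (p' ≫ x i))).and
    (hf.exists_lift (q ≫ x j)) |>.mono ?_)
  rintro T' g ⟨⟨⟨a, ha⟩, ⟨a', ha'⟩⟩, ⟨b, hb'⟩⟩
  have hcom' : Commute ⁅a', b⁆ a := by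
    refine hi _ _ ((s : ℤ) • ((g ≫ p') * (g ≫ q))) (g ≫ p) ?_ (ha.trans (Category.assoc _ _ _).symm)
    rw [MonObj.commutatorElement_comp, ha', hb', ← Category.assoc, ← Category.assoc,
      hx.commutator i j t s h]
  rw [hcom.eq, MonObj.comp_mul, hf.comp_bracket, hf.comp_bracket, hf.comp_bracket, ← hx.add,
    MonObj.comp_mul, ← ha, ← ha', ← hb', ← MonObj.mul_comp, hf.bracket_comp_comp,
    hf.bracket_comp_comp, hf.bracket_comp_comp]
  have e : ⁅a * a', b⁆ = a * ⁅a', b⁆ * a⁻¹ * ⁅a, b⁆ := by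
    simp only [commutatorElement_def]; group
  rw [e, ← hcom'.eq, mul_inv_cancel_right]

include hx in
theorem rootBracket_add_right {i j t : I} {s : ℤˣ} (h : mulRel i j t s)
    (hj : LiftsCommute f (x t) (x j)) (ht : LiftsCommute f (x t) (x t)) {T : C}
    (p q q' : T ⟶ R) : rootBracket hf x i j s p (q + q') =
      rootBracket hf x i j s p q * rootBracket hf x i j s p q' := by
  have := hf.isMonHom
  have hb := fun p q : T ⟶ R => hf.bracket_comp (p ≫ x i) (q ≫ x j)
  simp only [hx.commutator i j t s h] at hb
  have hcom : Commute (hf.bracket (p ≫ x i) (q ≫ x j)) (hf.bracket (p ≫ x i) (q' ≫ x j)) :=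
    ht _ _ _ _ (hb p q) (hb p q')
  rw [rootBracket, rootBracket, rootBracket, ← hcom.mul_zpow]
  congr 1
  refine Locally.eq (((hf.exists_lift (p ≫ x i)).and (hf.exists_lift (q ≫ x j))).and
    (hf.exists_lift (q' ≫ x j)) |>.mono ?_)
  rintro T' g ⟨⟨⟨a, ha⟩, ⟨b, hb⟩⟩, ⟨b', hb'⟩⟩
  have hcom' : Commute ⁅a, b'⁆ b := by
    refine hj _ _ ((s : ℤ) • ((g ≫ p) * (g ≫ q'))) (g ≫ q) ?_ (hb.trans (Category.assoc _ _ _).symm)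
    rw [MonObj.commutatorElement_comp, ha, hb', ← Category.assoc, ← Category.assoc,
      hx.commutator i j t s h]
  rw [MonObj.comp_mul, hf.comp_bracket, hf.comp_bracket, hf.comp_bracket, ← hx.add,
    MonObj.comp_mul, ← ha, ← hb, ← hb', ← MonObj.mul_comp, hf.bracket_comp_comp,
    hf.bracket_comp_comp, hf.bracket_comp_comp]
  have e : ⁅a, b * b'⁆ = ⁅a, b⁆ * (b * ⁅a, b'⁆ * b⁻¹) := by
    simp only [commutatorElement_def]; group
  rw [e, ← hcom'.eq, mul_inv_cancel_right]

include hx in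
/-- The two bracketings of a triple product of root elements in a central extension. -/
theorem rootBracket_mul_eq_iff {a b c d e t : I} {s₁ s₂ s₃ s₄ : ℤˣ}
    (h₁ : mulRel a b d s₁) (h₂ : mulRel b c e s₂) (h₃ : mulRel a e t s₃) (h₄ : mulRel d c t s₄)
    (hs : s₁ * s₄ = s₂ * s₃) (hac : comRel a c) (htt : LiftsCommute f (x t) (x t))
    (hte : LiftsCommute f (x t) (x e)) (htd : LiftsCommute f (x t) (x d))
    {T : C} (p q r : T ⟶ R) {A B D : T ⟶ X} (hA : A ≫ f = p ≫ x a) (hB : B ≫ f = q ≫ x b)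
    (hD : D ≫ f = r ≫ x c) :
    rootBracket hf x a e s₃ p (q * r) = rootBracket hf x d c s₄ (p * q) r ↔
      Commute ⁅A, B⁆ ⁅B, D⁆ := by
  have := hf.isMonHom
  have hAB : ⁅A, B⁆ ≫ f = ((s₁ : ℤ) • (p * q)) ≫ x d := by
    rw [MonObj.commutatorElement_comp, hA, hB, hx.commutator a b d s₁ h₁]
  have hBD : ⁅B, D⁆ ≫ f = ((s₂ : ℤ) • (q * r)) ≫ x e := by
    rw [MonObj.commutatorElement_comp, hB, hD, hx.commutator b c e s₂ h₂]
  have hAE : ⁅A, ⁅B, D⁆⁆ ≫ f = ((s₃ : ℤ) • (p * ((s₂ : ℤ) • (q * r)))) ≫ x t := by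
    rw [MonObj.commutatorElement_comp, hA, hBD, hx.commutator a e t s₃ h₃]
  have hAD : ⁅A, D⁆ ≫ f = 1 := by
    rw [MonObj.commutatorElement_comp, hA, hD, hx.commute a c hac]
  -- `⁅B, D⁆` lies over `s₂ • (q * r)`; additivity turns this sign into an exponent. By `hs` the
  -- other bracketing acquires the same exponent.
  have hl : ⁅A, ⁅B, D⁆⁆ = rootBracket hf x a e s₃ p (q * r) ^ ((s₂ * s₃ : ℤˣ) : ℤ) := by
    rw [← zpow_units_zpow_units, ← zpow_units_of_add _ (rootBracket_add_right hx hf h₃ hte htt p),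
      rootBracket, zpow_units_zpow_units, ← hA, ← hBD, hf.bracket_comp_comp, Int.units_mul_self,
      Units.val_one, zpow_one]
  have hr : ⁅⁅A, B⁆, D⁆ = rootBracket hf x d c s₄ (p * q) r ^ ((s₁ * s₄ : ℤˣ) : ℤ) := by
    rw [← zpow_units_zpow_units, ← zpow_units_of_add (fun p => rootBracket hf x d c s₄ p r)
      (fun p p' => rootBracket_add_left hx hf h₄ htd htt p p' r),
      rootBracket, zpow_units_zpow_units, ← hD, ← hAB, hf.bracket_comp_comp, Int.units_mul_self,
      Units.val_one, zpow_one]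
  rw [← commutatorElement_assoc_iff (hf.commute_of_comp_eq_one hAD) (hte _ _ _ _ hAE hBD).symm,
    hl, hr, hs]
  constructor
  · intro h; rw [h]
  · intro h
    have := congr($h ^ ((s₂ * s₃ : ℤˣ) : ℤ))
    simpa only [zpow_units_zpow_units, Int.units_mul_self, Units.val_one, zpow_one] using this

end RootExtensions

/-! ### Balanced brackets and the section -/

section RootSections

variable {C : Type u} [Category.{v} C] [CartesianMonoidalCategory C] [InfinitaryPretopos C]
  {R : C} [NonUnitalRingObj R] {E : Subobject R} (hE : IsWeakUnit E)
  {I : Type w} {mulRel : I → I → I → ℤˣ → Prop} {comRel : I → I → Prop}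
  {X G : C} [GrpObj X] [GrpObj G] {x : I → (R ⟶ G)} (hx : RootRelations mulRel comRel x)
  {f : X ⟶ G} (hf : IsCentralExtension f)

include hx in
theorem rootBracket_mul_eq {a b c d e t : I} {s₁ s₂ s₃ s₄ : ℤˣ}
    (h₁ : mulRel a b d s₁) (h₂ : mulRel b c e s₂) (h₃ : mulRel a e t s₃) (h₄ : mulRel d c t s₄)
    (hs : s₁ * s₄ = s₂ * s₃) (hac : comRel a c) (htt : LiftsCommute f (x t) (x t))
    (hte : LiftsCommute f (x t) (x e)) (htd : LiftsCommute f (x t) (x d))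
    (hde : LiftsCommute f (x d) (x e)) {T : C} (p q r : T ⟶ R) :
    rootBracket hf x a e s₃ p (q * r) = rootBracket hf x d c s₄ (p * q) r := by
  have := hf.isMonHom
  refine Locally.eq ((((hf.exists_lift (p ≫ x a)).and (hf.exists_lift (q ≫ x b))).and
    (hf.exists_lift (r ≫ x c))).mono ?_)
  rintro T' g ⟨⟨⟨A, hA⟩, ⟨B, hB⟩⟩, ⟨D, hD⟩⟩
  rw [← Category.assoc] at hA hB hD
  rw [comp_rootBracket, comp_rootBracket, NonUnitalRingObj.comp_mul, NonUnitalRingObj.comp_mul,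
    rootBracket_mul_eq_iff hx hf h₁ h₂ h₃ h₄ hs hac htt hte htd _ _ _ hA hB hD]
  refine hde _ _ ((s₁ : ℤ) • ((g ≫ p) * (g ≫ q))) ((s₂ : ℤ) • ((g ≫ q) * (g ≫ r))) ?_ ?_
  · rw [MonObj.commutatorElement_comp, hA, hB, hx.commutator a b d s₁ h₁]
  · rw [MonObj.commutatorElement_comp, hB, hD, hx.commutator b c e s₂ h₂]

include hE hx in
theorem exists_comp_eq_rootBracket {i j t : I} {s : ℤˣ} (h : mulRel i j t s)
    (hi : LiftsCommute f (x t) (x i)) (ht : LiftsCommute f (x t) (x t))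
    (hbal : ∀ {T : C} (p q r : T ⟶ R),
      rootBracket hf x i j s (p * q) r = rootBracket hf x i j s p (q * r)) :
    ∃ y : R ⟶ X, ∀ {T : C} (p q : T ⟶ R), rootBracket hf x i j s p q = (p * q) ≫ y :=
  hE.exists_factor_mul (fun p q => rootBracket hf x i j s p q)
    (fun g p q => comp_rootBracket hf x g i j s p q)
    (fun p p' q => rootBracket_add_left hx hf h hi ht p p' q) hbal

include hE in
theorem rootBracket_eq_of_mul_left {i j k l : I} {s s' : ℤˣ}
    (h : ∀ {T : C} (p q r : T ⟶ R),
      rootBracket hf x i j s (p * q) r = rootBracket hf x k l s' (p * q) r)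
    {T : C} (p q : T ⟶ R) : rootBracket hf x i j s p q = rootBracket hf x k l s' p q := by
  refine Locally.eq ((hE.exists_mul_eq p).mono ?_)
  rintro T' g ⟨a, e, -, hp⟩
  rw [comp_rootBracket, comp_rootBracket, ← hp, h]

-- Since the right side of `h` depends only on `p * q` and `r`, commutativity lets `p` and `q` be
-- exchanged on the left side. After splitting `r = a * e`, exchanges with `a` bring both sides to
-- the bracket of `a` with `p * (q * e)`.
include hE in
theorem rootBracket_balanced_of_comm (hcomm : ∀ (T : C) (p q : T ⟶ R), p * q = q * p)
    {i j k l : I} {s s' : ℤˣ} (h : ∀ {T : C} (p q r : T ⟶ R),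
      rootBracket hf x i j s p (q * r) = rootBracket hf x k l s' (p * q) r)
    {T : C} (p q r : T ⟶ R) :
    rootBracket hf x i j s (p * q) r = rootBracket hf x i j s p (q * r) := by
  have h' : ∀ {T : C} (p q r : T ⟶ R),
      rootBracket hf x i j s p (q * r) = rootBracket hf x i j s q (p * r) := fun p q r => by
    rw [h, h, hcomm]
  refine Locally.eq ((hE.exists_mul_eq r).mono ?_)
  rintro T' g ⟨a, e, -, hr⟩
  rw [comp_rootBracket, comp_rootBracket, NonUnitalRingObj.comp_mul, NonUnitalRingObj.comp_mul,
    ← hr, h', ← mul_assoc _ a, hcomm _ _ a, mul_assoc, mul_assoc, h' _ a]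

include hE in
theorem rootBracket_eq_of_comm (hcomm : ∀ (T : C) (p q : T ⟶ R), p * q = q * p)
    {i j k l : I} {s s' : ℤˣ} (h : ∀ {T : C} (p q r : T ⟶ R),
      rootBracket hf x i j s p (q * r) = rootBracket hf x k l s' (p * q) r)
    {T : C} (p q : T ⟶ R) : rootBracket hf x i j s p q = rootBracket hf x k l s' p q :=
  rootBracket_eq_of_mul_left hE hf
    (fun p q r => by rw [rootBracket_balanced_of_comm hE hf hcomm h, h]) p q

include hE in
/-- If the brackets of lifts of root elements depend only on products, then the root group splits
in its central extension. -/
theorem IsRootGroup.exists_section (hx : IsRootGroup mulRel comRel x)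
    (hdec : ∀ t, ∃ i j s, mulRel i j t s ∧ LiftsCommute f (x t) (x i))
    (htt : ∀ t, LiftsCommute f (x t) (x t))
    (hcom : ∀ i j, comRel i j → LiftsCommute f (x i) (x j))
    (hy : ∀ t, ∃ y : R ⟶ X, ∀ i j s, mulRel i j t s → ∀ {T : C} (p q : T ⟶ R),
      rootBracket hf x i j s p q = (p * q) ≫ y) :
    ∃ s : G ⟶ X, IsMonHom s ∧ s ≫ f = 𝟙 G := by
  have hr := hx.relations
  choose y hy using hy
  have hyf : ∀ t, y t ≫ f = x t := by
    intro t
    obtain ⟨i, j, s, h, -⟩ := hdec t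
    refine Locally.eq ((hE.exists_mul_eq (𝟙 R)).mono ?_)
    rintro T g ⟨a, e, -, hg⟩
    rw [Category.comp_id] at hg
    rw [← hg, ← Category.assoc, ← hy t i j s h, rootBracket_comp hr hf h]
  have hadd : ∀ t {T : C} (p q : T ⟶ R), (p + q) ≫ y t = (p ≫ y t) * (q ≫ y t) := by
    intro t T p q
    obtain ⟨i, j, s, h, ht⟩ := hdec t
    refine Locally.eq ((hE.exists_mul_eq_mul_eq p q).mono ?_)
    rintro T' g ⟨a, b, e, -, hp, hq⟩
    rw [← Category.assoc, NonUnitalRingObj.comp_add, MonObj.comp_mul, ← Category.assoc,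
      ← Category.assoc, ← hp, ← hq, ← add_mul, ← hy t i j s h, ← hy t i j s h, ← hy t i j s h,
      rootBracket_add_left hr hf h ht (htt t)]
  have hyr : RootRelations mulRel comRel y :=
    { add := fun i T p q => (hadd i p q).symm
      commutator := fun i j k s h T p q => by
        rw [zpow_units_of_add (fun p : T ⟶ R => p ≫ y k) (hadd k), ← hy k i j s h, rootBracket,
          zpow_units_zpow_units, Int.units_mul_self, Units.val_one, zpow_one,
          ← hf.bracket_comp_comp, Category.assoc, Category.assoc, hyf, hyf]
      commute := fun i j h T p q => commutatorElement_eq_one_iff_commute.mpr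
        (hcom i j h _ _ p q (by rw [Category.assoc, hyf]) (by rw [Category.assoc, hyf])) }
  obtain ⟨s, ⟨hs, hs'⟩, -⟩ := hx.universal X y hyr
  have := hf.isMonHom
  refine ⟨s, hs, ?_⟩
  obtain ⟨_, -, hu⟩ := hx.universal G x hr
  rw [hu (s ≫ f) ⟨inferInstance, fun i => by rw [← Category.assoc, hs', hyf]⟩,
    hu (𝟙 G) ⟨inferInstance, fun i => Category.comp_id _⟩]

end RootSections

/-! ### Type `A` -/

section Linear

variable {C : Type u} [Category.{v} C] [CartesianMonoidalCategory C]
  {R : C} [NonUnitalRingObj R] {n : ℕ}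

/-- The roots of type `A`. -/
abbrev LinearRoot (n : ℕ) : Type := {p : Fin n × Fin n // p.1 ≠ p.2}

/-- The nontrivial commutator relations of type `A`. -/
def LinearRoot.mulRel (a b c : LinearRoot n) (s : ℤˣ) : Prop :=
  a.1.2 = b.1.1 ∧ c.1.1 = a.1.1 ∧ c.1.2 = b.1.2 ∧ s = 1

/-- The trivial commutator relations of type `A`. -/
def LinearRoot.comRel (a b : LinearRoot n) : Prop :=
  a.1.2 ≠ b.1.1 ∧ a.1.1 ≠ b.1.2

theorem linearSteinbergRelations_iff {G : C} [GrpObj G] (x : ∀ i j : Fin n, i ≠ j → (R ⟶ G)) :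
    LinearSteinbergRelations x ↔
      RootRelations LinearRoot.mulRel LinearRoot.comRel
        (fun a : LinearRoot n => x a.1.1 a.1.2 a.2) where
  mp h :=
    { add := fun i => h.add _ _ i.2
      commutator := by
        rintro ⟨⟨i, j⟩, hij⟩ ⟨⟨k, l⟩, hkl⟩ ⟨⟨i', l'⟩, hil⟩ s ⟨h₁, h₂, h₃, rfl⟩ T p q
        dsimp only at h₁ h₂ h₃
        subst h₁ h₂ h₃
        simpa using h.commutator _ _ _ hij hkl hil p q
      commute := fun i j hs => h.commute _ _ _ _ i.2 j.2 hs.1 hs.2 }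
  mpr h :=
    { add := fun i j hij => h.add ⟨(i, j), hij⟩
      commutator := fun i j k hij hjk hik T p q => by
        simpa using h.commutator ⟨(i, j), hij⟩ ⟨(j, k), hjk⟩ ⟨(i, k), hik⟩ 1
          ⟨rfl, rfl, rfl, rfl⟩ p q
      commute := fun i j k l hij hkl hjk hil =>
        h.commute ⟨(i, j), hij⟩ ⟨(k, l), hkl⟩ ⟨hjk, hil⟩ }

theorem isLinearSteinbergGroup_iff {G : C} [GrpObj G] (x : ∀ i j : Fin n, i ≠ j → (R ⟶ G)) :
    IsLinearSteinbergGroup x ↔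
      IsRootGroup LinearRoot.mulRel LinearRoot.comRel
        (fun a : LinearRoot n => x a.1.1 a.1.2 a.2) where
  mp h :=
    { relations := (linearSteinbergRelations_iff x).mp h.relations
      universal := fun H _ y hy => by
        obtain ⟨g, ⟨hg, hg'⟩, hu⟩ := h.universal H (fun i j hij => y ⟨(i, j), hij⟩)
          ((linearSteinbergRelations_iff _).mpr hy)
        exact ⟨g, ⟨hg, fun i => hg' _ _ i.2⟩, fun g' h' =>
          hu g' ⟨h'.1, fun i j hij => h'.2 ⟨(i, j), hij⟩⟩⟩ }
  mpr h :=
    { relations := (linearSteinbergRelations_iff x).mpr h.relations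
      universal := fun H _ y hy => by
        obtain ⟨g, ⟨hg, hg'⟩, hu⟩ := h.universal H (fun a => y a.1.1 a.1.2 a.2)
          ((linearSteinbergRelations_iff _).mp hy)
        exact ⟨g, ⟨hg, fun i j hij => hg' ⟨(i, j), hij⟩⟩,
          fun g' h' => hu g' ⟨h'.1, fun i => h'.2 _ _ _⟩⟩ }

variable [InfinitaryPretopos C]

theorem exists_isLinearSteinbergGroup (n : ℕ) (R : C) [NonUnitalRingObj R] :
    ∃ (G : C) (_ : GrpObj G) (x : ∀ i j : Fin n, i ≠ j → (R ⟶ G)), IsLinearSteinbergGroup x := by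
  obtain ⟨G, hG, x, hx⟩ :=
    exists_isRootGroup (LinearRoot.mulRel (n := n)) LinearRoot.comRel R
  exact ⟨G, hG, fun i j hij => x ⟨(i, j), hij⟩, (isLinearSteinbergGroup_iff _).mpr hx⟩

theorem Fin.exists_not_mem_of_card_lt {s : Finset (Fin n)} (h : s.card < n) : ∃ m, m ∉ s := by
  by_contra! H
  have := Finset.card_le_card (s := Finset.univ) (t := s) fun m _ => H m
  rw [Finset.card_univ, Fintype.card_fin] at this
  omega

theorem centrallyClosed_of_isLinearSteinbergGroup (hR : WeaklyUnital R) (hn : 5 ≤ n) {G : C}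
    [GrpObj G] {x : ∀ i j : Fin n, i ≠ j → (R ⟶ G)} (hx : IsLinearSteinbergGroup x) :
    CentrallyClosed G := by
  obtain ⟨E, hE⟩ := hR
  intro X _ f hf
  rw [isLinearSteinbergGroup_iff] at hx
  generalize (fun a : LinearRoot n => x a.1.1 a.1.2 a.2) = x at hx
  have hr := hx.relations
  -- The rank bound enters here: with at least five indices, one lies outside any given four.
  have hpick : ∀ i j k l : Fin n, ∃ m, m ≠ i ∧ m ≠ j ∧ m ≠ k ∧ m ≠ l := by
    intro i j k l
    have hc := Finset.card_le_four (a := i) (b := j) (c := k) (d := l)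
    obtain ⟨m, hm⟩ := Fin.exists_not_mem_of_card_lt (show Finset.card {i, j, k, l} < n by omega)
    exact ⟨m, by simpa using hm⟩
  have hcom : ∀ a b : LinearRoot n, LinearRoot.comRel a b → LiftsCommute f (x a) (x b) := by
    rintro ⟨⟨i, j⟩, hij⟩ ⟨⟨k, l⟩, hkl⟩ ⟨hjk, hil⟩
    -- The root `(i, j)` splits as `(i, m)` and `(m, j)`; since `m` avoids `k` and `l`, both root
    -- elements commute with those of `(k, l)`.
    obtain ⟨m, hi, hj, hk, hl⟩ := hpick i j k l
    exact liftsCommute_of_mulRel hE hr hf (i := ⟨(i, j), hij⟩)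
      (k := ⟨(i, m), hi.symm⟩) (l := ⟨(m, j), hj⟩) (s := 1)
      ⟨rfl, rfl, rfl, rfl⟩ ⟨hk, hil⟩ ⟨hjk, hl⟩
  -- The two brackets are the two bracketings along the path `i, j, j', k`, with the middle factor
  -- `q` on the edge from `j` to `j'`.
  have hedge : ∀ (i k j j' : Fin n) (hik : i ≠ k) (hij : i ≠ j) (hjk : j ≠ k) (hij' : i ≠ j')
      (hjk' : j' ≠ k), j ≠ j' → ∀ {T : C} (p q r : T ⟶ R),
      rootBracket hf x ⟨(i, j), hij⟩ ⟨(j, k), hjk⟩ 1 p (q * r) =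
        rootBracket hf x ⟨(i, j'), hij'⟩ ⟨(j', k), hjk'⟩ 1 (p * q) r := by
    intro i k j j' hik hij hjk hij' hjk' hjj T p q r
    exact rootBracket_mul_eq hr hf (a := ⟨(i, j), hij⟩) (b := ⟨(j, j'), hjj⟩) (c := ⟨(j', k), hjk'⟩)
      (d := ⟨(i, j'), hij'⟩) (e := ⟨(j, k), hjk⟩) (t := ⟨(i, k), hik⟩) (s₁ := 1) (s₂ := 1)
      ⟨rfl, rfl, rfl, rfl⟩ ⟨rfl, rfl, rfl, rfl⟩ ⟨rfl, rfl, rfl, rfl⟩ ⟨rfl, rfl, rfl, rfl⟩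
      rfl ⟨hjj, hik⟩ (hcom _ _ ⟨hik.symm, hik⟩) (hcom _ _ ⟨hjk.symm, hik⟩)
      (hcom _ _ ⟨hik.symm, hij'⟩) (hcom _ _ ⟨hjj.symm, hik⟩) p q r
  have heq : ∀ (i k j j' : Fin n) (hij : i ≠ j) (hjk : j ≠ k) (hij' : i ≠ j') (hjk' : j' ≠ k),
      i ≠ k → ∀ {T : C} (p q : T ⟶ R), rootBracket hf x ⟨(i, j), hij⟩ ⟨(j, k), hjk⟩ 1 p q =
        rootBracket hf x ⟨(i, j'), hij'⟩ ⟨(j', k), hjk'⟩ 1 p q := by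
    intro i k j j' hij hjk hij' hjk' hik T p q
    -- By `hedge`, the brackets through `j` and `j'` at `(p * q, r)` both equal the bracket through
    -- the third index `m` at `(p, q * r)`.
    obtain ⟨m, hi, hk, hj, hj'⟩ := hpick i k j j'
    exact rootBracket_eq_of_mul_left hE hf (fun p q r => by
      rw [← hedge i k m j hik hi.symm hk hij hjk hj, ← hedge i k m j' hik hi.symm hk hij' hjk' hj'])
      p q
  refine hx.exists_section hE hf ?_ (fun t => hcom _ _ ⟨t.2.symm, t.2⟩) hcom ?_
  · rintro ⟨⟨i, k⟩, hik⟩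
    obtain ⟨m, hi, hk, -, -⟩ := hpick i k i k
    exact ⟨⟨(i, m), hi.symm⟩, ⟨(m, k), hk⟩, 1, ⟨rfl, rfl, rfl, rfl⟩, hcom _ _ ⟨hik.symm, hi.symm⟩⟩
  · rintro ⟨⟨i, k⟩, hik⟩
    obtain ⟨m, hi, hk, -, -⟩ := hpick i k i k
    obtain ⟨m', hi', hk', hm, -⟩ := hpick i k m m
    obtain ⟨y, hy⟩ := exists_comp_eq_rootBracket (i := ⟨(i, m), hi.symm⟩) (j := ⟨(m, k), hk⟩)
      (t := ⟨(i, k), hik⟩) (s := 1) hE hr hf ⟨rfl, rfl, rfl, rfl⟩ (hcom _ _ ⟨hik.symm, hi.symm⟩)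
      (hcom _ _ ⟨hik.symm, hik⟩) (fun p q r => by
        -- Passing to `m'` keeps the arguments, while returning to `m` along an edge moves `q` to
        -- the other factor.
        rw [heq i k m m' hi.symm hk hi'.symm hk' hik (p * q),
          hedge i k m m' hik hi.symm hk hi'.symm hk' hm.symm])
    refine ⟨y, ?_⟩
    rintro ⟨⟨i', j⟩, hij⟩ ⟨⟨j', k'⟩, hjk⟩ s ⟨h₁, h₂, h₃, rfl⟩ T p q
    dsimp only at h₁ h₂ h₃
    subst h₁ h₂ h₃
    rw [← hy, heq i k j m hij hjk hi.symm hk hik]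

end Linear

/-! ### Pairings in simply laced root systems -/

section SimplyLaced

variable {I : Type w₁} {M : Type w₂} {N : Type w₃} [AddCommGroup M] [Module ℝ M]
  [AddCommGroup N] [Module ℝ N] {P : RootPairing I ℝ M N}

theorem RootPairing.exists_root_eq_neg (P : RootPairing I ℝ M N) (i : I) :
    ∃ k, P.root k = -P.root i :=
  ⟨P.reflectionPerm i i, by rw [P.root_reflectionPerm, P.reflection_apply_self]⟩

variable [P.IsCrystallographic]

theorem RootPairing.pairingIn_int_of_root_eq_sub {i j k : I} (h : P.root k = P.root i - P.root j)
    (l : I) : P.pairingIn ℤ k l = P.pairingIn ℤ i l - P.pairingIn ℤ j l := by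
  have := P.pairingIn_eq_add_of_root_eq_add (S := ℤ) (j := l)
    (show P.root i = P.root k + P.root j by rw [h, sub_add_cancel])
  omega

theorem RootPairing.pairingIn_int_of_root_eq_neg {i k : I} (h : P.root k = -P.root i) (l : I) :
    P.pairingIn ℤ k l = -P.pairingIn ℤ i l := by
  have h' : P.pairing k l = -P.pairing i l := by
    rw [← P.root_coroot'_eq_pairing, h, map_neg, P.root_coroot'_eq_pairing]
  rw [← P.algebraMap_pairingIn ℤ, ← P.algebraMap_pairingIn ℤ] at h'
  simpa [← Int.cast_neg, Int.cast_inj] using h'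

variable [Finite I]

theorem RootPairing.exists_root_eq_sub {i j : I} (h : P.pairingIn ℤ i j = 1) :
    ∃ k, P.root k = P.root i - P.root j := by
  refine P.root_sub_root_mem_of_pairingIn_pos (by omega) fun h' => ?_
  rw [h', P.pairingIn_same] at h
  omega

theorem RootPairing.exists_root_eq_add {i j : I} (h : P.pairingIn ℤ i j = -1) :
    ∃ k, P.root k = P.root i + P.root j := by
  refine P.root_add_root_mem_of_pairingIn_neg (by omega) fun h' => ?_
  have := P.pairingIn_int_of_root_eq_neg h' j
  rw [P.pairingIn_same] at this
  omega

variable [P.IsReduced]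

namespace RootIsSimplyLaced

variable (hP : RootIsSimplyLaced P)

include hP

theorem pairingIn_mem (i j : I) : (P.pairingIn ℤ i j, P.pairingIn ℤ j i) ∈
    ({(0, 0), (1, 1), (-1, -1), (2, 2), (-2, -2)} : Set (ℤ × ℤ)) := by
  have : Module.IsReflexive ℝ M := .of_isPerfPair P.toLinearMap
  rcases eq_or_ne i j with rfl | h₁
  · simp
  rcases eq_or_ne (P.root i) (-P.root j) with h₂ | h₂
  · rw [← P.pairingIn_neg_two_neg_two_iff ℤ] at h₂
    simp [h₂]
  have hc : ∀ i j : I, P.root i ≠ P.root j → P.root i ≠ -P.root j →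
      P.pairingIn ℤ i j = 0 ∨ P.pairingIn ℤ i j = 1 ∨ P.pairingIn ℤ i j = -1 := by
    intro i j h h'
    have := hP i j h h'
    rw [← P.algebraMap_pairingIn ℤ] at this
    simp only [algebraMap_int_eq, eq_intCast] at this
    exact_mod_cast this
  have h₃ := hc i j (P.root.injective.ne h₁) h₂
  have h₄ := hc j i (P.root.injective.ne h₁.symm) (fun h => h₂ (by rw [h, neg_neg]))
  have := P.pairingIn_pairingIn_mem_set_of_isCrystal_of_isRed i j
  simp only [Set.mem_insert_iff, Set.mem_singleton_iff, Prod.mk.injEq] at this ⊢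
  omega

theorem pairingIn_comm (i j : I) : P.pairingIn ℤ i j = P.pairingIn ℤ j i := by
  have := hP.pairingIn_mem i j
  simp only [Set.mem_insert_iff, Set.mem_singleton_iff, Prod.mk.injEq] at this
  omega

theorem le_two (i j : I) : P.pairingIn ℤ i j ≤ 2 := by
  have := hP.pairingIn_mem i j
  simp only [Set.mem_insert_iff, Set.mem_singleton_iff, Prod.mk.injEq] at this
  omega

theorem neg_two_le (i j : I) : -2 ≤ P.pairingIn ℤ i j := by
  have := hP.pairingIn_mem i j
  simp only [Set.mem_insert_iff, Set.mem_singleton_iff, Prod.mk.injEq] at this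
  omega

theorem eq_of_pairingIn_eq_two {i j : I} (h : P.pairingIn ℤ i j = 2) : i = j := by
  have : Module.IsReflexive ℝ M := .of_isPerfPair P.toLinearMap
  exact (P.pairingIn_two_two_iff ℤ i j).mp ⟨h, by rw [hP.pairingIn_comm, h]⟩

theorem eq_neg_of_pairingIn_eq_neg_two {i j : I} (h : P.pairingIn ℤ i j = -2) :
    P.root i = -P.root j := by
  have : Module.IsReflexive ℝ M := .of_isPerfPair P.toLinearMap
  exact (P.pairingIn_neg_two_neg_two_iff ℤ i j).mp ⟨h, by rw [hP.pairingIn_comm, h]⟩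

theorem pairingIn_add_right {i j k : I} (h : P.root k = P.root i + P.root j) (l : I) :
    P.pairingIn ℤ l k = P.pairingIn ℤ l i + P.pairingIn ℤ l j := by
  rw [hP.pairingIn_comm l, hP.pairingIn_comm l, hP.pairingIn_comm l,
    P.pairingIn_eq_add_of_root_eq_add h]

theorem pairingIn_sub_right {i j k : I} (h : P.root k = P.root i - P.root j) (l : I) :
    P.pairingIn ℤ l k = P.pairingIn ℤ l i - P.pairingIn ℤ l j := by
  rw [hP.pairingIn_comm l, hP.pairingIn_comm l, hP.pairingIn_comm l,
    P.pairingIn_int_of_root_eq_sub h]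

/-- If `a` is the pairing sought, then pairing the sum with itself gives `2 = 4 + 2 * a`. -/
theorem pairingIn_eq_neg_one {i j k : I} (h : P.root k = P.root i + P.root j) :
    P.pairingIn ℤ i j = -1 := by
  have h₁ := P.pairingIn_eq_add_of_root_eq_add (S := ℤ) (j := k) h
  have h₂ := hP.pairingIn_add_right h i
  have h₃ := hP.pairingIn_add_right h j
  have h₄ := hP.pairingIn_comm i j
  rw [P.pairingIn_same] at h₁ h₂ h₃
  omega

theorem odd_pairingIn_iff (i j : I) :
    Odd (P.pairingIn ℤ i j) ↔ P.pairingIn ℤ i j = 1 ∨ P.pairingIn ℤ i j = -1 := by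
  have h₁ := hP.le_two i j
  have h₂ := hP.neg_two_le i j
  generalize P.pairingIn ℤ i j = a at *
  rw [Int.odd_iff]
  omega

theorem isOrthogonal_of_pairingIn_eq_zero {i j : I} (h : P.pairingIn ℤ i j = 0) :
    P.IsOrthogonal i j := by
  have h' := hP.pairingIn_comm i j
  rw [h] at h'
  constructor
  · rw [← P.algebraMap_pairingIn ℤ, h, map_zero]
  · rw [← P.algebraMap_pairingIn ℤ, ← h', map_zero]

/-- In rank at least four, the roots adjacent to a given root are not contained in the span of this
root and two more vectors. -/
theorem exists_pairingIn_eq_one [P.IsRootSystem] [P.IsIrreducible]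
    (hM : 4 ≤ Module.finrank ℝ M) (i : I) (x y : M) :
    ∃ k, P.pairingIn ℤ k i = 1 ∧ P.root k ∉ Submodule.span ℝ {P.root i, x, y} := by
  by_contra! H
  have : Module.Finite ℝ M := Module.finite_of_finrank_pos (by omega)
  -- By irreducibility `s` spans `M` once every root outside its span is orthogonal to all of `s`.
  -- The negated claim would put this span inside one of dimension at most three.
  let s : Set I := insert i {k | P.pairingIn ℤ k i = 1}
  have hneg : ∀ j, P.pairingIn ℤ j i = -1 → P.root j ∈ Submodule.span ℝ (P.root '' s) := by
    intro j hj
    obtain ⟨k, hk⟩ := P.exists_root_eq_neg j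
    have hk' := P.pairingIn_int_of_root_eq_neg hk i
    rw [← neg_neg (P.root j), ← hk]
    exact neg_mem (Submodule.subset_span ⟨k, .inr (by simp [hk', hj]), rfl⟩)
  have hpos : ∀ j, P.pairingIn ℤ j i = 1 → P.root j ∈ Submodule.span ℝ (P.root '' s) :=
    fun j hj => Submodule.subset_span ⟨j, .inr hj, rfl⟩
  have hs : Submodule.span ℝ (P.root '' s) = ⊤ := by
    refine P.span_root_image_eq_top_of_forall_orthogonal s ⟨i, .inl rfl⟩ fun j hj => ?_
    have hi : P.pairingIn ℤ j i = 0 := by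
      by_contra h
      have h₁ := hP.le_two j i
      have h₂ := hP.neg_two_le j i
      have : P.pairingIn ℤ j i = 2 ∨ P.pairingIn ℤ j i = -2 ∨ P.pairingIn ℤ j i = 1 ∨
        P.pairingIn ℤ j i = -1 := by omega
      rcases this with h | h | h | h
      · rw [hP.eq_of_pairingIn_eq_two h] at hj
        exact hj (Submodule.subset_span ⟨i, .inl rfl, rfl⟩)
      · rw [hP.eq_neg_of_pairingIn_eq_neg_two h] at hj
        exact hj (neg_mem (Submodule.subset_span ⟨i, .inl rfl, rfl⟩))
      · exact hj (hpos j h)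
      · exact hj (hneg j h)
    rintro k (rfl | hk)
    · exact hP.isOrthogonal_of_pairingIn_eq_zero hi
    · refine hP.isOrthogonal_of_pairingIn_eq_zero ?_
      have hk : P.pairingIn ℤ k i = 1 := hk
      by_contra h
      have h₁ := hP.le_two j k
      have h₂ := hP.neg_two_le j k
      have : P.pairingIn ℤ j k = 2 ∨ P.pairingIn ℤ j k = -2 ∨ P.pairingIn ℤ j k = 1 ∨
        P.pairingIn ℤ j k = -1 := by omega
      rcases this with h | h | h | h
      · rw [hP.eq_of_pairingIn_eq_two h] at hi
        omega
      · have := P.pairingIn_int_of_root_eq_neg (hP.eq_neg_of_pairingIn_eq_neg_two h) i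
        omega
      · obtain ⟨l, hl⟩ := P.exists_root_eq_sub h
        have := P.pairingIn_int_of_root_eq_sub hl i
        rw [← sub_add_cancel (P.root j) (P.root k), ← hl] at hj
        exact hj (add_mem (hneg l (by omega)) (hpos k hk))
      · obtain ⟨l, hl⟩ := P.exists_root_eq_add h
        have := P.pairingIn_eq_add_of_root_eq_add (S := ℤ) (j := i) hl
        rw [← add_sub_cancel_right (P.root j) (P.root k), ← hl] at hj
        exact hj (sub_mem (hpos l (by omega)) (hpos k hk))
  have hle : Submodule.span ℝ (P.root '' s) ≤ Submodule.span ℝ {P.root i, x, y} := by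
    rw [Submodule.span_le]
    rintro _ ⟨k, rfl | hk, rfl⟩
    · exact Submodule.subset_span (by simp)
    · exact H k hk
  rw [hs, top_le_iff] at hle
  classical
  have h₁ := finrank_span_finset_le_card (R := ℝ) ({P.root i, x, y} : Finset M)
  have h₂ := Finset.card_le_three (a := P.root i) (b := x) (c := y)
  have h₃ : Module.finrank ℝ (Submodule.span ℝ (({P.root i, x, y} : Finset M) : Set M)) =
      Module.finrank ℝ M := by
    rw [Finset.coe_insert, Finset.coe_pair, hle, finrank_top]
  rw [Set.finrank, h₃] at h₁
  omega

end RootIsSimplyLaced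

end SimplyLaced

/-! ### Recognition of `D₄` -/

section TypeD4

variable {I : Type w₁} {M : Type w₂} {N : Type w₃} [Finite I] [AddCommGroup M] [Module ℝ M]
  [AddCommGroup N] [Module ℝ N] {P : RootPairing I ℝ M N} [P.IsCrystallographic] [P.IsReduced]

namespace RootIsSimplyLaced

variable (hP : RootIsSimplyLaced P)

include hP

/-- If the pairing is `1`, subtracting `d` from `k` makes it `-1` and preserves the pairings with
roots orthogonal to `d`. -/
theorem exists_pairingIn_eq_neg_one_of_odd {k d : I} (h : Odd (P.pairingIn ℤ k d)) :
    ∃ (k' : I) (e : ℕ), e ≤ 1 ∧ P.root k = P.root k' + e • P.root d ∧ P.pairingIn ℤ k' d = -1 ∧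
      ∀ l, P.pairingIn ℤ d l = 0 → P.pairingIn ℤ k' l = P.pairingIn ℤ k l := by
  obtain h | h := (hP.odd_pairingIn_iff k d).mp h
  · obtain ⟨k', hk'⟩ := P.exists_root_eq_sub h
    refine ⟨k', 1, le_rfl, by rw [hk', one_smul, sub_add_cancel], ?_, fun l hl => ?_⟩
    · rw [P.pairingIn_int_of_root_eq_sub hk', h, P.pairingIn_same]
      norm_num
    · rw [P.pairingIn_int_of_root_eq_sub hk', hl, sub_zero]
  · exact ⟨k, 0, zero_le_one, by simp, h, fun l _ => rfl⟩

section

variable {d₁ d₂ d₃ c : I} (h₁₂ : P.pairingIn ℤ d₁ d₂ = 0) (h₁₃ : P.pairingIn ℤ d₁ d₃ = 0)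
  (h₂₃ : P.pairingIn ℤ d₂ d₃ = 0) (h₁ : P.pairingIn ℤ c d₁ = -1) (h₂ : P.pairingIn ℤ c d₂ = -1)
  (h₃ : P.pairingIn ℤ c d₃ = -1)

include h₁₂ h₁₃ h₂₃ h₁ h₂ h₃

/-- The sum `c₃ = c + d₁ + d₂ + d₃` is a root, and the pairing of `k` with `c₃` is that with `c`
minus three. As both lie between `-2` and `2`, either `k` pairs to `2` with `c` or it pairs to `-2`
with `c₃`. -/
theorem root_eq_or_of_pairingIn_eq_neg_one {k : I} (hk₁ : P.pairingIn ℤ k d₁ = -1)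
    (hk₂ : P.pairingIn ℤ k d₂ = -1) (hk₃ : P.pairingIn ℤ k d₃ = -1) :
    P.root k = P.root c ∨ P.root k = -(P.root c + P.root d₁ + P.root d₂ + P.root d₃) := by
  obtain ⟨c₁, hc₁⟩ := P.exists_root_eq_add h₁
  have e₁ := P.pairingIn_eq_add_of_root_eq_add (S := ℤ) (j := d₂) hc₁
  obtain ⟨c₂, hc₂⟩ := P.exists_root_eq_add (i := c₁) (j := d₂) (by omega)
  have e₂ := P.pairingIn_eq_add_of_root_eq_add (S := ℤ) (j := d₃) hc₁
  have e₃ := P.pairingIn_eq_add_of_root_eq_add (S := ℤ) (j := d₃) hc₂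
  obtain ⟨c₃, hc₃⟩ := P.exists_root_eq_add (i := c₂) (j := d₃) (by omega)
  have e₄ := hP.pairingIn_add_right hc₁ k
  have e₅ := hP.pairingIn_add_right hc₂ k
  have e₆ := hP.pairingIn_add_right hc₃ k
  have e₇ := hP.neg_two_le k c₃
  have e₈ := hP.le_two k c
  obtain h | h : P.pairingIn ℤ k c = 2 ∨ P.pairingIn ℤ k c₃ = -2 := by omega
  · exact .inl (by rw [hP.eq_of_pairingIn_eq_two h])
  · exact .inr (by rw [hP.eq_neg_of_pairingIn_eq_neg_two h, hc₃, hc₂, hc₁])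

theorem root_eq_or_of_odd {k : I} (hk₁ : Odd (P.pairingIn ℤ k d₁))
    (hk₂ : Odd (P.pairingIn ℤ k d₂)) (hk₃ : Odd (P.pairingIn ℤ k d₃)) :
    ∃ a b e : ℕ, P.root k = P.root c + a • P.root d₁ + b • P.root d₂ + e • P.root d₃ ∨
      P.root k = -(P.root c + a • P.root d₁ + b • P.root d₂ + e • P.root d₃) := by
  obtain ⟨k₁, a, ha, r₁, u₁, v₁⟩ := hP.exists_pairingIn_eq_neg_one_of_odd hk₁
  rw [← v₁ _ h₁₂] at hk₂
  rw [← v₁ _ h₁₃] at hk₃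
  obtain ⟨k₂, b, hb, r₂, u₂, v₂⟩ := hP.exists_pairingIn_eq_neg_one_of_odd hk₂
  rw [← v₂ _ h₂₃] at hk₃
  obtain ⟨k₃, e, he, r₃, u₃, v₃⟩ := hP.exists_pairingIn_eq_neg_one_of_odd hk₃
  rw [hP.pairingIn_comm] at h₁₂ h₁₃ h₂₃
  rw [← v₂ _ h₁₂, ← v₃ _ h₁₃] at u₁
  rw [← v₃ _ h₂₃] at u₂
  rw [hP.pairingIn_comm] at h₁₂ h₁₃ h₂₃
  obtain h | h := hP.root_eq_or_of_pairingIn_eq_neg_one h₁₂ h₁₃ h₂₃ h₁ h₂ h₃ u₁ u₂ u₃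
  · exact ⟨a, b, e, .inl (by rw [r₁, r₂, r₃, h]; abel)⟩
  · refine ⟨1 - a, 1 - b, 1 - e, .inr ?_⟩
    rw [r₁, r₂, r₃, h, sub_nsmul _ ha, sub_nsmul _ hb, sub_nsmul _ he, one_nsmul, one_nsmul,
      one_nsmul]
    abel

/-- A root adjacent to `d₁` is adjacent to all three `dᵢ`, which `root_eq_or_of_odd` treats.
Otherwise it is some `±dᵢ` or orthogonal to all of them; in the latter case it is orthogonal to `c`,
or `±c`, or, if adjacent to `c`, equal up to sign to the highest root `2c + d₁ + d₂ + d₃`. -/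
theorem root_mem_closure_or_pairingIn_eq_zero
    (hd₂ : ∀ k, Odd (P.pairingIn ℤ k d₁) ↔ Odd (P.pairingIn ℤ k d₂))
    (hd₃ : ∀ k, Odd (P.pairingIn ℤ k d₁) ↔ Odd (P.pairingIn ℤ k d₃)) (k : I) :
    (P.root k ∈ AddSubmonoid.closure (P.root '' {d₁, c, d₂, d₃}) ∨
      -P.root k ∈ AddSubmonoid.closure (P.root '' {d₁, c, d₂, d₃})) ∨
      ∀ i ∈ ({d₁, c, d₂, d₃} : Set I), P.pairingIn ℤ k i = 0 := by
  set K := AddSubmonoid.closure (P.root '' {d₁, c, d₂, d₃})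
  have m₁ : P.root d₁ ∈ K := AddSubmonoid.subset_closure ⟨d₁, by simp, rfl⟩
  have m₂ : P.root d₂ ∈ K := AddSubmonoid.subset_closure ⟨d₂, by simp, rfl⟩
  have m₃ : P.root d₃ ∈ K := AddSubmonoid.subset_closure ⟨d₃, by simp, rfl⟩
  have mc : P.root c ∈ K := AddSubmonoid.subset_closure ⟨c, by simp, rfl⟩
  by_cases hk₁ : Odd (P.pairingIn ℤ k d₁)
  · left
    obtain ⟨a, b, e, h⟩ := hP.root_eq_or_of_odd h₁₂ h₁₃ h₂₃ h₁ h₂ h₃ hk₁ ((hd₂ k).mp hk₁)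
      ((hd₃ k).mp hk₁)
    have : P.root c + a • P.root d₁ + b • P.root d₂ + e • P.root d₃ ∈ K :=
      add_mem (add_mem (add_mem mc (nsmul_mem m₁ a)) (nsmul_mem m₂ b)) (nsmul_mem m₃ e)
    obtain h | h := h
    · exact .inl (h ▸ this)
    · exact .inr (by rwa [h, neg_neg])
  have key : ∀ d, P.root d ∈ K → ¬ Odd (P.pairingIn ℤ k d) →
      (P.root k ∈ K ∨ -P.root k ∈ K) ∨ P.pairingIn ℤ k d = 0 := by
    intro d hd hk
    rw [hP.odd_pairingIn_iff] at hk
    have h₁ := hP.le_two k d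
    have h₂ := hP.neg_two_le k d
    obtain h | h | h : P.pairingIn ℤ k d = 2 ∨ P.pairingIn ℤ k d = -2 ∨ P.pairingIn ℤ k d = 0 := by
      omega
    · exact .inl (.inl (by rwa [hP.eq_of_pairingIn_eq_two h]))
    · exact .inl (.inr (by rwa [hP.eq_neg_of_pairingIn_eq_neg_two h, neg_neg]))
    · exact .inr h
  obtain h | k₁ := key d₁ m₁ hk₁
  · exact .inl h
  obtain h | k₂ := key d₂ m₂ (by rwa [← hd₂])
  · exact .inl h
  obtain h | k₃ := key d₃ m₃ (by rwa [← hd₃])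
  · exact .inl h
  have hmem : P.root c + P.root c + P.root d₁ + P.root d₂ + P.root d₃ ∈ K :=
    add_mem (add_mem (add_mem (add_mem mc mc) m₁) m₂) m₃
  by_cases hc : Odd (P.pairingIn ℤ k c)
  · left
    obtain h | h := (hP.odd_pairingIn_iff k c).mp hc
    · rw [hP.pairingIn_comm] at h
      obtain ⟨l, hl⟩ := P.exists_root_eq_sub h
      have e₁ := P.pairingIn_int_of_root_eq_sub hl d₁
      have e₂ := P.pairingIn_int_of_root_eq_sub hl d₂
      have e₃ := P.pairingIn_int_of_root_eq_sub hl d₃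
      obtain h' | h' := hP.root_eq_or_of_pairingIn_eq_neg_one h₁₂ h₁₃ h₂₃ h₁ h₂ h₃ (k := l)
        (by omega) (by omega) (by omega)
      · rw [hl, sub_eq_self] at h'
        exact absurd h' (P.ne_zero k)
      · left
        rw [hl] at h'
        convert hmem using 1
        rw [← sub_sub_self (P.root c) (P.root k), h']
        abel
    · rw [hP.pairingIn_comm] at h
      obtain ⟨l, hl⟩ := P.exists_root_eq_add h
      have e₁ := P.pairingIn_eq_add_of_root_eq_add (S := ℤ) (j := d₁) hl
      have e₂ := P.pairingIn_eq_add_of_root_eq_add (S := ℤ) (j := d₂) hl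
      have e₃ := P.pairingIn_eq_add_of_root_eq_add (S := ℤ) (j := d₃) hl
      obtain h' | h' := hP.root_eq_or_of_pairingIn_eq_neg_one h₁₂ h₁₃ h₂₃ h₁ h₂ h₃ (k := l)
        (by omega) (by omega) (by omega)
      · rw [hl, add_eq_left] at h'
        exact absurd h' (P.ne_zero k)
      · right
        rw [hl] at h'
        convert hmem using 1
        rw [← add_sub_cancel_left (P.root c) (P.root k), h']
        abel
  · obtain h | kc := key c mc hc
    · exact .inl h
    · right
      rintro i (rfl | rfl | rfl | rfl) <;> assumption

/-- Three mutually orthogonal roots that are adjacent to the same roots occur only in type `D₄`. -/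
theorem rootIsTypeD4 [P.IsRootSystem] [P.IsIrreducible] (hM : 4 ≤ Module.finrank ℝ M)
    (hd₂ : ∀ k, Odd (P.pairingIn ℤ k d₁) ↔ Odd (P.pairingIn ℤ k d₂))
    (hd₃ : ∀ k, Odd (P.pairingIn ℤ k d₁) ↔ Odd (P.pairingIn ℤ k d₃)) : RootIsTypeD4 P := by
  have hroot := hP.root_mem_closure_or_pairingIn_eq_zero h₁₂ h₁₃ h₂₃ h₁ h₂ h₃ hd₂ hd₃
  set s : Set I := {d₁, c, d₂, d₃} with hs
  have hle : ∀ z, z ∈ AddSubmonoid.closure (P.root '' s) → z ∈ Submodule.span ℝ (P.root '' s) :=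
    fun z hz => (AddSubmonoid.closure_le (S := (Submodule.span ℝ (P.root '' s)).toAddSubmonoid)).mpr
      Submodule.subset_span hz
  have hspan : Submodule.span ℝ (P.root '' s) = ⊤ := by
    refine P.span_root_image_eq_top_of_forall_orthogonal s ⟨c, by simp [hs]⟩ fun j hj i hi => ?_
    obtain (h | h) | h := hroot j
    · exact absurd (hle _ h) hj
    · exact absurd (neg_mem_iff.mp (hle _ h)) hj
    · exact hP.isOrthogonal_of_pairingIn_eq_zero (h i hi)
  have hmem : ∀ k, P.root k ∈ AddSubmonoid.closure (P.root '' s) ∨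
      -P.root k ∈ AddSubmonoid.closure (P.root '' s) := by
    intro k
    -- A root orthogonal to the spanning set `s` would be orthogonal to itself.
    refine (hroot k).resolve_right fun h => ?_
    have : Submodule.span ℝ (P.root '' s) ≤ LinearMap.ker (P.coroot' k) := by
      rw [Submodule.span_le]
      rintro _ ⟨i, hi, rfl⟩
      exact (hP.isOrthogonal_of_pairingIn_eq_zero (h i hi)).2
    rw [hspan] at this
    have := this (Submodule.mem_top (x := P.root k))
    rw [LinearMap.mem_ker, P.root_coroot'_eq_pairing, P.pairing_same] at this
    norm_num at this
  -- The branch node of `CartanMatrix.D 4` has index `1`, hence the position of `c`.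
  let w : Fin 4 → I := ![d₁, c, d₂, d₃]
  have hw : Set.range w = s := by
    ext i
    simp only [w, hs, Matrix.range_cons, Matrix.range_empty, Set.union_empty,
      Set.singleton_union]
  have : Module.Finite ℝ M := Module.finite_of_finrank_pos (by omega)
  have hspan' : ⊤ ≤ Submodule.span ℝ (Set.range (P.root ∘ w)) := by
    rw [Set.range_comp, hw, hspan]
  have hfin : Module.finrank ℝ M ≤ 4 := by
    have := finrank_range_le_card (R := ℝ) (P.root ∘ w)
    rw [Set.finrank, top_le_iff.mp hspan', finrank_top, Fintype.card_fin] at this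
    exact this
  have hli : LinearIndependent ℝ (P.root ∘ w) :=
    linearIndependent_of_top_le_span_of_card_eq_finrank hspan' (by
      rw [Fintype.card_fin]; omega)
  have hinj : Function.Injective w := hli.injective.of_comp
  have hlis : LinearIndepOn ℝ P.root s := by
    rw [← hw]
    exact (linearIndepOn_range_iff hinj P.root).mpr hli
  let b : P.Base := RootPairing.Base.mk' P s hlis hmem
  have hb : ∀ i, i ∈ b.support ↔ i ∈ Set.range w := by
    intro i
    rw [hw]
    simp [b, RootPairing.Base.mk']
  let e : Fin 4 ≃ b.support := Equiv.ofBijective (fun a => ⟨w a, (hb _).mpr ⟨a, rfl⟩⟩)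
    ⟨fun a a' h => hinj congr($(h).1), fun ⟨i, hi⟩ => by
      obtain ⟨a, rfl⟩ := (hb i).mp hi
      exact ⟨a, rfl⟩⟩
  refine ⟨b, e.symm, ?_⟩
  ext i j
  obtain ⟨a, rfl⟩ := e.surjective i
  obtain ⟨a', rfl⟩ := e.surjective j
  rw [Matrix.submatrix_apply, e.symm_apply_apply, e.symm_apply_apply]
  change P.pairingIn ℤ (w a) (w a') = _
  have g₁₂ := hP.pairingIn_comm d₁ d₂
  have g₁₃ := hP.pairingIn_comm d₁ d₃
  have g₂₃ := hP.pairingIn_comm d₂ d₃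
  have g₁ := hP.pairingIn_comm c d₁
  have g₂ := hP.pairingIn_comm c d₂
  have g₃ := hP.pairingIn_comm c d₃
  fin_cases a <;> fin_cases a' <;> simp [w, CartanMatrix.D] <;> omega

end

end RootIsSimplyLaced

end TypeD4

/-! ### Signs of the structure constants -/

section StructureConstants

variable {I : Type w₁} {M : Type w₂} {N : Type w₃} [AddCommGroup M] [Module ℝ M]
  [AddCommGroup N] [Module ℝ N] {P : RootPairing I ℝ M N} [P.IsCrystallographic]

theorem LinearIndependent.units_eq_of_smul_eq {L : Type*} [AddCommGroup L] [Module ℂ L] {e : I → L}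
    (he : LinearIndependent ℂ e) {k : I} {s t : ℤˣ} (h : (s : ℤ) • e k = (t : ℤ) • e k) :
    s = t := by
  rw [← Int.cast_smul_eq_zsmul ℂ, ← Int.cast_smul_eq_zsmul ℂ] at h
  exact Units.ext (Int.cast_injective (_root_.smul_left_injective ℂ (he.ne_zero k) h))

namespace IsStructureConstants

variable {c : I → I → ℤˣ} (hc : IsStructureConstants P c)

include hc

theorem swap {i j k : I} (hk : P.root k = P.root i + P.root j) : c j i = -c i j := by
  obtain ⟨L, _, _, e, h, he⟩ := hc
  refine he.linearIndependent.units_eq_of_smul_eq (k := k) ?_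
  rw [Units.val_neg, neg_smul, ← he.lie_e_e i j k hk,
    ← he.lie_e_e j i k (by rw [hk, add_comm]), lie_skew]

/-- This is the Jacobi identity for `e i`, `e j`, `e l`, where `⁅e i, e l⁆` vanishes; it provides
the sign condition of `rootBracket_mul_eq_iff`. -/
theorem mul_eq_mul {i j l d m k : I} (hd : P.root d = P.root i + P.root j)
    (hm : P.root m = P.root j + P.root l) (hk : P.root k = P.root i + P.root m)
    (h₀ : P.root i + P.root l ≠ 0) (h₁ : P.root i + P.root l ∉ Set.range P.root) :
    c i j * c d l = c j l * c i m := by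
  obtain ⟨L, _, _, e, h, he⟩ := hc
  refine he.linearIndependent.units_eq_of_smul_eq (k := k) ?_
  rw [Units.val_mul, Units.val_mul, mul_smul, mul_smul,
    ← he.lie_e_e d l k (by rw [hk, hd, hm, add_assoc]), ← he.lie_e_e i m k hk,
    ← zsmul_lie (e d), ← lie_zsmul (e i), ← he.lie_e_e i j d hd, ← he.lie_e_e j l m hm,
    leibniz_lie (e i), he.lie_e_e_eq_zero i l h₀ h₁, lie_zero, add_zero]

end IsStructureConstants

end StructureConstants

/-! ### Steinberg groups of root systems as root groups -/

section Steinberg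

variable {I : Type w₁} {M : Type w₂} {N : Type w₃} [AddCommGroup M] [Module ℝ M]
  [AddCommGroup N] [Module ℝ N]

/-- The nontrivial commutator relations of a root system with structure constants. -/
def RootPairing.mulRel (P : RootPairing I ℝ M N) (c : I → I → ℤˣ) (i j k : I) (s : ℤˣ) : Prop :=
  P.root k = P.root i + P.root j ∧ s = c i j

/-- The trivial commutator relations of a root system. -/
def RootPairing.comRel (P : RootPairing I ℝ M N) (i j : I) : Prop :=
  P.root i + P.root j ≠ 0 ∧ P.root i + P.root j ∉ Set.range P.root

variable {C : Type u} [Category.{v} C] [CartesianMonoidalCategory C] {R : C} [NonUnitalRingObj R]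
  (P : RootPairing I ℝ M N) (c : I → I → ℤˣ)

theorem steinbergRelations_iff {G : C} [GrpObj G] (x : I → (R ⟶ G)) :
    SteinbergRelations P c x ↔ RootRelations (P.mulRel c) P.comRel x where
  mp h :=
    { add := h.add
      commutator := by
        rintro i j k s ⟨hk, rfl⟩
        exact h.commutator i j k hk
      commute := fun i j hs => h.commute i j hs.1 hs.2 }
  mpr h :=
    { add := h.add
      commutator := fun i j k hk => h.commutator i j k _ ⟨hk, rfl⟩
      commute := fun i j h₀ h₁ => h.commute i j ⟨h₀, h₁⟩ }

theorem isSteinbergGroup_iff {G : C} [GrpObj G] (x : I → (R ⟶ G)) :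
    IsSteinbergGroup P c x ↔ IsRootGroup (P.mulRel c) P.comRel x where
  mp h :=
    { relations := (steinbergRelations_iff P c x).mp h.relations
      universal := fun H _ y hy => h.universal H y ((steinbergRelations_iff P c y).mpr hy) }
  mpr h :=
    { relations := (steinbergRelations_iff P c x).mpr h.relations
      universal := fun H _ y hy => h.universal H y ((steinbergRelations_iff P c y).mp hy) }

theorem exists_isSteinbergGroup [InfinitaryPretopos C] [Finite I] (R : C) [NonUnitalRingObj R] :
    ∃ (G : C) (_ : GrpObj G) (x : I → (R ⟶ G)), IsSteinbergGroup P c x := by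
  obtain ⟨G, hG, x, hx⟩ := exists_isRootGroup (P.mulRel c) P.comRel R
  exact ⟨G, hG, x, (isSteinbergGroup_iff P c x).mpr hx⟩

end Steinberg

/-! ### Decompositions of a root and roots with the same neighbors -/

section SimplyLaced

variable {I : Type w₁} {M : Type w₂} {N : Type w₃} [Finite I] [AddCommGroup M] [Module ℝ M]
  [AddCommGroup N] [Module ℝ N] {P : RootPairing I ℝ M N} [P.IsCrystallographic] [P.IsReduced]

/-- Two roots are adjacent to the same roots. -/
def RootPairing.SameNeighbors (P : RootPairing I ℝ M N) [P.IsCrystallographic] (i j : I) : Prop :=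
  ∀ k, Odd (P.pairingIn ℤ k i) ↔ Odd (P.pairingIn ℤ k j)

namespace RootIsSimplyLaced

variable (hP : RootIsSimplyLaced P)

include hP

theorem comRel_iff {i j : I} : P.comRel i j ↔ 0 ≤ P.pairingIn ℤ i j := by
  constructor
  · rintro ⟨h₀, h⟩
    by_contra! H
    have := hP.neg_two_le i j
    obtain h' | h' : P.pairingIn ℤ i j = -1 ∨ P.pairingIn ℤ i j = -2 := by omega
    · exact h (P.exists_root_eq_add h')
    · exact h₀ (by rw [hP.eq_neg_of_pairingIn_eq_neg_two h', neg_add_cancel])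
  · refine fun h => ⟨fun h₀ => ?_, fun ⟨k, hk⟩ => ?_⟩
    · have := P.pairingIn_int_of_root_eq_neg (eq_neg_of_add_eq_zero_left h₀) j
      rw [P.pairingIn_same] at this
      omega
    · have := hP.pairingIn_eq_neg_one hk
      omega

theorem pairingIn_add_pairingIn_eq_one {i j k t : I} (h : P.root t = P.root i + P.root j)
    (hk : P.pairingIn ℤ k t = 1) : P.pairingIn ℤ k i + P.pairingIn ℤ k j = 1 := by
  rw [← hP.pairingIn_add_right h, hk]

theorem pairingIn_eq_one_left {i j t : I} (h : P.root t = P.root i + P.root j) :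
    P.pairingIn ℤ i t = 1 := by
  rw [hP.pairingIn_add_right h, P.pairingIn_same, hP.pairingIn_eq_neg_one h]
  norm_num

theorem pairingIn_eq_one_right {i j t : I} (h : P.root t = P.root i + P.root j) :
    P.pairingIn ℤ j t = 1 :=
  hP.pairingIn_eq_one_left (h.trans (add_comm _ _))

theorem eq_zero_of_not_odd {i j : I} (h : ¬ Odd (P.pairingIn ℤ i j)) (h₁ : P.root i ≠ P.root j)
    (h₂ : P.root i ≠ -P.root j) : P.pairingIn ℤ i j = 0 := by
  rw [hP.odd_pairingIn_iff] at h
  have h₃ := hP.le_two i j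
  have h₄ := hP.neg_two_le i j
  have h₅ : P.pairingIn ℤ i j ≠ 2 := fun h => h₁ (by rw [hP.eq_of_pairingIn_eq_two h])
  have h₆ : P.pairingIn ℤ i j ≠ -2 := fun h => h₂ (hP.eq_neg_of_pairingIn_eq_neg_two h)
  omega

variable [P.IsRootSystem] [P.IsIrreducible] (hM : 4 ≤ Module.finrank ℝ M)

include hM

/-- A root with a decomposition has another decomposition with an adjacent summand. -/
theorem exists_decomposition {t i j : I} (h : P.root t = P.root i + P.root j) (z : M) :
    ∃ k l, P.root t = P.root k + P.root l ∧ P.pairingIn ℤ i k = 1 ∧ P.root k ≠ z ∧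
      P.root k ≠ -z := by
  obtain ⟨k, hk, hk'⟩ := hP.exists_pairingIn_eq_one hM t (P.root i) z
  rw [hP.pairingIn_comm] at hk
  obtain ⟨l, hl⟩ := P.exists_root_eq_sub hk
  have hit := hP.pairingIn_eq_one_left h
  have hl' := hP.pairingIn_sub_right hl i
  have ht : P.root t ∈ Submodule.span ℝ {P.root t, P.root i, z} :=
    Submodule.subset_span (by simp)
  have hi : P.root i ∈ Submodule.span ℝ {P.root t, P.root i, z} :=
    Submodule.subset_span (by simp)
  have hz : z ∈ Submodule.span ℝ {P.root t, P.root i, z} :=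
    Submodule.subset_span (by simp)
  have hkl : P.root k = P.root t - P.root l := by rw [hl, sub_sub_cancel]
  have h₁ : P.pairingIn ℤ i k ≠ 2 := fun h => by
    rw [← hP.eq_of_pairingIn_eq_two h] at hk'
    exact hk' hi
  have h₂ : P.pairingIn ℤ i l ≠ 2 := fun h => by
    rw [hkl, ← hP.eq_of_pairingIn_eq_two h] at hk'
    exact hk' (sub_mem ht hi)
  have h₃ := hP.le_two i k
  have h₄ := hP.le_two i l
  -- The two pairings add up to `1` and neither equals `2`. Neither `k` nor `l` is `±z`, since `k`
  -- lies outside the span of `t`, `i` and `z`.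
  obtain h | h : P.pairingIn ℤ i k = 1 ∨ P.pairingIn ℤ i l = 1 := by omega
  · refine ⟨k, l, by rw [hl, add_sub_cancel], h, fun e => hk' (e ▸ hz), fun e => hk' ?_⟩
    rw [e]
    exact neg_mem hz
  · refine ⟨l, k, by rw [hl, sub_add_cancel], h, fun e => hk' ?_, fun e => hk' ?_⟩
    · rw [hkl, e]
      exact sub_mem ht hz
    · rw [hkl, e, sub_neg_eq_add]
      exact add_mem ht hz

/-- Otherwise `j`, `k`, `m` would be mutually orthogonal with the same neighbors, and `-t` would
pair to `-1` with each of them, which is the configuration of `D₄`. -/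
theorem not_sameNeighbors_of_sameNeighbors (hD : ¬ RootIsTypeD4 P) {t i j k l m : I}
    (h : P.root t = P.root i + P.root j) (hk : P.root t = P.root k + P.root l)
    (hm : P.pairingIn ℤ m t = 1) (hik : P.pairingIn ℤ i k = 1) (him : P.pairingIn ℤ i m = 1)
    (hkm : P.root m ≠ P.root k) (hkm' : P.root m ≠ -P.root k)
    (hjk : P.SameNeighbors j k) : ¬ P.SameNeighbors j m := by
  intro hjm
  have h₁ := hP.pairingIn_add_right h k
  have h₂ := hP.pairingIn_add_right h m
  have h₃ := hP.pairingIn_comm i k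
  have h₄ := hP.pairingIn_comm i m
  have h₅ := hP.pairingIn_eq_one_left hk
  have h₆ := hP.pairingIn_comm j k
  have h₇ := hP.pairingIn_comm j m
  have h₈ := hP.pairingIn_comm k m
  have h₉ : P.pairingIn ℤ m k = 0 := by
    refine hP.eq_zero_of_not_odd ?_ hkm hkm'
    rw [← hjk m, show P.pairingIn ℤ m j = 0 by omega]
    simp
  obtain ⟨c, hc⟩ := P.exists_root_eq_neg t
  have g₁ := P.pairingIn_int_of_root_eq_neg hc j
  have g₂ := P.pairingIn_int_of_root_eq_neg hc k
  have g₃ := P.pairingIn_int_of_root_eq_neg hc m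
  have g₄ := hP.pairingIn_eq_one_right h
  have g₅ := hP.pairingIn_comm t j
  have g₆ := hP.pairingIn_comm t k
  have g₇ := hP.pairingIn_comm t m
  exact hD (hP.rootIsTypeD4 (d₁ := j) (d₂ := k) (d₃ := m) (c := c) (by omega) (by omega)
    (by omega) (by omega) (by omega) (by omega) hM hjk hjm)

end RootIsSimplyLaced

end SimplyLaced

/-! ### Central extensions in the simply laced case -/

section SteinbergExtensions

variable {I : Type w₁} {M : Type w₂} {N : Type w₃} [Finite I] [AddCommGroup M] [Module ℝ M]
  [AddCommGroup N] [Module ℝ N] {P : RootPairing I ℝ M N} [P.IsCrystallographic] [P.IsReduced]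
  (hP : RootIsSimplyLaced P) {c : I → I → ℤˣ}
  {C : Type u} [Category.{v} C] [CartesianMonoidalCategory C] [InfinitaryPretopos C]
  {R : C} [NonUnitalRingObj R] {E : Subobject R} (hE : IsWeakUnit E)
  {X G : C} [GrpObj X] [GrpObj G] {x : I → (R ⟶ G)}
  (hx : RootRelations (P.mulRel c) P.comRel x) {f : X ⟶ G} (hf : IsCentralExtension f)

namespace RootIsSimplyLaced

include hP hE hx hf

theorem liftsCommute_of_root_eq_add {i j k l : I} (h : P.root i = P.root k + P.root l)
    (hk : 0 ≤ P.pairingIn ℤ k j) (hl : 0 ≤ P.pairingIn ℤ l j) : LiftsCommute f (x i) (x j) :=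
  liftsCommute_of_mulRel hE hx hf ⟨h, rfl⟩ (hP.comRel_iff.mpr hk) (hP.comRel_iff.mpr hl)

/-- Up to sign, `k` is a summand of `i`, and both it and the other summand are orthogonal to `j`. -/
theorem liftsCommute_of_odd {i j k : I} (h : P.pairingIn ℤ i j = 0)
    (hi : Odd (P.pairingIn ℤ k i)) (hj : ¬ Odd (P.pairingIn ℤ k j)) :
    LiftsCommute f (x i) (x j) := by
  have hkj : P.pairingIn ℤ k j = 0 := by
    refine hP.eq_zero_of_not_odd hj (fun e => ?_) fun e => ?_
    · rw [P.root.injective e, hP.pairingIn_comm, h] at hi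
      simp at hi
    · rw [P.pairingIn_int_of_root_eq_neg e, hP.pairingIn_comm, h] at hi
      simp at hi
  obtain ⟨m, hm, hm'⟩ : ∃ m, P.pairingIn ℤ m i = 1 ∧ P.pairingIn ℤ m j = 0 := by
    obtain h' | h' := (hP.odd_pairingIn_iff k i).mp hi
    · exact ⟨k, h', hkj⟩
    · obtain ⟨m, hm⟩ := P.exists_root_eq_neg k
      refine ⟨m, ?_, ?_⟩
      · rw [P.pairingIn_int_of_root_eq_neg hm, h', neg_neg]
      · rw [P.pairingIn_int_of_root_eq_neg hm, hkj, neg_zero]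
  rw [hP.pairingIn_comm] at hm
  obtain ⟨l, hl⟩ := P.exists_root_eq_sub hm
  refine hP.liftsCommute_of_root_eq_add hE hx hf (k := m) (l := l)
    (by rw [hl, add_sub_cancel]) hm'.ge ?_
  rw [P.pairingIn_int_of_root_eq_sub hl, h, hm', sub_zero]

theorem liftsCommute_of_not_sameNeighbors {i j : I} (h : P.pairingIn ℤ i j = 0)
    (hij : ¬ P.SameNeighbors i j) : LiftsCommute f (x i) (x j) := by
  obtain ⟨k, hk⟩ := not_forall.mp hij
  by_cases hi : Odd (P.pairingIn ℤ k i)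
  · exact hP.liftsCommute_of_odd hE hx hf h hi (by tauto)
  · exact (hP.liftsCommute_of_odd hE hx hf (k := k) (by rwa [hP.pairingIn_comm]) (by tauto)
      hi).symm

variable [P.IsRootSystem] [P.IsIrreducible] (hM : 4 ≤ Module.finrank ℝ M)

include hM

/-- Split `i = k + l` with `k` outside the span of `i` and `j`. Neither summand equals `j`, so both
pair to at most `1` with `j`; their pairings have positive sum and are therefore nonnegative. -/
theorem liftsCommute_of_pos {i j : I} (h : 0 < P.pairingIn ℤ i j) :
    LiftsCommute f (x i) (x j) := by
  obtain ⟨k, hk, hk'⟩ := hP.exists_pairingIn_eq_one hM i (P.root j) 0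
  have hki := hP.pairingIn_comm k i
  obtain ⟨l, hl⟩ := P.exists_root_eq_sub (hki.symm.trans hk)
  have hlj := P.pairingIn_int_of_root_eq_sub hl j
  have hkl : P.root k = P.root i - P.root l := by rw [hl, sub_sub_cancel]
  have hi : P.root i ∈ Submodule.span ℝ {P.root i, P.root j, 0} :=
    Submodule.subset_span (by simp)
  have hj : P.root j ∈ Submodule.span ℝ {P.root i, P.root j, 0} :=
    Submodule.subset_span (by simp)
  have h₁ : P.pairingIn ℤ k j ≠ 2 := fun h => by
    rw [hP.eq_of_pairingIn_eq_two h] at hk'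
    exact hk' hj
  have h₂ : P.pairingIn ℤ l j ≠ 2 := fun h => by
    rw [hkl, hP.eq_of_pairingIn_eq_two h] at hk'
    exact hk' (sub_mem hi hj)
  have h₃ := hP.le_two k j
  have h₄ := hP.le_two l j
  have h₅ := hP.le_two i j
  by_cases hij : P.pairingIn ℤ i j = 2
  · rw [hP.eq_of_pairingIn_eq_two hij] at hki hl hk
    have := P.pairingIn_int_of_root_eq_sub hl j
    rw [P.pairingIn_same] at this
    exact hP.liftsCommute_of_root_eq_add hE hx hf (k := k) (l := l)
      (by rw [hl, add_sub_cancel, hP.eq_of_pairingIn_eq_two hij]) (by omega) (by omega)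
  · exact hP.liftsCommute_of_root_eq_add hE hx hf (k := k) (l := l)
      (by rw [hl, add_sub_cancel]) (by omega) (by omega)

variable (hc : IsStructureConstants P c)

include hc

/-- The root `m = k - i` gives the triple `i, m, l` with `i + m = k` and `m + l = j`. The other
commutations involve roots with positive pairing; that of the orthogonal roots `k` and `j` has to be
assumed. -/
theorem rootBracket_mul_eq {t i j k l : I} (h : P.root t = P.root i + P.root j)
    (h' : P.root t = P.root k + P.root l) (hik : P.pairingIn ℤ i k = 1)
    (hkj : LiftsCommute f (x k) (x j)) {T : C} (p q r : T ⟶ R) :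
    rootBracket hf x i j (c i j) p (q * r) = rootBracket hf x k l (c k l) (p * q) r := by
  obtain ⟨m, hm⟩ := P.exists_root_eq_sub (i := k) (j := i) (by rw [hP.pairingIn_comm, hik])
  have h₁ : P.root k = P.root i + P.root m := by rw [hm, add_sub_cancel]
  have h₂ : P.root j = P.root m + P.root l := by
    rw [hm, ← sub_eq_zero, ← sub_eq_zero.mpr (h.symm.trans h')]
    abel
  have hil : P.comRel i l := by
    have e₁ := hP.pairingIn_add_right h' i
    have e₂ := hP.pairingIn_eq_one_left h
    exact hP.comRel_iff.mpr (by omega)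
  have htj := hP.pairingIn_comm t j
  rw [hP.pairingIn_eq_one_right h] at htj
  have htk := hP.pairingIn_comm t k
  rw [hP.pairingIn_eq_one_left h'] at htk
  exact _root_.rootBracket_mul_eq hx hf ⟨h₁, rfl⟩ ⟨h₂, rfl⟩ ⟨h, rfl⟩ ⟨h', rfl⟩
    (hc.mul_eq_mul h₁ h₂ h hil.1 hil.2) hil
    (hP.liftsCommute_of_pos hE hx hf hM (by rw [P.pairingIn_same]; norm_num))
    (hP.liftsCommute_of_pos hE hx hf hM (by omega))
    (hP.liftsCommute_of_pos hE hx hf hM (by omega)) hkj p q r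

variable (hD : ¬ RootIsTypeD4 P) (hcomm : ∀ (T : C) (p q : T ⟶ R), p * q = q * p)

include hD hcomm

theorem exists_rootBracket_eq {t i j : I} (h : P.root t = P.root i + P.root j) :
    ∃ y : R ⟶ X, ∀ {T : C} (p q : T ⟶ R), rootBracket hf x i j (c i j) p q = (p * q) ≫ y := by
  have hjt := hP.pairingIn_comm t i
  rw [hP.pairingIn_eq_one_left h] at hjt
  have key : ∀ k l, P.root t = P.root k + P.root l → P.pairingIn ℤ i k = 1 →
      ¬ P.SameNeighbors j k → ∃ y : R ⟶ X, ∀ {T : C} (p q : T ⟶ R),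
        rootBracket hf x i j (c i j) p q = (p * q) ≫ y := by
    intro k l hkl hik hjk
    have hjk' : P.pairingIn ℤ j k = 0 := by
      have e₁ := P.pairingIn_eq_add_of_root_eq_add (S := ℤ) (j := k) h
      have e₂ := hP.pairingIn_eq_one_left hkl
      have e₃ := hP.pairingIn_comm k t
      omega
    exact exists_comp_eq_rootBracket hE hx hf ⟨h, rfl⟩
      (hP.liftsCommute_of_pos hE hx hf hM (by omega))
      (hP.liftsCommute_of_pos hE hx hf hM (by rw [P.pairingIn_same]; norm_num))
      (rootBracket_balanced_of_comm hE hf hcomm fun p q r =>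
        hP.rootBracket_mul_eq hE hx hf hM hc h hkl hik
          (hP.liftsCommute_of_not_sameNeighbors hE hx hf hjk' hjk).symm p q r)
  -- If `k` has the same neighbors as `j`, a second decomposition away from `±k` works, because `D₄`
  -- is excluded.
  obtain ⟨k, l, hkl, hik, -, -⟩ := hP.exists_decomposition hM h 0
  by_cases hjk : P.SameNeighbors j k
  · obtain ⟨m, n, hmn, him, hm, hm'⟩ := hP.exists_decomposition hM h (P.root k)
    exact key m n hmn him (hP.not_sameNeighbors_of_sameNeighbors hM hD h hkl
      (hP.pairingIn_eq_one_left hmn) hik him hm hm' hjk)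
  · exact key k l hkl hik hjk

theorem rootBracket_comm {t i j : I} (h : P.root t = P.root i + P.root j) {T : C}
    (p q : T ⟶ R) : rootBracket hf x j i (c j i) p q = rootBracket hf x i j (c i j) p q := by
  obtain ⟨y, hy⟩ := hP.exists_rootBracket_eq hE hx hf hM hc hD hcomm h
  rw [hc.swap h, rootBracket_swap, hy, hy, hcomm]

theorem rootBracket_eq_of_pairingIn_eq_one {t i j k l : I} (h : P.root t = P.root i + P.root j)
    (h' : P.root t = P.root k + P.root l) (hik : P.pairingIn ℤ i k = 1) {T : C} (p q : T ⟶ R) :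
    rootBracket hf x i j (c i j) p q = rootBracket hf x k l (c k l) p q := by
  have key : ∀ i j k l : I, P.root t = P.root i + P.root j → P.root t = P.root k + P.root l →
      P.pairingIn ℤ i k = 1 → ¬ P.SameNeighbors j k →
      rootBracket hf x i j (c i j) p q = rootBracket hf x k l (c k l) p q := by
    intro i j k l h hkl hik hjk
    have hjk' : P.pairingIn ℤ j k = 0 := by
      have e₁ := P.pairingIn_eq_add_of_root_eq_add (S := ℤ) (j := k) h
      have e₂ := hP.pairingIn_eq_one_left hkl
      have e₃ := hP.pairingIn_comm k t
      omega
    exact rootBracket_eq_of_comm hE hf hcomm (fun p q r =>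
      hP.rootBracket_mul_eq hE hx hf hM hc h hkl hik
        (hP.liftsCommute_of_not_sameNeighbors hE hx hf hjk' hjk).symm p q r) p q
  -- In the bad case the comparison goes through a third decomposition `t = m + n`, where `m`
  -- differs in neighbors from both `j` and `k` and pairs to `1` with `i` and with `l`.
  by_cases hjk : P.SameNeighbors j k
  · obtain ⟨m, n, hmn, him, hm, hm'⟩ := hP.exists_decomposition hM h (P.root k)
    have hjm := hP.not_sameNeighbors_of_sameNeighbors hM hD h h' (hP.pairingIn_eq_one_left hmn)
      hik him hm hm' hjk
    have hkm : ¬ P.SameNeighbors k m := fun hkm => hjm fun a => (hjk a).trans (hkm a)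
    have hlm : P.pairingIn ℤ l m = 1 := by
      have e₁ := hP.pairingIn_add_right h m
      have e₂ := hP.pairingIn_add_right h' m
      have e₃ := hP.pairingIn_comm i m
      have e₄ := hP.pairingIn_eq_one_left hmn
      have e₅ := hP.pairingIn_comm l m
      have e₆ : P.pairingIn ℤ m k = 0 := by
        refine hP.eq_zero_of_not_odd ?_ hm hm'
        rw [← hjk m, show P.pairingIn ℤ m j = 0 by omega]
        simp
      omega
    rw [key i j m n h hmn him hjm, ← key l k m n (h'.trans (add_comm _ _)) hmn hlm hkm,
      hP.rootBracket_comm hE hx hf hM hc hD hcomm h']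
  · exact key i j k l h h' hik hjk

theorem rootBracket_eq {t i j k l : I} (h : P.root t = P.root i + P.root j)
    (h' : P.root t = P.root k + P.root l) {T : C} (p q : T ⟶ R) :
    rootBracket hf x i j (c i j) p q = rootBracket hf x k l (c k l) p q := by
  have e₁ := hP.pairingIn_add_pairingIn_eq_one h' (hP.pairingIn_eq_one_left h)
  have e₂ := hP.le_two i k
  have e₃ := hP.le_two i l
  have heq : ∀ k l : I, P.root t = P.root k + P.root l → P.pairingIn ℤ i k = 2 →
      rootBracket hf x i j (c i j) p q = rootBracket hf x k l (c k l) p q := by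
    intro k l h' hik
    obtain rfl := hP.eq_of_pairingIn_eq_two hik
    obtain rfl := P.root.injective (add_left_cancel (h.symm.trans h'))
    rfl
  have h'' : P.root t = P.root l + P.root k := h'.trans (add_comm _ _)
  obtain hk | hk | hl | hl : P.pairingIn ℤ i k = 2 ∨ P.pairingIn ℤ i k = 1 ∨
      P.pairingIn ℤ i l = 1 ∨ P.pairingIn ℤ i l = 2 := by omega
  · exact heq k l h' hk
  · exact hP.rootBracket_eq_of_pairingIn_eq_one hE hx hf hM hc hD hcomm h h' hk p q
  · rw [hP.rootBracket_eq_of_pairingIn_eq_one hE hx hf hM hc hD hcomm h h'' hl p q,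
      hP.rootBracket_comm hE hx hf hM hc hD hcomm h']
  · rw [heq l k h'' hl, hP.rootBracket_comm hE hx hf hM hc hD hcomm h']

/-- The Hall–Witt criterion is used backwards. For `i = k + m`, `j = m + l` and `t = k + m + l`, the
two bracketings are already known to agree, so the commutators `⁅A, B⁆` and `⁅B, D⁆` commute.
Choosing arguments with a common middle factor makes these commutators lifts of the given values of
`x i` and `x j`. -/
theorem liftsCommute_of_sameNeighbors {i j : I} (h : P.pairingIn ℤ i j = 0)
    (hij : P.SameNeighbors i j) : LiftsCommute f (x i) (x j) := by
  have := hf.isMonHom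
  obtain ⟨m, hmi, hmj⟩ : ∃ m, P.pairingIn ℤ m i = 1 ∧ P.pairingIn ℤ m j = 1 := by
    obtain ⟨k, hk, -⟩ := hP.exists_pairingIn_eq_one hM i 0 0
    have hkj := (hij k).mp (by rw [hk]; exact odd_one)
    obtain hkj | hkj := (hP.odd_pairingIn_iff k j).mp hkj
    · exact ⟨k, hk, hkj⟩
    -- If `k` pairs to `-1` with `j`, then `i - k` pairs to `1` with both roots, since `i` and `j`
    -- are orthogonal.
    · obtain ⟨m, hm⟩ := P.exists_root_eq_sub (i := i) (j := k) (by rw [hP.pairingIn_comm, hk])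
      refine ⟨m, ?_, ?_⟩
      · rw [P.pairingIn_int_of_root_eq_sub hm, P.pairingIn_same, hk]
        norm_num
      · rw [P.pairingIn_int_of_root_eq_sub hm, h, hkj]
        norm_num
  have him := hP.pairingIn_comm i m
  have hjm := hP.pairingIn_comm j m
  obtain ⟨k, hk⟩ := P.exists_root_eq_sub (i := i) (j := m) (by omega)
  obtain ⟨l, hl⟩ := P.exists_root_eq_sub (i := j) (j := m) (by omega)
  have hkj := P.pairingIn_int_of_root_eq_sub hk j
  obtain ⟨t, ht⟩ := P.exists_root_eq_add (i := k) (j := j) (by omega)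
  have h₁ : P.root i = P.root k + P.root m := by rw [hk, sub_add_cancel]
  have h₂ : P.root j = P.root m + P.root l := by rw [hl, add_sub_cancel]
  have h₃ : P.root t = P.root i + P.root l := by rw [ht, h₁, h₂, add_assoc]
  have hkl : P.comRel k l := by
    have e₁ := P.pairingIn_int_of_root_eq_sub hk m
    have e₂ := hP.pairingIn_sub_right hl k
    rw [P.pairingIn_same] at e₁
    exact hP.comRel_iff.mpr (by omega)
  have htj := hP.pairingIn_eq_one_right ht
  have hti := hP.pairingIn_eq_one_left h₃
  have htj' := hP.pairingIn_comm t j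
  have hti' := hP.pairingIn_comm t i
  intro T a b p q ha hb
  refine Locally.eq ((hE.exists_mul_eq_eq_mul ((c k m : ℤ) • p) ((c m l : ℤ) • q)).bind ?_)
  rintro T' g ⟨p', q', r', hp, hq⟩
  refine (((hf.exists_lift (p' ≫ x k)).and (hf.exists_lift (q' ≫ x m))).and
    (hf.exists_lift (r' ≫ x l))).mono ?_
  rintro T'' g' ⟨⟨⟨A, hA⟩, ⟨B, hB⟩⟩, ⟨D, hD'⟩⟩
  rw [← Category.assoc] at hA hB hD'
  have hAB : ((g' ≫ g) ≫ a) ≫ f = ⁅A, B⁆ ≫ f := by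
    rw [MonObj.commutatorElement_comp, hA, hB, hx.commutator k m i _ ⟨h₁, rfl⟩,
      ← NonUnitalRingObj.comp_mul, hp, ← NonUnitalRingObj.comp_zsmul,
      ← NonUnitalRingObj.comp_zsmul, units_smul_units_smul, Category.assoc, ha]
    simp only [Category.assoc]
  have hBD : ((g' ≫ g) ≫ b) ≫ f = ⁅B, D⁆ ≫ f := by
    rw [MonObj.commutatorElement_comp, hB, hD', hx.commutator m l j _ ⟨h₂, rfl⟩,
      ← NonUnitalRingObj.comp_mul, hq, ← NonUnitalRingObj.comp_zsmul,
      ← NonUnitalRingObj.comp_zsmul, units_smul_units_smul, Category.assoc, hb]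
    simp only [Category.assoc]
  obtain ⟨y, hy⟩ := hP.exists_rootBracket_eq hE hx hf hM hc hD hcomm ht
  have hcom : Commute ⁅A, B⁆ ⁅B, D⁆ := by
    rw [← rootBracket_mul_eq_iff hx hf ⟨h₁, rfl⟩ ⟨h₂, rfl⟩ ⟨ht, rfl⟩ ⟨h₃, rfl⟩
      (hc.mul_eq_mul h₁ h₂ ht hkl.1 hkl.2) hkl
      (hP.liftsCommute_of_pos hE hx hf hM (by rw [P.pairingIn_same]; norm_num))
      (hP.liftsCommute_of_pos hE hx hf hM (by omega))
      (hP.liftsCommute_of_pos hE hx hf hM (by omega)) _ _ _ hA hB hD',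
      ← hP.rootBracket_eq hE hx hf hM hc hD hcomm ht h₃, hy, hy, mul_assoc]
  rw [MonObj.comp_mul, MonObj.comp_mul]
  have := hf.commutatorElement_congr hAB hBD
  rw [commutatorElement_eq_one_iff_commute.mpr hcom, commutatorElement_eq_one_iff_mul_comm] at this
  exact this

theorem liftsCommute {i j : I} (h : P.comRel i j) : LiftsCommute f (x i) (x j) := by
  obtain h | h := (hP.comRel_iff.mp h).eq_or_lt
  · by_cases hij : P.SameNeighbors i j
    · exact hP.liftsCommute_of_sameNeighbors hE hx hf hM hc hD hcomm h.symm hij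
    · exact hP.liftsCommute_of_not_sameNeighbors hE hx hf h.symm hij
  · exact hP.liftsCommute_of_pos hE hx hf hM h

end RootIsSimplyLaced

end SteinbergExtensions

theorem centrallyClosed_of_isSteinbergGroup {I : Type w₁} {M : Type w₂} {N : Type w₃} [Finite I]
    [AddCommGroup M] [Module ℝ M] [AddCommGroup N] [Module ℝ N] {P : RootPairing I ℝ M N}
    [P.IsCrystallographic] [P.IsReduced] [P.IsRootSystem] [P.IsIrreducible]
    (hP : RootIsSimplyLaced P) (hM : 4 ≤ Module.finrank ℝ M) (hD : ¬ RootIsTypeD4 P)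
    {c : I → I → ℤˣ} (hc : IsStructureConstants P c)
    {C : Type u} [Category.{v} C] [CartesianMonoidalCategory C] [InfinitaryPretopos C]
    {R : C} [NonUnitalRingObj R] (hR : WeaklyUnital R)
    (hcomm : ∀ (T : C) (p q : T ⟶ R), p * q = q * p) {G : C} [GrpObj G] {x : I → (R ⟶ G)}
    (hx : IsSteinbergGroup P c x) : CentrallyClosed G := by
  obtain ⟨E, hE⟩ := hR
  intro X _ f hf
  rw [isSteinbergGroup_iff] at hx
  have hr := hx.relations
  have hdec : ∀ t, ∃ i j, P.root t = P.root i + P.root j := by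
    intro t
    obtain ⟨i, hi, -⟩ := hP.exists_pairingIn_eq_one hM t 0 0
    rw [hP.pairingIn_comm] at hi
    obtain ⟨j, hj⟩ := P.exists_root_eq_sub hi
    exact ⟨i, j, by rw [hj, add_sub_cancel]⟩
  refine hx.exists_section hE hf (fun t => ?_) (fun t => ?_)
    (fun i j h => hP.liftsCommute hE hr hf hM hc hD hcomm h) fun t => ?_
  · obtain ⟨i, j, h⟩ := hdec t
    have h₁ := hP.pairingIn_eq_one_left h
    have h₂ := hP.pairingIn_comm i t
    exact ⟨i, j, c i j, ⟨h, rfl⟩, hP.liftsCommute_of_pos hE hr hf hM (by omega)⟩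
  · exact hP.liftsCommute_of_pos hE hr hf hM (by rw [P.pairingIn_same]; norm_num)
  · obtain ⟨i, j, h⟩ := hdec t
    obtain ⟨y, hy⟩ := hP.exists_rootBracket_eq hE hr hf hM hc hD hcomm h
    refine ⟨y, ?_⟩
    rintro k l s ⟨h', rfl⟩ T p q
    rw [← hy, hP.rootBracket_eq hE hr hf hM hc hD hcomm h' h]

theorem mainTheorem7 {C : Type u} [Category.{v} C] [CartesianMonoidalCategory C]
    [InfinitaryPretopos C] (R : C) [NonUnitalRingObj R] (hR : WeaklyUnital R) :
    (∀ ℓ : ℕ, 4 ≤ ℓ →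
      (∃ (G : C) (_ : GrpObj G) (x : ∀ i j : Fin (ℓ + 1), i ≠ j → (R ⟶ G)),
        IsLinearSteinbergGroup x) ∧
      ∀ (G : C) [GrpObj G] (x : ∀ i j : Fin (ℓ + 1), i ≠ j → (R ⟶ G)),
        IsLinearSteinbergGroup x → CentrallyClosed G) ∧
    ((∀ (T : C) (p q : T ⟶ R), p * q = q * p) →
      ∀ (I : Type w₁) (M : Type w₂) (N : Type w₃) [Finite I]
        [AddCommGroup M] [Module ℝ M] [AddCommGroup N] [Module ℝ N]
        (P : RootPairing I ℝ M N) [P.IsRootSystem] [P.IsCrystallographic] [P.IsReduced]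
        [P.IsIrreducible],
        RootIsSimplyLaced P → 4 ≤ Module.finrank ℝ M → ¬ RootIsTypeD4 P →
        ∀ c : I → I → ℤˣ, IsStructureConstants P c →
          (∃ (G : C) (_ : GrpObj G) (x : I → (R ⟶ G)), IsSteinbergGroup P c x) ∧
          ∀ (G : C) [GrpObj G] (x : I → (R ⟶ G)),
            IsSteinbergGroup P c x → CentrallyClosed G) := by
  refine ⟨fun ℓ hℓ => ⟨exists_isLinearSteinbergGroup (ℓ + 1) R, fun G _ x hx =>
    centrallyClosed_of_isLinearSteinbergGroup hR (by omega) hx⟩, ?_⟩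
  intro hcomm I M N _ _ _ _ _ P _ _ _ _ hP hM hD c hc
  exact ⟨exists_isSteinbergGroup P c R, fun G _ x hx =>
    centrallyClosed_of_isSteinbergGroup hP hM hD hc hR hcomm hx⟩
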